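/- **Setting.** Let $(E,\mathcal E)$ be a measurable space and $(P_t)_{t\ge 0}$ a Markov semigroup on it, $P_tf(x)=\int f(y)\,P_t(x,dy)$ with Markov kernels $P_t(x,dy)$, $P_0=\mathrm{Id}$, $P_{s+t}=P_sP_t$. Its generator is $Lf(x)=\lim_{h\to0^+}\frac{P_hf(x)-f(x)}h$; a bounded measurable $f$ is in the domain of $L$ if these difference quotients are uniformly bounded and converge at every point. Let $\mathcal A$ be an algebra of functions on $E$, containing the constants and contained in the domain of $L$, that is stable under $L$, under every $P_t$, and under $f\mapsto\phi(f)$ for $\phi\in C^\infty(\mathbb R)$. Put $\Gamma(f,g)=\frac12\big(L(fg)-fLg-gLf\big)$, $\Gamma(f)=\Gamma(f,f)$, $\Gamma_2(f)=\frac12\big(L\Gamma(f)-2\Gamma(f,Lf)\big)$, and assume that $L$ is a diffusion: $L\phi(f)=\phi'(f)Lf+\phi''(f)\Gamma(f)$ for all $f\in\mathcal A$, $\phi\in C^\infty(\mathbb R)$. For positive $f$ let $\mathrm{Ent}_{P_t}(f)=P_t(f\log f)-P_tf\log P_tf$. All inequalities below hold at every point of $E$. **Theorem.** For every real $n\ge1$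 the following are equivalent. (i) $CD(0,n)$: $\Gamma_2(f)\ge\frac1n(Lf)^2$ for all $f\in\mathcal A$. (ii) For all $t\ge0$ and all positive $f\in\mathcal A$ with $\log f\in\mathcal A$ (equivalently $\inf f>0$), one has $1-\frac{2t}{n}\frac{P_t(fL(\log f))}{P_tf}>0$ and $$\mathrm{Ent}_{P_t}(f)\le t\,LP_tf+\frac n2\,P_tf\,\log\Big(1-\frac{2t}{n}\frac{P_t(fL(\log f))}{P_tf}\Big).$$ (iii) For all $1<q_1<q_2$, $u_1,u_2>0$ and $t>s\ge0$ with $t-s=u_1q_1-u_2q_2$, and all positive $f\in\mathcal A$, $$\big(P_{u_2}((P_{t-s}f)^{q_2})\big)^{1/q_2}\le\big(P_{u_1}(f^{q_1})\big)^{1/q_1}M^{n/2},$$ $$M=\Big(\frac{q_1-1}{u_2}\Big)^{1-\frac1{q_1}}\Big(\frac{q_2-1}{u_1}\Big)^{\frac1{q_2}-1}\Big(\frac{u_1q_1-u_2q_2}{q_2-q_1}\Big)^{\frac1{q_2}-\frac1{q_1}}.$$ (iv) For all $q_1,q_2$ with $0<q_2<q_1<1$ or $q_2<q_1<0$, all $u_1,u_2>0$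 and $t>s\ge0$ with $t-s=u_1q_1-u_2q_2$, and all positive $f\in\mathcal A$, $$\big(P_{u_1}(f^{q_1})\big)^{1/q_1}\le\big(P_{u_2}((P_{t-s}f)^{q_2})\big)^{1/q_2}N^{n/2},$$ $$N=\Big(\frac{1-q_1}{u_2}\Big)^{\frac1{q_1}-1}\Big(\frac{1-q_2}{u_1}\Big)^{1-\frac1{q_2}}\Big(\frac{u_1q_1-u_2q_2}{q_1-q_2}\Big)^{\frac1{q_1}-\frac1{q_2}}$$ (for negative $q$ an infinite integral is allowed, with $\infty^{1/q}=0$). **Sharpness.** Let $d\ge1$ be an integer and let $P_t(x,\cdot)$ be the Euclidean heat kernel on $\mathbb R^d$, i.e. the law of $x+\sqrt{2t}\,Y$ with $Y$ a standard Gaussian vector. This is a Markov semigroup which, with $\mathcal A=C_b^\infty(\mathbb R^d)$ (smooth functions bounded together with all their derivatives), satisfies the above assumptions, with $L=\Delta$ on $\mathcal A$, and it satisfies $CD(0,d)$. For all parameters as in (iii), respectively (iv), the function $f(x)=e^{a|x|^2}$ with $a=\frac{t-s+u_2-u_1}{4u_1(t-s)(q_1-1)}$ gives equality (with $n=d$)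 in the inequality of (iii), respectively (iv), at every $x\in\mathbb R^d$, both sides being finite and positive. -/

import Mathlib

open MeasureTheory ProbabilityTheory Filter Topology
open scoped NNReal ENNReal ContDiff

noncomputable section

namespace MarkovSG

variable {E : Type*} [MeasurableSpace E]

/-- A Markov semigroup on `E`, given by its transition kernels `κ t x = P_t(x, dy)`. -/
structure IsMarkov (κ : ℝ≥0 → Kernel E E) : Prop where
  markov : ∀ t, IsMarkovKernel (κ t)
  zero : κ 0 = Kernel.id
  add : ∀ s t, κ (s + t) = κ s ∘ₖ κ t

/-- The operator `P_t f (x) = ∫ f(y) P_t(x, dy)`. -/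
def P (κ : ℝ≥0 → Kernel E E) (t : ℝ≥0) (f : E → ℝ) (x : E) : ℝ := ∫ y, f y ∂(κ t x)

/-- The infinitesimal generator `L f (x) = lim_{h → 0+} (P_h f (x) - f (x)) / h`
(meaningful for `f` in the domain, see `InDomain`). -/
def L (κ : ℝ≥0 → Kernel E E) (f : E → ℝ) (x : E) : ℝ :=
  limUnder (𝓝[>] (0 : ℝ≥0)) (fun h : ℝ≥0 => (P κ h f x - f x) / h)

/-- The domain of the generator: bounded measurable functions whose difference quotients
`(P_h f - f) / h` are uniformly bounded and converge pointwise as `h → 0+`. -/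
structure InDomain (κ : ℝ≥0 → Kernel E E) (f : E → ℝ) : Prop where
  measurable : Measurable f
  bounded : ∃ C : ℝ, ∀ x, |f x| ≤ C
  quotient_bounded : ∃ C : ℝ, ∀ (h : ℝ≥0) (x : E), |P κ h f x - f x| ≤ C * h
  tendsto : ∀ x, ∃ l : ℝ,
    Tendsto (fun h : ℝ≥0 => (P κ h f x - f x) / h) (𝓝[>] (0 : ℝ≥0)) (𝓝 l)

/-- The carré du champ `Γ(f, g) = (L(fg) - f Lg - g Lf) / 2`. -/
def Gam (κ : ℝ≥0 → Kernel E E) (f g : E → ℝ) (x : E) : ℝ :=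
  (L κ (fun y => f y * g y) x - f x * L κ g x - g x * L κ f x) / 2

/-- The iterated operator `Γ₂(f) = (L Γ(f) - 2 Γ(f, Lf)) / 2`. -/
def Gam2 (κ : ℝ≥0 → Kernel E E) (f : E → ℝ) (x : E) : ℝ :=
  (L κ (Gam κ f f) x - 2 * Gam κ f (L κ f) x) / 2

/-- `A` is a nice algebra for the semigroup, on which its generator is a diffusion operator:
`A` is an algebra of functions (with constants) in the domain of `L`, stable under `L`, under
all `P_t` and under composition with smooth functions `φ : ℝ → ℝ`, and
`L φ(f) = φ'(f) L f + φ''(f) Γ(f)` for `f ∈ A`. -/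
structure IsDiffusion (κ : ℝ≥0 → Kernel E E) (A : Subalgebra ℝ (E → ℝ)) : Prop where
  domain : ∀ f ∈ A, InDomain κ f
  L_mem : ∀ f ∈ A, L κ f ∈ A
  P_mem : ∀ f ∈ A, ∀ t, P κ t f ∈ A
  comp_mem : ∀ f ∈ A, ∀ φ : ℝ → ℝ, ContDiff ℝ ∞ φ → (fun x => φ (f x)) ∈ A
  chain : ∀ f ∈ A, ∀ φ : ℝ → ℝ, ContDiff ℝ ∞ φ → ∀ x,
    L κ (fun y => φ (f y)) x
      = deriv φ (f x) * L κ f x + deriv (deriv φ) (f x) * Gam κ f f x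

/-- The curvature-dimension criterion `CD(ρ, n)` on the algebra `A`. -/
def CD (κ : ℝ≥0 → Kernel E E) (A : Subalgebra ℝ (E → ℝ)) (ρ n : ℝ) : Prop :=
  ∀ f ∈ A, ∀ x, Gam2 κ f x ≥ ρ * Gam κ f f x + 1 / n * (L κ f x) ^ 2

/-- `Ent_{P_t}(f) = P_t(f log f) - P_t f log P_t f`. -/
def Ent (κ : ℝ≥0 → Kernel E E) (t : ℝ≥0) (f : E → ℝ) (x : E) : ℝ :=
  P κ t (fun y => f y * Real.log (f y)) x - P κ t f x * Real.log (P κ t f x)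

/-- The argument `1 - (2t/n) P_t(f L(log f)) / P_t f` of the logarithm in the dimensional
local logarithmic Sobolev inequality. -/
def logArg (κ : ℝ≥0 → Kernel E E) (n : ℝ) (t : ℝ≥0) (f : E → ℝ) (x : E) : ℝ :=
  1 - 2 * t / n * (P κ t (fun y => f y * L κ (fun z => Real.log (f z)) y) x / P κ t f x)

/-- The dimensional local logarithmic Sobolev inequality, for the positive `f ∈ A` for which
`L(log f)` is defined. That the argument of the logarithm is positive is part of the claim. -/
def LocalLogSobolev (κ : ℝ≥0 → Kernel E E) (A : Subalgebra ℝ (E → ℝ)) (n : ℝ) : Prop :=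
  ∀ f ∈ A, (∀ x, 0 < f x) → (fun x => Real.log (f x)) ∈ A → ∀ (t : ℝ≥0) (x : E),
    0 < logArg κ n t f x ∧
    Ent κ t f x ≤ t * L κ (P κ t f) x
      + n / 2 * P κ t f x * Real.log (logArg κ n t f x)

/-- `(P_u(g^q))^{1/q}(x)` for a positive function `g`, in `[0, ∞]`: for `q < 0` the integral of
`g^q` may be infinite, and then the value is `∞^{1/q} = 0`. -/
def powMean (κ : ℝ≥0 → Kernel E E) (u : ℝ≥0) (q : ℝ) (g : E → ℝ) (x : E) : ℝ≥0∞ :=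
  (∫⁻ y, ENNReal.ofReal (g y) ^ q ∂(κ u x)) ^ (1 / q)

/-- The constant `M` of the hypercontractive bound. -/
def constM (q₁ q₂ u₁ u₂ : ℝ) : ℝ :=
  ((q₁ - 1) / u₂) ^ (1 - 1 / q₁) * ((q₂ - 1) / u₁) ^ (1 / q₂ - 1)
    * ((u₁ * q₁ - u₂ * q₂) / (q₂ - q₁)) ^ (1 / q₂ - 1 / q₁)

/-- The constant `N` of the reverse hypercontractive bound. -/
def constN (q₁ q₂ u₁ u₂ : ℝ) : ℝ :=
  ((1 - q₁) / u₂) ^ (1 / q₁ - 1) * ((1 - q₂) / u₁) ^ (1 - 1 / q₂)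
    * ((u₁ * q₁ - u₂ * q₂) / (q₁ - q₂)) ^ (1 / q₁ - 1 / q₂)

/-- Admissible times: `u₁, u₂ > 0` and `t - s = u₁ q₁ - u₂ q₂ > 0`. (In the limit cases in which
one of these three numbers vanishes the constants `M` and `N` are infinite.) -/
def Admissible (q₁ q₂ : ℝ) (u₁ u₂ s t : ℝ≥0) : Prop :=
  0 < u₁ ∧ 0 < u₂ ∧ s < t ∧ (t : ℝ) - s = u₁ * q₁ - u₂ * q₂

/-- The exponents of the reverse bound. -/
def ReverseExponents (q₁ q₂ : ℝ) : Prop :=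
  (0 < q₂ ∧ q₂ < q₁ ∧ q₁ < 1) ∨ (q₂ < q₁ ∧ q₁ < 0)

/-- The dimensional local hypercontractive bound. -/
def Hypercontractive (κ : ℝ≥0 → Kernel E E) (A : Subalgebra ℝ (E → ℝ)) (n : ℝ) : Prop :=
  ∀ (q₁ q₂ : ℝ) (u₁ u₂ s t : ℝ≥0), 1 < q₁ → q₁ < q₂ → Admissible q₁ q₂ u₁ u₂ s t →
    ∀ f ∈ A, (∀ x, 0 < f x) → ∀ x,
      powMean κ u₂ q₂ (P κ (t - s) f) x
        ≤ powMean κ u₁ q₁ f x * ENNReal.ofReal (constM q₁ q₂ u₁ u₂ ^ (n / 2))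

/-- The reverse dimensional local hypercontractive bound. -/
def ReverseHypercontractive (κ : ℝ≥0 → Kernel E E) (A : Subalgebra ℝ (E → ℝ)) (n : ℝ) : Prop :=
  ∀ (q₁ q₂ : ℝ) (u₁ u₂ s t : ℝ≥0), ReverseExponents q₁ q₂ → Admissible q₁ q₂ u₁ u₂ s t →
    ∀ f ∈ A, (∀ x, 0 < f x) → ∀ x,
      powMean κ u₁ q₁ f x
        ≤ powMean κ u₂ q₂ (P κ (t - s) f) x * ENNReal.ofReal (constN q₁ q₂ u₁ u₂ ^ (n / 2))

/-- The Euclidean heat kernel on `ℝ^d`: `P_t(x, ·)` is the law of `x + √(2t) Y` with `Y` a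
standard Gaussian vector, so that its density for `t > 0` is
`(4πt)^{-d/2} exp(-|x - y|² / (4t))` and the generator is the Laplacian. -/
def heat (d : ℕ) (t : ℝ≥0) : Kernel (EuclideanSpace ℝ (Fin d)) (EuclideanSpace ℝ (Fin d)) where
  toFun x := (stdGaussian (EuclideanSpace ℝ (Fin d))).map (fun y => x + √(2 * (t : ℝ)) • y)
  measurable' := by
    have h : Measurable (fun p : EuclideanSpace ℝ (Fin d) × EuclideanSpace ℝ (Fin d) =>
        p.1 + √(2 * (t : ℝ)) • p.2) := by fun_prop
    have h2 := (Measure.measurable_map _ h).comp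
      (Measurable.map_prodMk_left (ν := stdGaussian (EuclideanSpace ℝ (Fin d))))
    convert h2 using 2 with x
    exact (Measure.map_map h measurable_prodMk_left).symm

/-- The algebra `C_b^∞(ℝ^d)` of smooth functions that are bounded with all their derivatives. -/
def smoothBounded (d : ℕ) : Subalgebra ℝ (EuclideanSpace ℝ (Fin d) → ℝ) where
  carrier := {f | ContDiff ℝ ∞ f ∧ ∀ k : ℕ, ∃ C : ℝ, ∀ x, ‖iteratedFDeriv ℝ k f x‖ ≤ C}
  mul_mem' := by
    rintro f g ⟨hf, hf'⟩ ⟨hg, hg'⟩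
    refine ⟨hf.mul hg, fun k => ?_⟩
    choose C hC using hf'
    choose D hD using hg'
    refine ⟨∑ i ∈ Finset.range (k + 1), (k.choose i : ℝ) * C i * D (k - i), fun x => ?_⟩
    refine (norm_iteratedFDeriv_mul_le hf hg x (by exact_mod_cast le_top)).trans ?_
    refine Finset.sum_le_sum fun i _ => ?_
    have h0 : 0 ≤ C i := (norm_nonneg _).trans (hC i x)
    gcongr
    · exact hC i x
    · exact hD (k - i) x
  add_mem' := by
    rintro f g ⟨hf, hf'⟩ ⟨hg, hg'⟩
    refine ⟨hf.add hg, fun k => ?_⟩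
    obtain ⟨C, hC⟩ := hf' k
    obtain ⟨D, hD⟩ := hg' k
    refine ⟨C + D, fun x => ?_⟩
    rw [iteratedFDeriv_add (hf.of_le (by exact_mod_cast le_top))
      (hg.of_le (by exact_mod_cast le_top))]
    exact (norm_add_le _ _).trans (add_le_add (hC x) (hD x))
  algebraMap_mem' := by
    intro r
    refine ⟨contDiff_const, fun k => ?_⟩
    change ∃ C : ℝ, ∀ x, ‖iteratedFDeriv ℝ k (fun _ => r) x‖ ≤ C
    rcases Nat.eq_zero_or_pos k with rfl | hk
    · exact ⟨‖r‖, fun x => by simp⟩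
    · exact ⟨0, fun x => by simp [iteratedFDeriv_const_of_ne hk.ne' r]⟩

/-- The square-exponential function `exp(a |x|²)` with the extremal
`a = (t - s + u₂ - u₁) / (4 u₁ (t - s) (q₁ - 1))`. -/
def gaussExtremal (d : ℕ) (q₁ : ℝ) (u₁ u₂ s t : ℝ≥0) (x : EuclideanSpace ℝ (Fin d)) : ℝ :=
  Real.exp (((t : ℝ) - s + u₂ - u₁) / (4 * u₁ * ((t : ℝ) - s) * (q₁ - 1)) * ‖x‖ ^ 2)

end MarkovSG

end

noncomputable section

namespace MarkovSG

section

variable {E : Type*} [MeasurableSpace E]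
variable {κ : ℝ≥0 → Kernel E E} {A : Subalgebra ℝ (E → ℝ)}

/-! ### The generator on the algebra -/

/-! All four conditions are compared with (ii), the dimensional logarithmic Sobolev inequality.

From (i) to (ii): put F = P_{T-s} f. The second derivative of s ↦ P_s(F log F) is 2 P_s(F Γ₂(log F))
(`L_L_entropy`). After subtracting the linear term s P_T(Lf), the first derivative becomes -P_s(F L
log F). CD(0,n) and Cauchy–Schwarz with weight F then bound the second derivative below by 2/(n P_T
f) times the square of the first. Hence an exponential is concave, and comparing it with its tangent
at s = T gives (ii) (`exp_le_of_sq_le_deriv`). Conversely, the two sides of (ii) agree to first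
order at t = 0, and the second-order term is CD(0,n) at log f.

Between (ii) and (iii), (iv): join (u₁,q₁) to (u₂,q₂) by a path on which u is affine in r and uq =
u₁q₁ - r, and follow the logarithm of (P_u((P_r f)^q))^{1/q}. Its derivative is a combination of the
entropy defect and of the tilted mean of L, the two quantities in (ii) (`hasDerivWithinAt_logMean`).
Concavity of the logarithm makes (ii) equivalent to a family of inequalities linear in these two
quantities, indexed by y > 0 (`log_le_iff_forall`). With y = w/(u(q-1)), w a constant of the path,
the error term integrates exactly to log M. The sign of q - 1 separates the direct bound from the
reverse one, so one computation serves both. Conversely, every y > 0 is the initial value for some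
path issued from a fixed q₁, and the bound along arbitrarily short paths gives the sign of the
derivative at r = 0.

Regularity is the delicate point: difference quotients converge only pointwise, so `L` cannot be
interchanged with limits freely. Derivatives of P_s applied to a moving function come from a product
rule for positive functionals and uniformly Lipschitz curves (`hasDerivWithinAt_state`). The entropy
is first averaged over a short time interval, which turns `L` into a difference of two semigroup
values; the average is removed at the end.

For the heat semigroup, CD(0,d) is Bochner's formula, and sharpness is an explicit Gaussian
computation. -/

lemma IsMarkov.integrable (hκ : IsMarkov κ) {f : E → ℝ} (hf : Measurable f)
    (hb : ∃ C : ℝ, ∀ x, |f x| ≤ C) (t : ℝ≥0) (x : E) : Integrable f (κ t x) := by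
  have := hκ.markov t
  obtain ⟨C, hC⟩ := hb
  exact Integrable.of_bound hf.aestronglyMeasurable C (ae_of_all _ hC)

lemma IsDiffusion.integrable (hA : IsDiffusion κ A) (hκ : IsMarkov κ) {f : E → ℝ} (hf : f ∈ A)
    (t : ℝ≥0) (x : E) : Integrable f (κ t x) :=
  hκ.integrable (hA.domain f hf).measurable (hA.domain f hf).bounded t x

lemma InDomain.tendsto_L {f : E → ℝ} (hf : InDomain κ f) (x : E) :
    Tendsto (fun h : ℝ≥0 => (P κ h f x - f x) / h) (𝓝[>] (0 : ℝ≥0)) (𝓝 (L κ f x)) :=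
  tendsto_nhds_limUnder (hf.tendsto x)

lemma L_eq_of_tendsto {f : E → ℝ} {x : E} {l : ℝ}
    (h : Tendsto (fun h : ℝ≥0 => (P κ h f x - f x) / h) (𝓝[>] (0 : ℝ≥0)) (𝓝 l)) :
    L κ f x = l :=
  h.limUnder_eq

lemma P_const (hκ : IsMarkov κ) (t : ℝ≥0) (c : ℝ) (x : E) : P κ t (fun _ => c) x = c := by
  have := hκ.markov t
  simp [P]

section
variable (hκ : IsMarkov κ) (hA : IsDiffusion κ A) {f g h : E → ℝ} (hf : f ∈ A) (hg : g ∈ A)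
  (hh : h ∈ A)
include hκ hA hf

omit hκ hA hf in
lemma P_smul (f : E → ℝ) (c : ℝ) (t : ℝ≥0) (x : E) : P κ t (c • f) x = c * P κ t f x := by
  simp only [P, Pi.smul_apply, smul_eq_mul, integral_const_mul]

omit hκ in
lemma L_smul (c : ℝ) (x : E) : L κ (c • f) x = c * L κ f x := by
  apply L_eq_of_tendsto
  convert ((hA.domain f hf).tendsto_L x).const_mul c using 2 with r
  rw [P_smul]; simp only [Pi.smul_apply, smul_eq_mul]; ring

include hg

lemma P_add_mem (t : ℝ≥0) (x : E) : P κ t (f + g) x = P κ t f x + P κ t g x :=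
  integral_add (hA.integrable hκ hf t x) (hA.integrable hκ hg t x)

lemma P_sub_mem (t : ℝ≥0) (x : E) : P κ t (f - g) x = P κ t f x - P κ t g x :=
  integral_sub (hA.integrable hκ hf t x) (hA.integrable hκ hg t x)

lemma L_add (x : E) : L κ (f + g) x = L κ f x + L κ g x := by
  apply L_eq_of_tendsto
  convert ((hA.domain f hf).tendsto_L x).add ((hA.domain g hg).tendsto_L x) using 2 with r
  rw [P_add_mem hκ hA hf hg]; simp only [Pi.add_apply]; ring

lemma L_sub (x : E) : L κ (f - g) x = L κ f x - L κ g x := by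
  apply L_eq_of_tendsto
  convert ((hA.domain f hf).tendsto_L x).sub ((hA.domain g hg).tendsto_L x) using 2 with r
  rw [P_sub_mem hκ hA hf hg]; simp only [Pi.sub_apply]; ring

omit hκ hf hA hg in
lemma Gam_comm (f g : E → ℝ) (x : E) : Gam κ f g x = Gam κ g f x := by
  simp only [Gam, mul_comm (f _) (g _)]; ring

omit hκ hf hA hg in
lemma L_mul (f g : E → ℝ) (x : E) :
    L κ (f * g) x = f x * L κ g x + g x * L κ f x + 2 * Gam κ f g x := by
  simp only [Gam, Pi.mul_def]; ring

omit hκ in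
lemma Gam_mem : Gam κ f g ∈ A := by
  have : Gam κ f g = (1 / 2 : ℝ) • (L κ (f * g) - f * L κ g - g * L κ f) := by
    ext x; simp only [Gam, Pi.smul_apply, Pi.sub_apply, smul_eq_mul, Pi.mul_def]; ring
  rw [this]
  exact A.smul_mem (A.sub_mem (A.sub_mem (hA.L_mem _ (A.mul_mem hf hg))
    (A.mul_mem hf (hA.L_mem _ hg))) (A.mul_mem hg (hA.L_mem _ hf))) _

lemma Gam_smul_left (c : ℝ) (x : E) : Gam κ (c • f) g x = c * Gam κ f g x := by
  have h1 := L_smul hA (A.mul_mem hf hg) c x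
  have h2 := L_smul hA hf c x
  have h3 := L_mul (κ := κ) (c • f) g x
  have h4 := L_mul (κ := κ) f g x
  rw [smul_mul_assoc] at h3
  simp only [Pi.smul_apply, smul_eq_mul] at *
  rw [h1, h2, h4] at h3
  linarith

include hh

lemma Gam_add_left (x : E) : Gam κ (f + g) h x = Gam κ f h x + Gam κ g h x := by
  have h1 := L_add hκ hA (A.mul_mem hf hh) (A.mul_mem hg hh) x
  have h2 := L_add hκ hA hf hg x
  have h3 := L_mul (κ := κ) (f + g) h x
  have h4 := L_mul (κ := κ) f h x
  have h5 := L_mul (κ := κ) g h x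
  rw [add_mul] at h3
  simp only [Pi.add_apply] at *
  rw [h1, h2, h4, h5] at h3
  linarith

lemma Gam_sub_left (x : E) : Gam κ (f - g) h x = Gam κ f h x - Gam κ g h x := by
  have e : f - g = f + (-1 : ℝ) • g := by ext; simp [sub_eq_add_neg]
  rw [e, Gam_add_left hκ hA hf (A.smul_mem hg _) hh, Gam_smul_left hκ hA hg hh]; ring

lemma Gam_add_right (x : E) : Gam κ h (f + g) x = Gam κ h f x + Gam κ h g x := by
  simp only [Gam_comm h]
  exact Gam_add_left hκ hA hf hg hh x

omit hh

lemma Gam_smul_right (c : ℝ) (x : E) : Gam κ g (c • f) x = c * Gam κ g f x := by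
  simp only [Gam_comm g]
  exact Gam_smul_left hκ hA hf hg c x

omit hg

/-- 2Γ(f)(x) is the limit of P_r((f - f(x))²)(x)/r, a limit of nonnegative numbers. -/
lemma Gam_self_nonneg (x : E) : 0 ≤ Gam κ f f x := by
  have h1 := (hA.domain _ (A.mul_mem hf hf)).tendsto_L x
  have h2 := (hA.domain f hf).tendsto_L x
  have h3 := h1.sub (h2.const_mul (2 * f x))
  rw [L_mul] at h3
  have h4 : 0 ≤ f x * L κ f x + f x * L κ f x + 2 * Gam κ f f x - 2 * f x * L κ f x := by
    refine ge_of_tendsto h3 (Eventually.of_forall fun r => ?_)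
    have hm := hκ.markov r
    have e : P κ r (f * f) x - 2 * f x * P κ r f x + f x ^ 2 = ∫ y, (f y - f x) ^ 2 ∂(κ r x) := by
      have i1 := hA.integrable hκ (A.mul_mem hf hf) r x
      have i2 := (hA.integrable hκ hf r x).const_mul (2 * f x)
      have : (fun y => (f y - f x) ^ 2) = fun y => ((f * f) y - 2 * f x * f y) + f x ^ 2 := by
        ext y; simp only [Pi.mul_apply]; ring
      have i3 : Integrable (fun y => (f * f) y - 2 * f x * f y) (κ r x) := i1.sub i2
      rw [this, integral_add i3 (integrable_const _), integral_sub i1 i2, integral_const_mul]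
      simp [P]
    have e2 : (P κ r (f * f) x - (f * f) x) / r - 2 * f x * ((P κ r f x - f x) / r)
        = (∫ y, (f y - f x) ^ 2 ∂(κ r x)) / r := by
      rw [← e]; simp only [Pi.mul_apply]; ring
    rw [e2]
    exact div_nonneg (integral_nonneg fun y => sq_nonneg _) r.2
  linarith

include hg

/-- Degenerate Cauchy–Schwarz: at x, Γ(g + c f) is affine in c and nonnegative for every c, so its
slope vanishes. -/
lemma Gam_eq_zero (x : E) (h0 : Gam κ f f x = 0) : Gam κ f g x = 0 := by
  have key : ∀ c : ℝ, 0 ≤ Gam κ g g x + c * (2 * Gam κ f g x) := by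
    intro c
    have hcf := A.smul_mem hf c
    have h1 := Gam_self_nonneg hκ hA (A.add_mem hg hcf) x
    rw [Gam_add_left hκ hA hg hcf (A.add_mem hg hcf), Gam_add_right hκ hA hg hcf hg,
      Gam_add_right hκ hA hg hcf hcf, Gam_smul_right hκ hA hf hg, Gam_smul_left hκ hA hf hg,
      Gam_smul_left hκ hA hf hcf, Gam_smul_right hκ hA hf hf, h0, Gam_comm g f] at h1
    linarith
  by_contra hne
  have := key (-(Gam κ g g x + 1) / (2 * Gam κ f g x))
  rw [div_mul_cancel₀ _ (by simpa using hne)] at this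
  linarith

omit hκ hg in
-- Apply the chain rule for `L` to φ and to φ²; the φ'' terms cancel in L(φ(f)²) - 2φ(f) Lφ(f).
lemma Gam_comp_self {φ : ℝ → ℝ} (hφ : ContDiff ℝ ∞ φ) (x : E) :
    Gam κ (fun y => φ (f y)) (fun y => φ (f y)) x = deriv φ (f x) ^ 2 * Gam κ f f x := by
  have c1 := hA.chain f hf φ hφ x
  have hφ2 : ContDiff ℝ ∞ (fun y => φ y * φ y) := hφ.mul hφ
  have c2 := hA.chain f hf _ hφ2 x
  have d : Differentiable ℝ φ := hφ.differentiable (by simp)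
  have d' : Differentiable ℝ (deriv φ) :=
    ((contDiff_infty_iff_deriv.1 hφ).2).differentiable (by simp)
  have e1 : deriv (fun y => φ y * φ y) = fun y => 2 * (φ y * deriv φ y) := by
    ext y; rw [deriv_fun_mul (d y) (d y)]; ring
  have e2 : deriv (deriv (fun y => φ y * φ y)) (f x)
      = 2 * (deriv φ (f x) ^ 2 + φ (f x) * deriv (deriv φ) (f x)) := by
    rw [e1, deriv_const_mul_field, deriv_fun_mul (d _) (d' _)]; ring
  rw [e2, e1] at c2
  have := L_mul (κ := κ) (fun y => φ (f y)) (fun y => φ (f y)) x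
  simp only [Pi.mul_def] at this
  rw [c2, c1] at this
  linarith

/-- The diffusion property of the carré du champ. -/
lemma Gam_comp_left {φ : ℝ → ℝ} (hφ : ContDiff ℝ ∞ φ) (x : E) :
    Gam κ (fun y => φ (f y)) g x = deriv φ (f x) * Gam κ f g x := by
  have hF := hA.comp_mem f hf φ hφ
  -- With the slope frozen at its value at x, φ(f) - c f has vanishing carré du champ at x, hence
  -- vanishing Γ against every g there. This avoids a chain rule in several functions, which is not
  -- assumed.
  set c := deriv φ (f x) with hc
  have hφ' : ContDiff ℝ ∞ (fun y => φ y - c * y) := hφ.sub (contDiff_const.mul contDiff_id)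
  have h1 := Gam_comp_self hA hf hφ' x
  have d : deriv (fun y => φ y - c * y) (f x) = 0 := by
    rw [deriv_fun_sub (hφ.differentiable (by simp) _) (by fun_prop), deriv_const_mul_field]
    simp [hc]
  rw [d] at h1
  have e : (fun y => φ (f y) - c * f y) = (fun y => φ (f y)) - c • f := by ext; simp
  rw [e] at h1
  have hm := A.sub_mem hF (A.smul_mem hf c)
  have h2 := Gam_eq_zero hκ hA hm hg x (by rw [h1]; ring)
  rw [Gam_sub_left hκ hA hF (A.smul_mem hf c) hg, Gam_smul_left hκ hA hf hg] at h2
  linarith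

include hh

/-- Leibniz rule by polarisation, fg = ((f+g)² - f² - g²)/2, which only needs functions of a single
element of the algebra. -/
lemma Gam_mul_left (x : E) :
    Gam κ (f * g) h x = f x * Gam κ g h x + g x * Gam κ f h x := by
  have hs : ContDiff ℝ ∞ (fun y : ℝ => y ^ 2) := contDiff_id.pow 2
  have hfg := A.add_mem hf hg
  have e : f * g = (1 / 2 : ℝ) • (((fun y => (f + g) y ^ 2) - (fun y => f y ^ 2))
      - (fun y => g y ^ 2)) := by
    ext y; simp only [Pi.mul_apply, Pi.smul_apply, Pi.sub_apply, Pi.add_apply, smul_eq_mul]; ring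
  have m1 := hA.comp_mem _ hfg _ hs
  have m2 := hA.comp_mem _ hf _ hs
  have m3 := hA.comp_mem _ hg _ hs
  rw [e, Gam_smul_left hκ hA (A.sub_mem (A.sub_mem m1 m2) m3) hh,
    Gam_sub_left hκ hA (A.sub_mem m1 m2) m3 hh, Gam_sub_left hκ hA m1 m2 hh,
    Gam_comp_left hκ hA hfg hh hs, Gam_comp_left hκ hA hf hh hs, Gam_comp_left hκ hA hg hh hs,
    Gam_add_left hκ hA hf hg hh]
  simp
  ring

end

/-! ### Exponentials and the Γ₂ identity for the entropy -/

section
variable (hκ : IsMarkov κ) (hA : IsDiffusion κ A) {g h : E → ℝ} (hg : g ∈ A) (hh : h ∈ A)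
include hA hg

lemma exp_mem : (fun y => Real.exp (g y)) ∈ A := hA.comp_mem g hg _ Real.contDiff_exp

lemma L_exp (x : E) :
    L κ (fun y => Real.exp (g y)) x = Real.exp (g x) * (L κ g x + Gam κ g g x) := by
  rw [hA.chain g hg _ Real.contDiff_exp]; simp; ring

include hκ hh in
lemma Gam_exp_left (x : E) :
    Gam κ (fun y => Real.exp (g y)) h x = Real.exp (g x) * Gam κ g h x := by
  rw [Gam_comp_left hκ hA hg hh Real.contDiff_exp]; simp

include hκ

lemma L_exp_mul_self (x : E) :
    L κ ((fun y => Real.exp (g y)) * g) x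
      = (g x + 1) * L κ (fun y => Real.exp (g y)) x + Real.exp (g x) * Gam κ g g x := by
  rw [L_mul, Gam_exp_left hκ hA hg hg, L_exp hA hg]; ring

/-- The second derivative of `s ↦ P_s (Φ (P_{T-s} f))` for `Φ y = y log y`, at `f = exp g`. -/
lemma L_L_entropy (x : E) :
    L κ (L κ ((fun y => Real.exp (g y)) * g)) x
      - 2 * L κ ((g + 1) * L κ (fun y => Real.exp (g y))) x
      + (L κ (fun y => Real.exp (g y)) x) ^ 2 / Real.exp (g x)
      + (g x + 1) * L κ (L κ (fun y => Real.exp (g y))) x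
      = 2 * (Real.exp (g x) * Gam2 κ g x) := by
  set f : E → ℝ := fun y => Real.exp (g y) with hfdef
  have hf : f ∈ A := exp_mem hA hg
  have hLf := hA.L_mem _ hf
  have hLg := hA.L_mem _ hg
  have hΓ := Gam_mem hA hg hg
  have hg1 : g + 1 ∈ A := A.add_mem hg A.one_mem
  -- Everything is expressed through g by Lf = f(Lg + Γ(g)) and Γ(f,h) = fΓ(g,h); what survives is
  -- LΓ(g) - 2Γ(g,Lg).
  have e0 : L κ f = f * (L κ g + Gam κ g g) := by
    ext y; simpa using L_exp hA hg y
  have e1 : L κ (f * g) = (g + 1) * L κ f + f * Gam κ g g := by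
    ext y; simpa using L_exp_mul_self hκ hA hg y
  have fx : f x ≠ 0 := (Real.exp_pos _).ne'
  have e2 : L κ ((g + 1) * L κ f) x = (g x + 1) * L κ (L κ f) x + L κ f x * L κ g x
      + 2 * Gam κ g (L κ f) x := by
    have : (g + 1) * L κ f = g * L κ f + L κ f := by ring
    rw [this, L_add hκ hA (A.mul_mem hg hLf) hLf, L_mul]; ring
  have e3 : L κ (f * Gam κ g g) x = f x * L κ (Gam κ g g) x + Gam κ g g x * L κ f x
      + 2 * (f x * Gam κ g (Gam κ g g) x) := by
    rw [L_mul, Gam_exp_left hκ hA hg hΓ]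
  have e4 : Gam κ g (L κ f) x = f x * (Gam κ g (L κ g) x + Gam κ g (Gam κ g g) x)
      + (L κ g x + Gam κ g g x) * (f x * Gam κ g g x) := by
    rw [e0, Gam_comm, Gam_mul_left hκ hA hf (A.add_mem hLg hΓ) hg, Gam_exp_left hκ hA hg hg,
      Gam_add_left hκ hA hLg hΓ hg, Gam_comm (L κ g), Gam_comm (Gam κ g g) g]
    simp only [Pi.add_apply, hfdef]
  rw [e1, L_add hκ hA (A.mul_mem hg1 hLf) (A.mul_mem hf hΓ), e3, e2, e4]
  have e5 : L κ f x = f x * (L κ g x + Gam κ g g x) := L_exp hA hg x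
  have e6 : Real.exp (g x) = f x := rfl
  rw [e5, e6, Gam2]
  field_simp
  ring

end

end

section

variable {E : Type*} [MeasurableSpace E]
variable {κ : ℝ≥0 → Kernel E E} {A : Subalgebra ℝ (E → ℝ)}

/-! ### The semigroup in real time -/

/-- The semigroup, extended by the identity to negative times. -/
def Q (κ : ℝ≥0 → Kernel E E) (t : ℝ) (f : E → ℝ) : E → ℝ := P κ t.toNNReal f

@[simp] lemma Q_coe (t : ℝ≥0) (f : E → ℝ) : Q κ t f = P κ t f := by
  simp [Q]

lemma abs_P_le (hκ : IsMarkov κ) {f : E → ℝ} {B : ℝ} (hB : ∀ x, |f x| ≤ B) (t : ℝ≥0) (x : E) :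
    |P κ t f x| ≤ B := by
  have := hκ.markov t
  have h := norm_integral_le_of_norm_le_const (μ := κ t x) (f := f) (C := B)
    (ae_of_all _ fun y => by simpa using hB y)
  simpa [P] using h

section
variable (hκ : IsMarkov κ) (hA : IsDiffusion κ A) {f g : E → ℝ} (hf : f ∈ A) (hg : g ∈ A)
include hκ

lemma P_zero (hm : Measurable f) (x : E) : P κ 0 f x = f x := by
  rw [P, hκ.zero, Kernel.id_apply, integral_dirac' _ _ hm.stronglyMeasurable]

include hA hf

lemma P_nonneg_bound {ε : ℝ} (hε : ∀ x, ε ≤ f x) (t : ℝ≥0) (x : E) : ε ≤ P κ t f x := by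
  have := hκ.markov t
  calc ε = ∫ _, ε ∂(κ t x) := by simp
    _ ≤ P κ t f x := integral_mono (integrable_const _) (hA.integrable hκ hf t x) hε

lemma P_comp (s t : ℝ≥0) (x : E) : P κ t (P κ s f) x = P κ (s + t) f x := by
  have := hA.integrable hκ hf (s + t) x
  rw [hκ.add] at this
  rw [P, P, hκ.add, Kernel.integral_comp this]
  rfl

/-- The difference quotient of P_t f is P_t of the difference quotient of f; the uniform bound in
`InDomain` provides dominated convergence. -/
lemma L_P (t : ℝ≥0) : L κ (P κ t f) = P κ t (L κ f) := by
  ext x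
  have hm := hκ.markov t
  apply L_eq_of_tendsto
  have e : ∀ h : ℝ≥0, (P κ h (P κ t f) x - P κ t f x) / h
      = ∫ y, (P κ h f y - f y) / h ∂(κ t x) := by
    intro h
    rw [integral_div, integral_sub (hA.integrable hκ (hA.P_mem f hf h) t x)
      (hA.integrable hκ hf t x), P_comp hκ hA hf, add_comm, ← P_comp hκ hA hf]
    rfl
  simp_rw [e]
  obtain ⟨C, hC⟩ := (hA.domain f hf).quotient_bounded
  refine tendsto_integral_filter_of_dominated_convergence (fun _ => |C|) ?_ ?_
    (integrable_const _) (ae_of_all _ fun y => (hA.domain f hf).tendsto_L y)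
  · refine Eventually.of_forall fun h => Measurable.aestronglyMeasurable ?_
    exact ((hA.domain _ (hA.P_mem f hf h)).measurable.sub (hA.domain f hf).measurable).div_const _
  · refine Eventually.of_forall fun h => ae_of_all _ fun y => ?_
    rw [Real.norm_eq_abs, abs_div, NNReal.abs_eq]
    refine div_le_of_le_mul₀ h.2 (abs_nonneg _) ((hC h y).trans ?_)
    exact mul_le_mul_of_nonneg_right (le_abs_self C) h.2

omit hκ in
lemma Q_mem (t : ℝ) : Q κ t f ∈ A := hA.P_mem f hf _

lemma L_Q (t : ℝ) : L κ (Q κ t f) = Q κ t (L κ f) := L_P hκ hA hf _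

lemma Q_Q {s t : ℝ} (hs : 0 ≤ s) (ht : 0 ≤ t) (x : E) :
    Q κ t (Q κ s f) x = Q κ (s + t) f x := by
  rw [Q, Q, Q, P_comp hκ hA hf, Real.toNNReal_add hs ht]

lemma Q_zero (x : E) : Q κ 0 f x = f x := by
  simpa [Q] using P_zero hκ (hA.domain f hf).measurable x

/-- The bound on P_h f - f is preserved by the contraction P_t, hence is uniform in time and space.
-/
lemma exists_lipschitz : ∃ C : ℝ, 0 ≤ C ∧ ∀ s t x, |Q κ s f x - Q κ t f x| ≤ C * |s - t| := by
  obtain ⟨C, hC⟩ := (hA.domain f hf).quotient_bounded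
  have key : ∀ s t : ℝ≥0, t ≤ s → ∀ x, |P κ s f x - P κ t f x| ≤ |C| * |(s : ℝ) - t| := by
    intro s t hst x
    obtain ⟨h, rfl⟩ := exists_add_of_le hst
    rw [add_comm t h, ← P_comp hκ hA hf, ← P_sub_mem hκ hA (hA.P_mem f hf h) hf]
    refine abs_P_le hκ (fun y => ((hC h y).trans ?_)) t x
    rw [NNReal.coe_add, add_sub_cancel_right, NNReal.abs_eq]
    exact mul_le_mul_of_nonneg_right (le_abs_self C) h.2
  refine ⟨|C|, abs_nonneg _, fun s t x => ?_⟩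
  have h1 : |(s.toNNReal : ℝ) - t.toNNReal| ≤ |s - t| := by
    have := Real.lipschitzWith_toNNReal.dist_le_mul s t
    simpa [Real.dist_eq, NNReal.dist_eq] using this
  refine le_trans ?_ (mul_le_mul_of_nonneg_left h1 (abs_nonneg _))
  rcases le_total t.toNNReal s.toNNReal with h | h
  · exact key _ _ h x
  · rw [abs_sub_comm, abs_sub_comm (s.toNNReal : ℝ)]
    exact key _ _ h x

lemma continuous_Q (x : E) : Continuous fun t => Q κ t f x := by
  obtain ⟨C, hC, h⟩ := exists_lipschitz hκ hA hf
  refine (LipschitzWith.of_dist_le_mul (K := ⟨C, hC⟩) fun s t => ?_).continuous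
  rw [Real.dist_eq, Real.dist_eq]
  exact h s t x

lemma hasDerivWithinAt_Q_right {t : ℝ} (ht : 0 ≤ t) (x : E) :
    HasDerivWithinAt (fun s => Q κ s f x) (Q κ t (L κ f) x) (Set.Ioi t) t := by
  have h1 := (hA.domain _ (Q_mem hA hf t)).tendsto_L x
  rw [L_Q hκ hA hf] at h1
  have h2 : Tendsto (fun s : ℝ => (s - t).toNNReal) (𝓝[>] t) (𝓝[>] 0) := by
    refine tendsto_nhdsWithin_iff.2 ⟨?_, ?_⟩
    · have : Continuous fun s : ℝ => (s - t).toNNReal := by fun_prop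
      simpa using (this.tendsto t).mono_left nhdsWithin_le_nhds
    · filter_upwards [self_mem_nhdsWithin] with s hs
      simpa using hs
  rw [hasDerivWithinAt_iff_tendsto_slope' (by simp)]
  refine (h1.comp h2).congr' ?_
  filter_upwards [self_mem_nhdsWithin] with s hs
  have hst : 0 ≤ s - t := sub_nonneg.2 (le_of_lt hs)
  have e := Q_Q hκ hA hf ht hst x
  simp only [Function.comp_apply, slope_def_field, Real.coe_toNNReal _ hst]
  congr 2
  rw [show P κ (s - t).toNNReal (Q κ t f) x = Q κ (s - t) (Q κ t f) x from rfl, e]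
  ring_nf

lemma integral_Q_L {a b : ℝ} (ha : 0 ≤ a) (hab : a ≤ b) (x : E) :
    ∫ v in a..b, Q κ v (L κ f) x = Q κ b f x - Q κ a f x :=
  intervalIntegral.integral_eq_sub_of_hasDeriv_right_of_le hab
    (continuous_Q hκ hA hf x).continuousOn
    (fun _ ht => hasDerivWithinAt_Q_right hκ hA hf (ha.trans ht.1.le) x)
    ((continuous_Q hκ hA (hA.L_mem f hf) x).intervalIntegrable _ _)

/-- The semigroup law yields right derivatives only. Since the candidate derivative is continuous in
t, the semigroup is its integral, and the derivative exists from both sides at positive times. -/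
lemma hasDerivWithinAt_Q {t : ℝ} (ht : 0 ≤ t) (x : E) :
    HasDerivWithinAt (fun s => Q κ s f x) (Q κ t (L κ f) x) (Set.Ici 0) t := by
  have hc := continuous_Q hκ hA (hA.L_mem f hf) x
  have h := ((hc.integral_hasStrictDerivAt 0 t).hasDerivAt.hasDerivWithinAt
    (s := Set.Ici 0)).const_add (Q κ 0 f x)
  refine h.congr (fun s hs => ?_) ?_
  · rw [integral_Q_L hκ hA hf le_rfl hs]; ring
  · rw [integral_Q_L hκ hA hf le_rfl ht]; ring

end

/-! ### States -/

/-- Positive normalised linear functionals on the algebra. -/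
structure IsState (A : Subalgebra ℝ (E → ℝ)) (ℓ : (E → ℝ) → ℝ) : Prop where
  add : ∀ f ∈ A, ∀ g ∈ A, ℓ (f + g) = ℓ f + ℓ g
  smul : ∀ (c : ℝ), ∀ f ∈ A, ℓ (c • f) = c * ℓ f
  nonneg : ∀ f ∈ A, (∀ x, 0 ≤ f x) → 0 ≤ ℓ f
  one : ℓ 1 = 1

namespace IsState

omit [MeasurableSpace E]

variable {ℓ : (E → ℝ) → ℝ} (hℓ : IsState A ℓ) {f g : E → ℝ} (hf : f ∈ A) (hg : g ∈ A)
include hℓ hf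

lemma le_of_forall_le {c : ℝ} (h : ∀ x, c ≤ f x) : c ≤ ℓ f := by
  have h1 := hℓ.nonneg (f + (-c) • 1) (A.add_mem hf (A.smul_mem A.one_mem _))
    (fun x => by simpa using h x)
  rw [hℓ.add f hf _ (A.smul_mem A.one_mem _), hℓ.smul _ _ A.one_mem, hℓ.one] at h1
  linarith

lemma abs_apply_le {B : ℝ} (h : ∀ x, |f x| ≤ B) : |ℓ f| ≤ B := by
  rw [abs_le]
  refine ⟨hℓ.le_of_forall_le hf fun x => neg_le_of_abs_le (h x), ?_⟩
  have h1 := hℓ.le_of_forall_le (A.smul_mem hf (-1 : ℝ)) (c := -B)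
    (fun x => by simpa using (abs_le.1 (h x)).2)
  rw [hℓ.smul _ _ hf] at h1
  linarith

include hg

lemma sub : ℓ (f - g) = ℓ f - ℓ g := by
  have : f - g = f + (-1 : ℝ) • g := by ext; simp [sub_eq_add_neg]
  rw [this, hℓ.add f hf _ (A.smul_mem hg _), hℓ.smul _ _ hg]; ring

lemma mono (h : ∀ x, f x ≤ g x) : ℓ f ≤ ℓ g := by
  have h1 := hℓ.nonneg (g - f) (A.sub_mem hg hf) (fun x => sub_nonneg.2 (h x))
  rw [hℓ.sub hg hf] at h1
  linarith

/-- The Cauchy–Schwarz inequality with a nonnegative weight `f`. -/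
lemma sq_le_mul (h0 : ∀ x, 0 ≤ f x) (hpos : 0 < ℓ f) :
    ℓ (f * g) ^ 2 / ℓ f ≤ ℓ (f * g ^ 2) := by
  -- The minimiser of c ↦ ℓ(f (g - c)²).
  set c := ℓ (f * g) / ℓ f with hc
  have hfg := A.mul_mem hf hg
  have hfgg := A.mul_mem hf (A.pow_mem hg 2)
  have h1 := hℓ.nonneg (f * g ^ 2 - (2 * c) • (f * g) + c ^ 2 • f)
    (A.add_mem (A.sub_mem hfgg (A.smul_mem hfg _)) (A.smul_mem hf _)) (fun x => by
      have : 0 ≤ f x * (g x - c) ^ 2 := mul_nonneg (h0 x) (sq_nonneg _)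
      simp only [Pi.add_apply, Pi.sub_apply, Pi.mul_apply, Pi.pow_apply, Pi.smul_apply,
        smul_eq_mul]
      linarith)
  rw [hℓ.add _ (A.sub_mem hfgg (A.smul_mem hfg _)) _ (A.smul_mem hf _),
    hℓ.sub hfgg (A.smul_mem hfg _), hℓ.smul _ _ hfg, hℓ.smul _ _ hf] at h1
  have h2 : 2 * c * ℓ (f * g) = 2 * (ℓ (f * g) ^ 2 / ℓ f) := by rw [hc]; ring
  have h3 : c ^ 2 * ℓ f = ℓ (f * g) ^ 2 / ℓ f := by rw [hc]; field_simp
  linarith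

end IsState

lemma isState_Q (hκ : IsMarkov κ) (hA : IsDiffusion κ A) (t : ℝ) (x : E) :
    IsState A (fun f => Q κ t f x) where
  add _ hf _ hg := P_add_mem hκ hA hf hg _ x
  smul c f _ := P_smul f c _ x
  nonneg _ _ h := integral_nonneg h
  one := P_const hκ _ 1 x

/-! ### Curves of functions -/

/-- Uniformly bounded and uniformly Lipschitz curves of functions. -/
def UniformLip (S : Set ℝ) (ψ : ℝ → E → ℝ) : Prop :=
  ∃ C : ℝ, (∀ r ∈ S, ∀ x, |ψ r x| ≤ C) ∧
    ∀ r ∈ S, ∀ r' ∈ S, ∀ x, |ψ r x - ψ r' x| ≤ C * |r - r'|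

namespace UniformLip

omit [MeasurableSpace E]

variable {S : Set ℝ} {ψ χ : ℝ → E → ℝ}

lemma add (hψ : UniformLip S ψ) (hχ : UniformLip S χ) :
    UniformLip S (fun r x => ψ r x + χ r x) := by
  obtain ⟨C, h1, h2⟩ := hψ
  obtain ⟨D, h3, h4⟩ := hχ
  refine ⟨C + D, fun r hr x => (abs_add_le _ _).trans (add_le_add (h1 r hr x) (h3 r hr x)),
    fun r hr r' hr' x => ?_⟩
  rw [add_sub_add_comm, add_mul]
  exact (abs_add_le _ _).trans (add_le_add (h2 r hr r' hr' x) (h4 r hr r' hr' x))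

lemma mul (hψ : UniformLip S ψ) (hχ : UniformLip S χ) :
    UniformLip S (fun r x => ψ r x * χ r x) := by
  obtain ⟨C, h1, h2⟩ := hψ
  obtain ⟨D, h3, h4⟩ := hχ
  refine ⟨max (C * D) (2 * (C * D)), fun r hr x => ?_, fun r hr r' hr' x => ?_⟩
  · rw [abs_mul]
    exact (mul_le_mul (h1 r hr x) (h3 r hr x) (abs_nonneg _)
      ((abs_nonneg _).trans (h1 r hr x))).trans (le_max_left _ _)
  · have e : ψ r x * χ r x - ψ r' x * χ r' x
        = (ψ r x - ψ r' x) * χ r x + ψ r' x * (χ r x - χ r' x) := by ring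
    have a1 := h1 r' hr' x
    have a2 := h2 r hr r' hr' x
    have a3 := h3 r hr x
    have a4 := h4 r hr r' hr' x
    have hC : 0 ≤ C := (abs_nonneg _).trans a1
    refine le_trans ?_ (mul_le_mul_of_nonneg_right (le_max_right _ _) (abs_nonneg _))
    rw [e]
    refine (abs_add_le _ _).trans ?_
    rw [abs_mul, abs_mul]
    have b1 := mul_le_mul a2 a3 (abs_nonneg _) (mul_nonneg hC (abs_nonneg _))
    have b2 := mul_le_mul a1 a4 (abs_nonneg _) hC
    linarith

/-- A C¹ function is bounded and Lipschitz on a compact interval; the interval lets φ be the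
logarithm or the inverse, singular at 0. -/
lemma comp (hψ : UniformLip S ψ) {φ : ℝ → ℝ} {a b : ℝ}
    (hmem : ∀ r ∈ S, ∀ x, ψ r x ∈ Set.Icc a b) (hφ : ∀ y ∈ Set.Icc a b, ContDiffAt ℝ 1 φ y) :
    UniformLip S (fun r x => φ (ψ r x)) := by
  obtain ⟨C, h1, h2⟩ := hψ
  have hlip : LocallyLipschitzOn (Set.Icc a b) φ := by
    intro y hy
    obtain ⟨K, t, ht, hK⟩ := (hφ y hy).exists_lipschitzOnWith
    exact ⟨K, t, mem_nhdsWithin_of_mem_nhds ht, hK⟩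
  obtain ⟨K, hK⟩ := hlip.exists_lipschitzOnWith_of_compact isCompact_Icc
  obtain ⟨D, hD⟩ := isCompact_Icc.exists_bound_of_continuousOn
    (fun y hy => (hφ y hy).continuousAt.continuousWithinAt)
  refine ⟨max D (K * C), fun r hr x => (hD _ (hmem r hr x)).trans (le_max_left _ _),
    fun r hr r' hr' x => ?_⟩
  have h3 := hK.dist_le_mul _ (hmem r hr x) _ (hmem r' hr' x)
  rw [Real.dist_eq, Real.dist_eq] at h3
  refine h3.trans (le_trans ?_ (mul_le_mul_of_nonneg_right (le_max_right _ _) (abs_nonneg _)))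
  rw [mul_assoc]
  exact mul_le_mul_of_nonneg_left (h2 r hr r' hr' x) K.2

lemma comp_contDiff (hψ : UniformLip S ψ) {φ : ℝ → ℝ} (hφ : ContDiff ℝ 1 φ) :
    UniformLip S (fun r x => φ (ψ r x)) := by
  obtain ⟨C, h1, h2⟩ := id hψ
  exact hψ.comp (fun r hr x => abs_le.1 (h1 r hr x)) fun y _ => hφ.contDiffAt

lemma neg (hψ : UniformLip S ψ) : UniformLip S (fun r x => -ψ r x) :=
  hψ.comp_contDiff contDiff_neg

lemma scalar {a b : ℝ} {c : ℝ → ℝ} (hc : ∀ y ∈ Set.Icc a b, ContDiffAt ℝ 1 c y) :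
    UniformLip (Set.Icc a b) (fun r (_ : E) => c r) := by
  refine comp (ψ := fun r _ => r) ⟨max (max |a| |b|) 1, fun r hr x => ?_, fun r _ r' _ x => ?_⟩
    (fun r hr _ => hr) hc
  · exact (abs_le_max_abs_abs hr.1 hr.2).trans (le_max_left _ _)
  · exact le_mul_of_one_le_left (abs_nonneg _) (le_max_right _ _)

end UniformLip

lemma uniformLip_Q (hκ : IsMarkov κ) (hA : IsDiffusion κ A) {f : E → ℝ} (hf : f ∈ A)
    (S : Set ℝ) {θ : ℝ → ℝ} (hθ : ∀ r r', |θ r - θ r'| ≤ |r - r'|) :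
    UniformLip S (fun r => Q κ (θ r) f) := by
  obtain ⟨B, hB⟩ := (hA.domain f hf).bounded
  obtain ⟨C, hC, h⟩ := exists_lipschitz hκ hA hf
  refine ⟨max B C, fun r _ x => (abs_P_le hκ hB _ x).trans (le_max_left _ _), fun r _ r' _ x => ?_⟩
  exact (h _ _ x).trans (mul_le_mul (le_max_right _ _) (hθ r r') (abs_nonneg _)
    (hC.trans (le_max_right _ _)))

/-- Where one factor vanishes, continuity of the other suffices for differentiability of the
product. -/
lemma hasDerivWithinAt_sub_mul {k : ℝ → ℝ} {S : Set ℝ} {r : ℝ} (hk : ContinuousWithinAt k S r) :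
    HasDerivWithinAt (fun r' => (r' - r) * k r') (k r) S r := by
  rw [hasDerivWithinAt_iff_tendsto_slope]
  refine (hk.mono Set.sdiff_subset).tendsto.congr' ?_
  filter_upwards [self_mem_nhdsWithin] with s hs
  have : s - r ≠ 0 := sub_ne_zero.2 (by simpa using hs.2)
  rw [slope_def_field]
  field_simp
  simp

lemma hasDerivWithinAt_of_abs_le_sq {k : ℝ → ℝ} {S : Set ℝ} {r C : ℝ}
    (hk : ∀ r' ∈ S, |k r'| ≤ C * (r' - r) ^ 2) (hr : r ∈ S) : HasDerivWithinAt k 0 S r := by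
  have h0 : k r = 0 := by simpa using hk r hr
  rw [hasDerivWithinAt_iff_isLittleO]
  have h1 : (fun r' : ℝ => (r' - r) ^ 2) =o[𝓝[S] r] fun r' => r' - r := by
    have h2 : (fun y : ℝ => y ^ 2) =o[𝓝 0] fun y => y := by
      simpa using Asymptotics.isLittleO_pow_pow (𝕜 := ℝ) (one_lt_two)
    have h3 : Tendsto (fun r' : ℝ => r' - r) (𝓝[S] r) (𝓝 0) := by
      have : Continuous fun r' : ℝ => r' - r := by fun_prop
      simpa using (this.tendsto r).mono_left nhdsWithin_le_nhds
    exact h2.comp_tendsto h3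
  refine Asymptotics.IsBigO.trans_isLittleO ?_ h1
  refine Asymptotics.IsBigO.of_bound C ?_
  filter_upwards [self_mem_nhdsWithin] with s hs
  simpa [h0] using hk s hs

omit [MeasurableSpace E] in
/-- The product rule for a moving state applied to a moving function. -/
lemma hasDerivWithinAt_state {S : Set ℝ} (hS : Convex ℝ S) {r : ℝ} (hr : r ∈ S)
    {ℓ : ℝ → (E → ℝ) → ℝ} (hℓ : ∀ r' ∈ S, IsState A (ℓ r')) {ψ ψ' : ℝ → E → ℝ}
    (hψ : ∀ r' ∈ S, ψ r' ∈ A) (hψ' : ψ' r ∈ A) (hL : UniformLip S ψ')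
    (hd : ∀ x, ∀ r' ∈ S, HasDerivWithinAt (fun s => ψ s x) (ψ' r' x) S r') {D : ℝ}
    (hD : HasDerivWithinAt (fun r' => ℓ r' (ψ r)) D S r)
    (hc : ContinuousWithinAt (fun r' => ℓ r' (ψ' r)) S r) :
    HasDerivWithinAt (fun r' => ℓ r' (ψ r')) (D + ℓ r (ψ' r)) S r := by
  obtain ⟨C, -, hC⟩ := hL
  -- The Taylor remainder of the curve at r. As ψ' is Lipschitz uniformly in space, it is O((r' -
  -- r)²) uniformly, and a state preserves uniform bounds. Only the frozen functions ψ r and ψ' r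
  -- then have to be followed under the moving state.
  set R : ℝ → E → ℝ := fun r' => ψ r' - ψ r - (r' - r) • ψ' r with hRdef
  have hRm : ∀ r' ∈ S, R r' ∈ A := fun r' hr' =>
    A.sub_mem (A.sub_mem (hψ r' hr') (hψ r hr)) (A.smul_mem hψ' _)
  have hR : ∀ r' ∈ S, ∀ x, |R r' x| ≤ |C| * (r' - r) ^ 2 := by
    intro r' hr' x
    have hsub : segment ℝ r r' ⊆ S := hS.segment_subset hr hr'
    have hd2 : ∀ s ∈ segment ℝ r r', HasDerivWithinAt (fun s => ψ s x - s * ψ' r x)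
        (ψ' s x - ψ' r x) (segment ℝ r r') s := by
      intro s hs
      have h1 := (hd x s (hsub hs)).mono hsub
      have h2 := ((hasDerivAt_id s).mul_const (ψ' r x)).hasDerivWithinAt (s := segment ℝ r r')
      rw [one_mul] at h2
      exact h1.sub h2
    have hb : ∀ s ∈ segment ℝ r r', ‖ψ' s x - ψ' r x‖ ≤ |C| * |r' - r| := by
      intro s hs
      have h3 : |s - r| ≤ |r' - r| := by
        rw [segment_eq_uIcc] at hs
        exact Set.abs_sub_left_of_mem_uIcc hs
      exact (hC s (hsub hs) r hr x).trans
        ((mul_le_mul_of_nonneg_right (le_abs_self C) (abs_nonneg _)).trans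
          (mul_le_mul_of_nonneg_left h3 (abs_nonneg _)))
    have := (convex_segment r r').norm_image_sub_le_of_norm_hasDerivWithin_le hd2 hb
      (left_mem_segment ℝ r r') (right_mem_segment ℝ r r')
    rw [Real.norm_eq_abs, Real.norm_eq_abs, mul_assoc, ← sq, sq_abs] at this
    convert this using 2
    simp only [hRdef, Pi.sub_apply, Pi.smul_apply, smul_eq_mul]
    ring
  have e : ∀ r' ∈ S, ℓ r' (ψ r') = ℓ r' (ψ r) + (r' - r) * ℓ r' (ψ' r) + ℓ r' (R r') := by
    intro r' hr'
    rw [hRdef]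
    simp only
    rw [(hℓ r' hr').sub (A.sub_mem (hψ r' hr') (hψ r hr)) (A.smul_mem hψ' _),
      (hℓ r' hr').sub (hψ r' hr') (hψ r hr), (hℓ r' hr').smul _ _ hψ']
    ring
  have h3 : HasDerivWithinAt (fun r' => ℓ r' (R r')) 0 S r :=
    hasDerivWithinAt_of_abs_le_sq (C := |C|)
      (fun r' hr' => (hℓ r' hr').abs_apply_le (hRm r' hr') (hR r' hr')) hr
  have h4 := (hD.add (hasDerivWithinAt_sub_mul hc)).add h3
  rw [add_zero] at h4
  exact h4.congr e (e r hr)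

/-! ### Logarithms in the algebra -/

lemma exists_smooth_log {ε : ℝ} (hε : 0 < ε) :
    ∃ φ : ℝ → ℝ, ContDiff ℝ ∞ φ ∧ ∀ y, ε ≤ y → φ y = Real.log y := by
  -- The cutoff vanishes for y ≤ ε/2 and equals 1 for y ≥ ε, so the singularity of the logarithm is
  -- removed.
  refine ⟨fun y => Real.smoothTransition (2 * y / ε - 1) * Real.log y, ?_, fun y hy => ?_⟩
  · rw [contDiff_iff_contDiffAt]
    intro y
    rcases lt_or_ge 0 y with hy | hy
    · exact (Real.smoothTransition.contDiff.contDiffAt.comp y (by fun_prop)).mul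
        (Real.contDiffAt_log.2 hy.ne')
    · refine ContDiffAt.congr_of_eventuallyEq (f := fun _ => (0 : ℝ)) contDiffAt_const ?_
      filter_upwards [Iio_mem_nhds (lt_of_le_of_lt hy (half_pos hε))] with z hz
      rw [Real.smoothTransition.zero_of_nonpos, zero_mul]
      have : 2 * z / ε ≤ 1 := by
        rw [div_le_one hε]
        have := Set.mem_Iio.1 hz
        linarith
      linarith
  · simp only
    rw [Real.smoothTransition.one_of_one_le, one_mul]
    have : 2 ≤ 2 * y / ε := by
      rw [le_div_iff₀ hε]; linarith
    linarith

lemma log_mem (hA : IsDiffusion κ A) {f : E → ℝ} (hf : f ∈ A) {ε : ℝ} (hε : 0 < ε)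
    (h : ∀ x, ε ≤ f x) : (fun x => Real.log (f x)) ∈ A := by
  obtain ⟨φ, hφ, he⟩ := exists_smooth_log hε
  have := hA.comp_mem f hf φ hφ
  simpa only [he _ (h _)] using this

lemma exists_lower_bound (hA : IsDiffusion κ A) {f : E → ℝ} (h0 : ∀ x, 0 < f x)
    (h : (fun x => Real.log (f x)) ∈ A) : ∃ ε : ℝ, 0 < ε ∧ ∀ x, ε ≤ f x := by
  obtain ⟨C, hC⟩ := (hA.domain _ h).bounded
  refine ⟨Real.exp (-C), Real.exp_pos _, fun x => ?_⟩
  rw [← Real.exp_log (h0 x)]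
  exact Real.exp_le_exp.2 (neg_le_of_abs_le (hC x))

end

section

variable {E : Type*} [MeasurableSpace E]
variable {κ : ℝ≥0 → Kernel E E} {A : Subalgebra ℝ (E → ℝ)}

/-! ### Time averages of the semigroup -/

/-- The time average of `P_v f (x)` over `[s, s + δ]`. -/
def avg (κ : ℝ≥0 → Kernel E E) (x : E) (δ s : ℝ) (f : E → ℝ) : ℝ :=
  δ⁻¹ * ∫ v in s..s + δ, Q κ v f x

section
variable (hκ : IsMarkov κ) (hA : IsDiffusion κ A) {f : E → ℝ} (hf : f ∈ A) (x : E)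
include hκ hA

lemma isState_avg {δ : ℝ} (hδ : 0 < δ) (s : ℝ) : IsState A (avg κ x δ s) where
  add f hf g hg := by
    have hQ := fun v => (isState_Q hκ hA v x).add f hf g hg
    simp only [avg, hQ]
    rw [intervalIntegral.integral_add ((continuous_Q hκ hA hf x).intervalIntegrable _ _)
      ((continuous_Q hκ hA hg x).intervalIntegrable _ _)]
    ring
  smul c f hf := by
    have hQ := fun v => (isState_Q hκ hA v x).smul c f hf
    simp only [avg, hQ, intervalIntegral.integral_const_mul]
    ring
  nonneg f hf h := mul_nonneg (inv_nonneg.2 hδ.le) (intervalIntegral.integral_nonneg (by linarith)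
    fun v _ => (isState_Q hκ hA v x).nonneg f hf h)
  one := by
    have hQ := fun v => (isState_Q hκ hA v x).one
    simp only [avg, hQ]
    simp [hδ.ne']

include hf

lemma hasDerivAt_avg (δ s : ℝ) :
    HasDerivAt (fun s => avg κ x δ s f) (δ⁻¹ * (Q κ (s + δ) f x - Q κ s f x)) s := by
  have hc := continuous_Q hκ hA hf x
  have h0 : (fun s => avg κ x δ s f)
      = fun s => δ⁻¹ * ((∫ v in (0 : ℝ)..s + δ, Q κ v f x) - ∫ v in (0 : ℝ)..s, Q κ v f x) := by
    ext s
    rw [avg, intervalIntegral.integral_interval_sub_left (hc.intervalIntegrable _ _)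
      (hc.intervalIntegrable _ _)]
  rw [h0]
  have h1 := (hc.integral_hasStrictDerivAt 0 (s + δ)).hasDerivAt.comp_add_const s δ
  exact (h1.sub (hc.integral_hasStrictDerivAt 0 s).hasDerivAt).const_mul _

/-- The reason for averaging: under the averaged functional `L` becomes a difference of two
semigroup values, which can be differentiated along a moving function. -/
lemma avg_L {δ s : ℝ} (hδ : 0 < δ) (hs : 0 ≤ s) :
    avg κ x δ s (L κ f) = δ⁻¹ * (Q κ (s + δ) f x - Q κ s f x) := by
  rw [avg, integral_Q_L hκ hA hf hs (by linarith)]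

lemma avg_Q {δ s r : ℝ} (hδ : 0 < δ) (hs : 0 ≤ s) (hr : 0 ≤ r) :
    avg κ x δ s (Q κ r f) = avg κ x δ (r + s) f := by
  have h : ∫ v in s..s + δ, Q κ v (Q κ r f) x = ∫ v in s..s + δ, Q κ (r + v) f x := by
    refine intervalIntegral.integral_congr fun v hv => ?_
    rw [Set.uIcc_of_le (by linarith)] at hv
    exact Q_Q hκ hA hf hr (hs.trans hv.1) x
  rw [avg, h, intervalIntegral.integral_comp_add_left (fun v => Q κ v f x), avg, add_assoc]

lemma tendsto_avg (s : ℝ) : Tendsto (fun δ => avg κ x δ s f) (𝓝[>] 0) (𝓝 (Q κ s f x)) := by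
  have hc := continuous_Q hκ hA hf x
  have h := (hc.integral_hasStrictDerivAt s s).hasDerivAt.tendsto_slope_zero_right
  simpa [avg] using h

end

/-! ### The logarithmic Sobolev inequality from the curvature condition -/

/-- If `c Z'² ≤ Z''` then `exp (-c Z)` is concave, hence below its tangent at the right end. -/
lemma exp_le_of_sq_le_deriv {T c : ℝ} (hT : 0 < T) {Z Z' Z'' : ℝ → ℝ} (hc : 0 ≤ c)
    (h1 : ∀ s ∈ Set.Icc 0 T, HasDerivWithinAt Z (Z' s) (Set.Icc 0 T) s)
    (h2 : ∀ s ∈ Set.Icc 0 T, HasDerivWithinAt Z' (Z'' s) (Set.Icc 0 T) s)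
    (h3 : ∀ s ∈ Set.Icc 0 T, c * Z' s ^ 2 ≤ Z'' s) :
    Real.exp (c * (Z T - Z 0)) ≤ 1 + T * (c * Z' T) := by
  set W : ℝ → ℝ := fun s => Real.exp (-c * Z s) with hW
  set W' : ℝ → ℝ := fun s => Real.exp (-c * Z s) * (-c * Z' s) with hW'
  have hd1 : ∀ s ∈ Set.Icc 0 T, HasDerivWithinAt W (W' s) (Set.Icc 0 T) s := fun s hs =>
    ((h1 s hs).const_mul (-c)).exp
  have hd2 : ∀ s ∈ Set.Icc 0 T, HasDerivWithinAt W'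
      (W' s * (-c * Z' s) + W s * (-c * Z'' s)) (Set.Icc 0 T) s := fun s hs =>
    (hd1 s hs).mul ((h2 s hs).const_mul (-c))
  have hanti : AntitoneOn W' (Set.Icc 0 T) := by
    refine antitoneOn_of_hasDerivWithinAt_nonpos (convex_Icc _ _)
      (fun s hs => (hd2 s hs).continuousWithinAt)
      (fun s hs => (hd2 s (interior_subset hs)).mono interior_subset) fun s hs => ?_
    have h4 := h3 s (interior_subset hs)
    have h5 : W' s * (-c * Z' s) + W s * (-c * Z'' s)
        = -(W s * (c * (Z'' s - c * Z' s ^ 2))) := by simp only [hW, hW']; ring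
    rw [h5, neg_nonpos]
    exact mul_nonneg (Real.exp_pos _).le (mul_nonneg hc (sub_nonneg.2 h4))
  -- The chord slope of W on [0,T] is W'(ξ) ≥ W'(T), as W' is antitone.
  obtain ⟨ξ, hξ, he⟩ := exists_hasDerivAt_eq_slope W W' hT
    (fun s hs => (hd1 s hs).continuousWithinAt)
    (fun s hs => (hd1 s (Set.Ioo_subset_Icc_self hs)).hasDerivAt (Icc_mem_nhds hs.1 hs.2))
  have h6 := hanti (Set.Ioo_subset_Icc_self hξ) (Set.right_mem_Icc.2 hT.le) hξ.2.le
  rw [he, sub_zero, le_div_iff₀ hT] at h6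
  have h7 : W 0 ≤ W T * (1 + T * (c * Z' T)) := by
    simp only [hW, hW'] at h6 ⊢
    linarith
  have h8 : W 0 = Real.exp (c * (Z T - Z 0)) * W T := by
    simp only [hW]
    rw [← Real.exp_add]
    ring_nf
  rw [h8, mul_comm] at h7
  exact le_of_mul_le_mul_left h7 (Real.exp_pos _)

section
variable (hκ : IsMarkov κ) (hA : IsDiffusion κ A) {f : E → ℝ} (hf : f ∈ A) {ε : ℝ} (hε : 0 < ε)
  (hfε : ∀ x, ε ≤ f x)
include hκ hA hf hε hfε

omit hε in
lemma Q_lower (t : ℝ) (x : E) : ε ≤ Q κ t f x := P_nonneg_bound hκ hA hf hfε _ x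

lemma log_Q_mem (t : ℝ) : (fun x => Real.log (Q κ t f x)) ∈ A :=
  log_mem hA (Q_mem hA hf t) hε (Q_lower hκ hA hf hfε t)

lemma exp_log_Q (t : ℝ) : (fun x => Real.exp (Real.log (Q κ t f x))) = Q κ t f := by
  ext x
  exact Real.exp_log (hε.trans_le (Q_lower hκ hA hf hfε t x))

lemma uniformLip_comp_Q (S : Set ℝ) {θ : ℝ → ℝ} (hθ : ∀ r r', |θ r - θ r'| ≤ |r - r'|)
    {φ : ℝ → ℝ} (hφ : ∀ y, 0 < y → ContDiffAt ℝ 1 φ y) :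
    UniformLip S (fun r x => φ (Q κ (θ r) f x)) := by
  obtain ⟨B, hB⟩ := (hA.domain f hf).bounded
  exact (uniformLip_Q hκ hA hf S hθ).comp (a := ε) (b := B)
    (fun r _ x => ⟨Q_lower hκ hA hf hfε _ x, (le_abs_self _).trans (abs_P_le hκ hB _ x)⟩)
    fun y hy => hφ y (hε.trans_le hy.1)

omit hε hfε in
lemma hasDerivWithinAt_Q_sub {T s : ℝ} (hs : s ∈ Set.Icc 0 T) (x : E) :
    HasDerivWithinAt (fun s => Q κ (T - s) f x) (-Q κ (T - s) (L κ f) x) (Set.Icc 0 T) s := by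
  have h1 : HasDerivWithinAt (fun s => T - s) (-1) (Set.Icc 0 T) s :=
    ((hasDerivAt_id s).const_sub T).hasDerivWithinAt
  have h2 := hasDerivWithinAt_Q hκ hA hf (sub_nonneg.2 hs.2) x
  have := h2.comp s h1 (fun r hr => sub_nonneg.2 hr.2)
  simpa [Function.comp_def] using this

/-- Second derivative of the entropy along the semigroup, averaged in time. -/
lemma hasDerivWithinAt_entropy {T δ : ℝ} (hδ : 0 < δ) (x : E) {s : ℝ} (hs : s ∈ Set.Icc 0 T) :
    HasDerivWithinAt
      (fun s => avg κ x δ s (Q κ (T - s) f * fun y => Real.log (Q κ (T - s) f y)))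
      (avg κ x δ s (Q κ (T - s) f *
        Gam κ (fun y => Real.log (Q κ (T - s) f y)) (fun y => Real.log (Q κ (T - s) f y))))
      (Set.Icc 0 T) s ∧
    HasDerivWithinAt
      (fun s => avg κ x δ s (Q κ (T - s) f *
        Gam κ (fun y => Real.log (Q κ (T - s) f y)) (fun y => Real.log (Q κ (T - s) f y))))
      (avg κ x δ s ((2 : ℝ) • (Q κ (T - s) f * Gam2 κ (fun y => Real.log (Q κ (T - s) f y)))))
      (Set.Icc 0 T) s := by
  set S := Set.Icc 0 T with hSdef
  set G : ℝ → E → ℝ := fun s y => Real.log (Q κ (T - s) f y) with hG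
  set F : ℝ → E → ℝ := fun s => Q κ (T - s) f with hF
  set F1 : ℝ → E → ℝ := fun s => Q κ (T - s) (L κ f) with hF1
  set F2 : ℝ → E → ℝ := fun s => Q κ (T - s) (L κ (L κ f)) with hF2
  have hLf := hA.L_mem f hf
  have hLLf := hA.L_mem _ hLf
  have hGm : ∀ s, G s ∈ A := fun s => log_Q_mem hκ hA hf hε hfε _
  have hFm : ∀ s, F s ∈ A := fun s => Q_mem hA hf _
  have hF1m : ∀ s, F1 s ∈ A := fun s => Q_mem hA hLf _
  have hF2m : ∀ s, F2 s ∈ A := fun s => Q_mem hA hLLf _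
  have hexp : ∀ s, (fun y => Real.exp (G s y)) = F s := fun s => exp_log_Q hκ hA hf hε hfε _
  have hinvm : ∀ s, (fun y => (F s y)⁻¹) ∈ A := by
    intro s
    have := exp_mem hA (A.smul_mem (hGm s) (-1 : ℝ))
    convert this using 2 with y
    simp only [Pi.smul_apply, smul_eq_mul, neg_mul, one_mul, Real.exp_neg]
    rw [← hexp]
  have hpos : ∀ s y, 0 < F s y := fun s y => hε.trans_le (Q_lower hκ hA hf hfε _ y)
  have hθ : ∀ r r' : ℝ, |(T - r) - (T - r')| ≤ |r - r'| := fun r r' => by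
    rw [abs_sub_comm r]; apply le_of_eq; congr 1; ring
  have dF : ∀ y, ∀ r ∈ S, HasDerivWithinAt (fun s => F s y) (-F1 r y) S r := fun y r hr =>
    hasDerivWithinAt_Q_sub hκ hA hf hr y
  have dF1 : ∀ y, ∀ r ∈ S, HasDerivWithinAt (fun s => F1 s y) (-F2 r y) S r := fun y r hr =>
    hasDerivWithinAt_Q_sub hκ hA hLf hr y
  have dG : ∀ y, ∀ r ∈ S, HasDerivWithinAt (fun s => G s y) (-F1 r y / F r y) S r :=
    fun y r hr => (dF y r hr).log (hpos r y).ne'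
  have uG : UniformLip S G := uniformLip_comp_Q hκ hA hf hε hfε S hθ
    fun y hy => Real.contDiffAt_log.2 hy.ne'
  have uinv : UniformLip S (fun s y => (F s y)⁻¹) := uniformLip_comp_Q hκ hA hf hε hfε S hθ
    fun y hy => contDiffAt_inv ℝ hy.ne'
  have uF1 : UniformLip S F1 := uniformLip_Q hκ hA hLf S hθ
  have uF2 : UniformLip S F2 := uniformLip_Q hκ hA hLLf S hθ
  have uG1 : UniformLip S (fun s y => G s y + 1) := uG.comp_contDiff (φ := fun y => y + 1) (by fun_prop)
  -- Since ∂ₛF = -LF, the entropy density ψ = F log F has time derivative -χ, and χ has time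
  -- derivative χ'.
  set ψ : ℝ → E → ℝ := fun s => F s * G s with hψ
  set χ : ℝ → E → ℝ := fun s => (G s + 1) * F1 s with hχ
  set χ' : ℝ → E → ℝ := fun s => -(F1 s ^ 2 * (fun y => (F s y)⁻¹) + (G s + 1) * F2 s) with hχ'
  have mG1 : ∀ s, G s + 1 ∈ A := fun s => A.add_mem (hGm s) A.one_mem
  have mψ : ∀ s, ψ s ∈ A := fun s => A.mul_mem (hFm s) (hGm s)
  have mχ : ∀ s, χ s ∈ A := fun s => A.mul_mem (mG1 s) (hF1m s)
  have mχ' : ∀ s, χ' s ∈ A := fun s => A.neg_mem (A.add_mem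
    (A.mul_mem (A.pow_mem (hF1m s) 2) (hinvm s)) (A.mul_mem (mG1 s) (hF2m s)))
  have dψ : ∀ y, ∀ r ∈ S, HasDerivWithinAt (fun s => ψ s y) ((-χ r) y) S r := by
    intro y r hr
    refine ((dF y r hr).mul (dG y r hr)).congr_deriv ?_
    have := (hpos r y).ne'
    simp only [hχ, Pi.neg_apply, Pi.mul_apply, Pi.add_apply, Pi.one_apply]
    field_simp
    ring
  have dχ : ∀ y, ∀ r ∈ S, HasDerivWithinAt (fun s => χ s y) (χ' r y) S r := by
    intro y r hr
    refine (((dG y r hr).add_const 1).mul (dF1 y r hr)).congr_deriv ?_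
    have := (hpos r y).ne'
    simp only [hχ', Pi.neg_apply, Pi.mul_apply, Pi.add_apply, Pi.pow_apply, Pi.one_apply]
    field_simp
    ring
  have uχ : UniformLip S χ := uG1.mul uF1
  have uχ' : UniformLip S χ' := by
    have := (((uF1.mul uF1).mul uinv).add (uG1.mul uF2)).neg
    convert this using 4 with s y
    simp [hχ', sq]
  have unχ : UniformLip S (fun s => -χ s) := uχ.neg
  have stA : ∀ s, IsState A (avg κ x δ s) := fun s => isState_avg hκ hA x hδ s
  have dA : ∀ {h : E → ℝ}, h ∈ A → ∀ s ∈ S,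
      HasDerivWithinAt (fun s => avg κ x δ s h) (avg κ x δ s (L κ h)) S s := by
    intro h hh s hs
    rw [avg_L hκ hA hh x hδ hs.1]
    exact (hasDerivAt_avg hκ hA hh x δ s).hasDerivWithinAt
  have dQ : ∀ {h : E → ℝ}, h ∈ A → ∀ {a : ℝ}, 0 ≤ a → ∀ s ∈ S,
      HasDerivWithinAt (fun s => Q κ (s + a) h x) (Q κ (s + a) (L κ h) x) S s := by
    intro h hh a ha s hs
    have h1 : HasDerivWithinAt (fun s => s + a) 1 S s :=
      ((hasDerivAt_id s).add_const a).hasDerivWithinAt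
    have := (hasDerivWithinAt_Q hκ hA hh (add_nonneg hs.1 ha) x).comp s h1
      (fun r hr => add_nonneg hr.1 ha)
    simpa [Function.comp_def] using this
  have e1 : ∀ s, L κ (ψ s) - χ s = F s * Gam κ (G s) (G s) := by
    intro s
    have := L_exp_mul_self hκ hA (hGm s)
    ext y
    have h2 := this y
    rw [hexp] at h2
    simp only [hψ, hχ, Pi.sub_apply, Pi.mul_apply, Pi.add_apply, Pi.one_apply]
    rw [h2, congrFun (hexp s) y, show L κ (F s) y = F1 s y from congrFun (L_Q hκ hA hf _) y]
    ring
  have e2 : ∀ s, L κ (L κ (ψ s)) - L κ (χ s) - L κ (χ s) - χ' s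
      = (2 : ℝ) • (F s * Gam2 κ (G s)) := by
    intro s
    ext y
    have h2 := L_L_entropy hκ hA (hGm s) y
    rw [hexp, show L κ (F s) = F1 s from L_Q hκ hA hf _,
      show L κ (F1 s) = F2 s from L_Q hκ hA hLf _, congrFun (hexp s) y] at h2
    simp only [hψ, hχ, hχ', Pi.sub_apply, Pi.mul_apply, Pi.add_apply, Pi.one_apply, Pi.neg_apply,
      Pi.pow_apply, Pi.smul_apply, smul_eq_mul]
    rw [← h2]
    ring
  have mLψ : ∀ s, L κ (ψ s) ∈ A := fun s => hA.L_mem _ (mψ s)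
  have mLχ : ∀ s, L κ (χ s) ∈ A := fun s => hA.L_mem _ (mχ s)
  have eA : ∀ s, avg κ x δ s (F s * Gam κ (G s) (G s)) = avg κ x δ s (L κ (ψ s))
      - avg κ x δ s (χ s) := fun s => by rw [← e1, (stA s).sub (mLψ s) (mχ s)]
  have neg_eq : ∀ {ℓ : (E → ℝ) → ℝ}, IsState A ℓ → ∀ s, ℓ (-χ s) = -ℓ (χ s) := by
    intro ℓ hℓ s
    have := hℓ.smul (-1) _ (mχ s)
    simpa using this
  constructor
  · have := hasDerivWithinAt_state (convex_Icc 0 T) hs (fun r _ => stA r) (fun r _ => mψ r)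
      (ψ' := fun s => -χ s) (A.neg_mem (mχ s)) unχ dψ (dA (mψ s) s hs)
      (dA (A.neg_mem (mχ s)) s hs).continuousWithinAt
    rw [neg_eq (stA s), ← sub_eq_add_neg, ← eA] at this
    exact this
  -- The first derivative is avg(Lψ) - avg(χ). Differentiating Lψ in time would require commuting
  -- `L` with ∂ₛ; instead avg(Lψ) is written as (P_{s+δ}ψ - P_sψ)/δ, and the product rule is applied
  -- at the two times.
  · have hq : ∀ a, 0 ≤ a → HasDerivWithinAt (fun s => Q κ (s + a) (ψ s) x)
        (Q κ (s + a) (L κ (ψ s)) x - Q κ (s + a) (χ s) x) S s := by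
      intro a ha
      have := hasDerivWithinAt_state (ℓ := fun s h => Q κ (s + a) h x) (convex_Icc 0 T) hs
        (fun r _ => isState_Q hκ hA _ x) (fun r _ => mψ r)
        (ψ' := fun s => -χ s) (A.neg_mem (mχ s)) unχ dψ (dQ (mψ s) ha s hs)
        (dQ (A.neg_mem (mχ s)) ha s hs).continuousWithinAt
      rw [neg_eq (ℓ := fun h => Q κ (s + a) h x) (isState_Q hκ hA _ x), ← sub_eq_add_neg] at this
      exact this
    have hχd := hasDerivWithinAt_state (convex_Icc 0 T) hs (fun r _ => stA r) (fun r _ => mχ r)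
      (mχ' s) uχ' dχ (dA (mχ s) s hs) (dA (mχ' s) s hs).continuousWithinAt
    have h0 := hq 0 le_rfl
    simp only [add_zero] at h0
    have htot := (((hq δ hδ.le).sub h0).const_mul δ⁻¹).sub hχd
    have hval : δ⁻¹ * (Q κ (s + δ) (L κ (ψ s)) x - Q κ (s + δ) (χ s) x
          - (Q κ s (L κ (ψ s)) x - Q κ s (χ s) x))
        - (avg κ x δ s (L κ (χ s)) + avg κ x δ s (χ' s))
        = avg κ x δ s ((2 : ℝ) • (F s * Gam2 κ (G s))) := by
      rw [← e2, (stA s).sub (A.sub_mem (A.sub_mem (hA.L_mem _ (mLψ s)) (mLχ s)) (mLχ s)) (mχ' s),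
        (stA s).sub (A.sub_mem (hA.L_mem _ (mLψ s)) (mLχ s)) (mLχ s),
        (stA s).sub (hA.L_mem _ (mLψ s)) (mLχ s), avg_L hκ hA (mLψ s) x hδ hs.1,
        avg_L hκ hA (mχ s) x hδ hs.1]
      ring
    rw [hval] at htot
    have hfun : ∀ r ∈ S, avg κ x δ r (F r * Gam κ (G r) (G r))
        = δ⁻¹ * (Q κ (r + δ) (ψ r) x - Q κ r (ψ r) x) - avg κ x δ r (χ r) := by
      intro r hr
      rw [eA, avg_L hκ hA (mψ r) x hδ hr.1]
    exact htot.congr hfun (hfun s hs)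

omit hε hfε in
lemma Q_zero' : Q κ 0 f = f := funext fun x => Q_zero hκ hA hf x

/-- The concavity lemma is applied to Z(s) = avg_s(F log F) - s avg_T(Lf), F = P_{T-s} f. The linear
term makes Z' = -avg_s(F L log F); the mass avg_s(F) = a does not depend on s; and CD(0,n) followed
by Cauchy–Schwarz with weight F gives Z'' ≥ 2/(na) Z'². -/
lemma exp_entropy_avg_le {n : ℝ} (hn : 0 < n) (hCD : CD κ A 0 n) {T δ : ℝ} (hT : 0 < T)
    (hδ : 0 < δ) (x : E) :
    Real.exp (2 / (n * avg κ x δ T f) * (avg κ x δ T (f * fun y => Real.log (f y))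
        - T * avg κ x δ T (L κ f)
        - avg κ x δ 0 (Q κ T f * fun y => Real.log (Q κ T f y))))
      ≤ 1 + T * (2 / (n * avg κ x δ T f)
        * -avg κ x δ T (f * L κ (fun y => Real.log (f y)))) := by
  have stA : ∀ s, IsState A (avg κ x δ s) := fun s => isState_avg hκ hA x hδ s
  have hLf := hA.L_mem f hf
  set a := avg κ x δ T f with ha
  have hapos : 0 < a := hε.trans_le ((stA T).le_of_forall_le hf hfε)
  set G : ℝ → E → ℝ := fun s y => Real.log (Q κ (T - s) f y) with hG
  set F : ℝ → E → ℝ := fun s => Q κ (T - s) f with hF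
  have hGm : ∀ s, G s ∈ A := fun s => log_Q_mem hκ hA hf hε hfε _
  have hFm : ∀ s, F s ∈ A := fun s => Q_mem hA hf _
  have hexp : ∀ s, (fun y => Real.exp (G s y)) = F s := fun s => exp_log_Q hκ hA hf hε hfε _
  have hFpos : ∀ s y, 0 < F s y := fun s y => hε.trans_le (Q_lower hκ hA hf hfε _ y)
  have hZ' : ∀ s ∈ Set.Icc 0 T, avg κ x δ s (F s * Gam κ (G s) (G s)) - avg κ x δ T (L κ f)
      = -avg κ x δ s (F s * L κ (G s)) := by
    intro s hs
    have h1 : avg κ x δ T (L κ f) = avg κ x δ s (L κ (F s)) := by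
      rw [hF]
      simp only
      rw [L_Q hκ hA hf, avg_Q hκ hA hLf x hδ hs.1 (sub_nonneg.2 hs.2)]
      ring_nf
    have h2 : L κ (F s) = F s * L κ (G s) + F s * Gam κ (G s) (G s) := by
      have h3 := L_exp hA (hGm s)
      ext y
      have h4 := h3 y
      rw [hexp, congrFun (hexp s) y] at h4
      rw [h4]
      simp only [Pi.add_apply, Pi.mul_apply]
      ring
    rw [h1, h2, (stA s).add _ (A.mul_mem (hFm s) (hA.L_mem _ (hGm s))) _
      (A.mul_mem (hFm s) (Gam_mem hA (hGm s) (hGm s)))]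
    ring
  have key := exp_le_of_sq_le_deriv (T := T) (c := 2 / (n * a)) hT
    (Z := fun s => avg κ x δ s (F s * G s) - s * avg κ x δ T (L κ f))
    (Z' := fun s => avg κ x δ s (F s * Gam κ (G s) (G s)) - avg κ x δ T (L κ f))
    (Z'' := fun s => avg κ x δ s ((2 : ℝ) • (F s * Gam2 κ (G s)))) (by positivity)
    (fun s hs => by
      have h1 := (hasDerivWithinAt_entropy hκ hA hf hε hfε hδ x hs).1
      have h2 := ((hasDerivAt_id s).mul_const (avg κ x δ T (L κ f))).hasDerivWithinAt
        (s := Set.Icc 0 T)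
      rw [one_mul] at h2
      exact h1.sub h2)
    (fun s hs => (hasDerivWithinAt_entropy hκ hA hf hε hfε hδ x hs).2.sub_const _)
    (fun s hs => by
      have hLG := hA.L_mem _ (hGm s)
      have ha' : avg κ x δ s (F s) = a := by
        rw [hF]
        simp only
        rw [avg_Q hκ hA hf x hδ hs.1 (sub_nonneg.2 hs.2), ha]
        ring_nf
      have hG2 : Gam2 κ (G s) ∈ A := by
        have : Gam2 κ (G s) = (1 / 2 : ℝ) • (L κ (Gam κ (G s) (G s))
            - (2 : ℝ) • Gam κ (G s) (L κ (G s))) := by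
          ext y
          simp only [Gam2, Pi.smul_apply, Pi.sub_apply, smul_eq_mul]
          ring
        rw [this]
        exact A.smul_mem (A.sub_mem (hA.L_mem _ (Gam_mem hA (hGm s) (hGm s)))
          (A.smul_mem (Gam_mem hA (hGm s) hLG) _)) _
      have hcs := (stA s).sq_le_mul (hFm s) hLG (fun y => (hFpos s y).le) (by rw [ha']; exact hapos)
      have hm := (stA s).mono (A.smul_mem (A.mul_mem (hFm s) (A.pow_mem hLG 2)) (2 / n))
        (A.smul_mem (A.mul_mem (hFm s) hG2) (2 : ℝ)) (fun y => by
          have h1 := hCD _ (hGm s) y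
          have h2 := mul_le_mul_of_nonneg_left h1 (hFpos s y).le
          simp only [Pi.smul_apply, Pi.mul_apply, Pi.pow_apply, smul_eq_mul]
          calc 2 / n * (F s y * L κ (G s) y ^ 2)
              = 2 * (F s y * (0 * Gam κ (G s) (G s) y + 1 / n * L κ (G s) y ^ 2)) := by ring
            _ ≤ _ := by linarith)
      rw [(stA s).smul _ _ (A.mul_mem (hFm s) (A.pow_mem hLG 2))] at hm
      refine le_trans ?_ hm
      rw [hZ' s hs]
      rw [ha'] at hcs
      calc 2 / (n * a) * (-avg κ x δ s (F s * L κ (G s))) ^ 2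
          = 2 / n * (avg κ x δ s (F s * L κ (G s)) ^ 2 / a) := by
            field_simp
        _ ≤ _ := mul_le_mul_of_nonneg_left hcs (by positivity))
  rw [hZ' T (Set.right_mem_Icc.2 hT.le)] at key
  have hF_T : F T = f := by
    rw [hF]; simp only [sub_self]; exact Q_zero' hκ hA hf
  have hG_T : G T = fun y => Real.log (f y) := by
    rw [hG]; simp only [sub_self]; rw [Q_zero' hκ hA hf]
  have hF_0 : F 0 = Q κ T f := by rw [hF]; simp
  have hG_0 : G 0 = fun y => Real.log (Q κ T f y) := by rw [hG]; simp
  rw [hF_T, hG_T, hF_0, hG_0] at key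
  simpa using key

end

/-- Let the averaging length δ tend to 0. Taking the limit in exponential form gives positivity of
the argument of the logarithm at once, as it dominates an exponential. -/
theorem localLogSobolev_of_CD (hκ : IsMarkov κ) (hA : IsDiffusion κ A) {n : ℝ} (hn : 0 < n)
    (hCD : CD κ A 0 n) : LocalLogSobolev κ A n := by
  intro f hf hpos hlog t x
  obtain ⟨ε, hε, hfε⟩ := exists_lower_bound hA hpos hlog
  rcases eq_or_lt_of_le (zero_le : 0 ≤ t) with rfl | ht
  · have h1 : logArg κ n 0 f x = 1 := by simp [logArg]
    have hm := (hA.domain _ (A.mul_mem hf hlog)).measurable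
    have h2 : Ent κ 0 f x = 0 := by
      have h3 := P_zero hκ hm x
      simp only [Pi.mul_def] at h3
      rw [Ent, h3, P_zero hκ (hA.domain f hf).measurable, sub_self]
    simp [h1, h2]
  have hT : (0 : ℝ) < t := ht
  have hLf := hA.L_mem f hf
  have hfl := A.mul_mem hf (hA.L_mem _ hlog)
  have hQ : Q κ t f = P κ t f := Q_coe t f
  have hPpos : 0 < P κ t f x := by
    rw [← hQ]; exact hε.trans_le (Q_lower hκ hA hf hfε _ x)
  have hlogQ := log_Q_mem hκ hA hf hε hfε t
  have t1 := tendsto_avg hκ hA hf x t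
  have t2 := tendsto_avg hκ hA (A.mul_mem hf hlog) x t
  have t3 := tendsto_avg hκ hA hLf x t
  have t4 := tendsto_avg hκ hA (A.mul_mem (Q_mem hA hf t) hlogQ) x 0
  have t5 := tendsto_avg hκ hA hfl x t
  have hne : n * Q κ t f x ≠ 0 := by rw [hQ]; positivity
  have tc := (tendsto_const_nhds (x := (2 : ℝ))).div (t1.const_mul n) hne
  have lim1 := (Real.continuous_exp.tendsto _).comp
    (tc.mul ((t2.sub (t3.const_mul (t : ℝ))).sub t4))
  have lim2 := ((tc.mul t5.neg).const_mul (t : ℝ)).const_add 1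
  have key := le_of_tendsto_of_tendsto lim1 lim2 (by
    filter_upwards [self_mem_nhdsWithin] with δ hδ
    exact exp_entropy_avg_le hκ hA hf hε hfε hn hCD hT hδ x)
  rw [Q_zero hκ hA (A.mul_mem (Q_mem hA hf t) hlogQ)] at key
  simp only [hQ, Q_coe, Pi.mul_apply] at key
  have harg : 1 + (t : ℝ) * (2 / (n * P κ t f x) * -P κ t (f * L κ fun y => Real.log (f y)) x)
      = logArg κ n t f x := by
    rw [logArg, Pi.mul_def]
    field_simp
    ring
  rw [harg] at key
  have hargpos := (Real.exp_pos _).trans_le key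
  refine ⟨hargpos, ?_⟩
  have h6 := (Real.le_log_iff_exp_le hargpos).2 key
  rw [L_P hκ hA hf, Ent]
  have h7 : P κ t (f * fun y => Real.log (f y)) x
      = P κ t (fun y => f y * Real.log (f y)) x := rfl
  rw [h7] at h6
  rw [div_mul_eq_mul_div, div_le_iff₀ (by positivity)] at h6
  linarith

end

section

variable {E : Type*} [MeasurableSpace E]
variable {κ : ℝ≥0 → Kernel E E} {A : Subalgebra ℝ (E → ℝ)}

/-! ### The curvature condition from the logarithmic Sobolev inequality -/

/-- A negative second derivative makes D1 negative just to the right of 0, so D would decrease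
strictly from the value 0. -/
lemma second_deriv_nonneg {D D1 : ℝ → ℝ} {d2 : ℝ} (h0 : D 0 = 0) (h1 : D1 0 = 0)
    (hpos : ∀ t, 0 ≤ t → 0 ≤ D t)
    (hD : ∀ t, 0 ≤ t → HasDerivWithinAt D (D1 t) (Set.Ici 0) t)
    (hD1 : HasDerivWithinAt D1 d2 (Set.Ici 0) 0) : 0 ≤ d2 := by
  by_contra! hneg
  have h2 := hD1.mono (Set.Ioi_subset_Ici_self)
  rw [hasDerivWithinAt_iff_tendsto_slope' (by simp)] at h2
  have h3 := h2.eventually (gt_mem_nhds hneg)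
  obtain ⟨δ, hδ, h4⟩ := mem_nhdsGT_iff_exists_Ioc_subset.1 h3
  have hδ : 0 < δ := hδ
  have hanti : StrictAntiOn D (Set.Icc 0 δ) := by
    refine strictAntiOn_of_hasDerivWithinAt_neg (f' := D1) (convex_Icc _ _)
      (fun t ht => ((hD t ht.1).mono Set.Icc_subset_Ici_self).continuousWithinAt) ?_ ?_
    · intro t ht
      exact (hD t (interior_subset ht).1).mono (interior_subset.trans Set.Icc_subset_Ici_self)
    · intro t ht
      rw [interior_Icc] at ht
      have h5 : slope D1 0 t < 0 := h4 ⟨ht.1, ht.2.le⟩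
      rw [slope_def_field, h1, sub_zero, sub_zero] at h5
      by_contra! h6
      exact absurd h5 (not_lt.2 (div_nonneg h6 ht.1.le))
  have := hanti (Set.left_mem_Icc.2 hδ.le) (Set.right_mem_Icc.2 hδ.le) hδ
  rw [h0] at this
  exact absurd this (not_lt.2 (hpos δ hδ.le))

/-- Second order expansion at time `0` of the dimensional logarithmic Sobolev inequality. -/
lemma lsi_second_order {n : ℝ} (hn : 0 < n) {α α1 α2 η η1 ξ ξ1 : ℝ → ℝ} {ξ2 : ℝ}
    (hα : ∀ t, 0 ≤ t → HasDerivWithinAt α (α1 t) (Set.Ici 0) t)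
    (hα1 : ∀ t, 0 ≤ t → HasDerivWithinAt α1 (α2 t) (Set.Ici 0) t)
    (hα2 : Continuous α2)
    (hη : ∀ t, 0 ≤ t → HasDerivWithinAt η (η1 t) (Set.Ici 0) t)
    (hη1 : Continuous η1)
    (hξ : ∀ t, 0 ≤ t → HasDerivWithinAt ξ (ξ1 t) (Set.Ici 0) t)
    (hξ1 : HasDerivWithinAt ξ1 ξ2 (Set.Ici 0) 0)
    (hpos : ∀ t, 0 ≤ t → 0 < α t)
    (hY : ∀ t, 0 ≤ t → 0 < 1 - 2 / n * (t * (η t / α t)))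
    (hlsi : ∀ t, 0 ≤ t → ξ t - α t * Real.log (α t)
      ≤ t * α1 t + n / 2 * (α t * Real.log (1 - 2 / n * (t * (η t / α t)))))
    (h0 : ξ 0 = α 0 * Real.log (α 0))
    (h1 : ξ1 0 = (Real.log (α 0) + 2) * α1 0 - η 0) :
    0 ≤ 2 * α2 0 - 2 * η1 0 - 2 / n * (η 0 ^ 2 / α 0) - ξ2 + α2 0 * (Real.log (α 0) + 1)
      + α1 0 ^ 2 / α 0 := by
  set S := Set.Ici (0 : ℝ)
  set ζ : ℝ → ℝ := fun t => η t / α t with hζ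
  set ζ1 : ℝ → ℝ := fun t => (η1 t * α t - η t * α1 t) / α t ^ 2 with hζ1
  set Y : ℝ → ℝ := fun t => 1 - 2 / n * (t * ζ t) with hYdef
  set Y1 : ℝ → ℝ := fun t => -(2 / n * (ζ t + t * ζ1 t)) with hY1def
  have dζ : ∀ t, 0 ≤ t → HasDerivWithinAt ζ (ζ1 t) S t := fun t ht =>
    (hη t ht).div (hα t ht) (hpos t ht).ne'
  have dY : ∀ t, 0 ≤ t → HasDerivWithinAt Y (Y1 t) S t := by
    intro t ht
    refine ((((hasDerivAt_id t).hasDerivWithinAt.mul (dζ t ht)).const_mul (2 / n)).const_sub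
      1).congr_deriv ?_
    simp [hY1def]
  have cζ1 : ContinuousWithinAt ζ1 S 0 := by
    refine ContinuousWithinAt.div ?_ ((hα 0 le_rfl).continuousWithinAt.pow 2)
      (pow_ne_zero _ (hpos 0 le_rfl).ne')
    exact (hη1.continuousWithinAt.mul (hα 0 le_rfl).continuousWithinAt).sub
      ((hη 0 le_rfl).continuousWithinAt.mul (hα1 0 le_rfl).continuousWithinAt)
  -- At t = 0 the product t k(t) only needs k continuous, so neither a third derivative of α nor a
  -- second one of η enters.
  have tmul : ∀ {k : ℝ → ℝ}, ContinuousWithinAt k S 0 →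
      HasDerivWithinAt (fun t => t * k t) (k 0) S 0 := by
    intro k hk
    simpa using hasDerivWithinAt_sub_mul hk
  have dY1 : HasDerivWithinAt Y1 (-(2 / n * (ζ1 0 + ζ1 0))) S 0 :=
    (((dζ 0 le_rfl).add (tmul cζ1)).const_mul (2 / n)).neg
  -- D is the right side of the inequality minus its left side; D1 is its derivative and d2 the
  -- second derivative at 0.
  have key := second_deriv_nonneg
    (D := fun t => t * α1 t + n / 2 * (α t * Real.log (Y t)) - ξ t + α t * Real.log (α t))
    (D1 := fun t => α1 t + t * α2 t + n / 2 * (α1 t * Real.log (Y t) + α t * (Y1 t / Y t))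
      - ξ1 t + (α1 t * Real.log (α t) + α1 t))
    (d2 := α2 0 + α2 0 + n / 2 * ((α2 0 * Real.log (Y 0) + α1 0 * (Y1 0 / Y 0))
      + (α1 0 * (Y1 0 / Y 0) + α 0 * ((-(2 / n * (ζ1 0 + ζ1 0)) * Y 0 - Y1 0 * Y1 0) / Y 0 ^ 2)))
      - ξ2 + ((α2 0 * Real.log (α 0) + α1 0 * (α1 0 / α 0)) + α2 0)) ?_ ?_ ?_ ?_ ?_
  · have e1 : Y 0 = 1 := by simp [hYdef]
    have e2 : Y1 0 = -(2 / n * (η 0 / α 0)) := by simp [hY1def, hζ]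
    have e3 : ζ1 0 = (η1 0 * α 0 - η 0 * α1 0) / α 0 ^ 2 := rfl
    rw [e1, e2, e3, Real.log_one] at key
    have hp := (hpos 0 le_rfl).ne'
    convert key using 1
    field_simp
    ring
  · simp [hYdef, h0]
  · have hp := (hpos 0 le_rfl).ne'
    simp only [hYdef, hY1def, hζ, h1]
    simp
    field_simp
    ring
  · intro t ht
    have := hlsi t ht
    simp only [hYdef, hζ]
    linarith
  · intro t ht
    refine (((((hasDerivAt_id t).hasDerivWithinAt.mul (hα1 t ht)).add
      (((hα t ht).mul ((dY t ht).log (hY t ht).ne')).const_mul (n / 2))).sub (hξ t ht)).add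
      ((hα t ht).mul ((hα t ht).log (hpos t ht).ne'))).congr_deriv ?_
    have hp := (hpos t ht).ne'
    simp only [id]
    field_simp
  · have hY0 : Y 0 ≠ 0 := (hY 0 le_rfl).ne'
    exact ((((hα1 0 le_rfl).add (tmul hα2.continuousWithinAt)).add
      ((((hα1 0 le_rfl).mul ((dY 0 le_rfl).log hY0)).add
        ((hα 0 le_rfl).mul (dY1.div (dY 0 le_rfl) hY0))).const_mul (n / 2))).sub hξ1).add
      (((hα1 0 le_rfl).mul ((hα 0 le_rfl).log (hpos 0 le_rfl).ne')).add (hα1 0 le_rfl))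

/-- For f = e^g, the second-order coefficient at t = 0 of (ii), right side minus left side, is by
`L_L_entropy` equal to 2fΓ₂(g) - (2/n) f (Lg)², up to the usual factor 1/2. -/
theorem CD_of_localLogSobolev (hκ : IsMarkov κ) (hA : IsDiffusion κ A) {n : ℝ} (hn : 0 < n)
    (hlsi : LocalLogSobolev κ A n) : CD κ A 0 n := by
  intro g hg x
  set f : E → ℝ := fun y => Real.exp (g y) with hfdef
  have hf : f ∈ A := exp_mem hA hg
  have hlogf : (fun y => Real.log (f y)) = g := by ext y; simp [hfdef]
  have hpos : ∀ y, 0 < f y := fun y => Real.exp_pos _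
  have hLf := hA.L_mem f hf
  have hLLf := hA.L_mem _ hLf
  have hLg := hA.L_mem g hg
  have hfg := A.mul_mem hf hg
  have hLfg := hA.L_mem _ hfg
  have hLLfg := hA.L_mem _ hLfg
  have hfLg := A.mul_mem hf hLg
  obtain ⟨ε, hε, hfε⟩ := exists_lower_bound hA hpos (by rw [hlogf]; exact hg)
  have hl := hlsi f hf hpos (by rw [hlogf]; exact hg)
  simp only [Ent, logArg, hlogf] at hl
  have eY : ∀ t : ℝ, 0 ≤ t → 1 - 2 * (t.toNNReal : ℝ) / n *
        (P κ t.toNNReal (fun y => f y * L κ g y) x / P κ t.toNNReal f x)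
      = 1 - 2 / n * (t * (Q κ t (f * L κ g) x / Q κ t f x)) := by
    intro t ht
    rw [Real.coe_toNNReal t ht, Q, Q, Pi.mul_def]
    ring
  have key := lsi_second_order hn (α := fun t => Q κ t f x) (α1 := fun t => Q κ t (L κ f) x)
    (α2 := fun t => Q κ t (L κ (L κ f)) x) (η := fun t => Q κ t (f * L κ g) x)
    (η1 := fun t => Q κ t (L κ (f * L κ g)) x) (ξ := fun t => Q κ t (f * g) x)
    (ξ1 := fun t => Q κ t (L κ (f * g)) x) (ξ2 := Q κ 0 (L κ (L κ (f * g))) x)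
    (fun t ht => hasDerivWithinAt_Q hκ hA hf ht x) (fun t ht => hasDerivWithinAt_Q hκ hA hLf ht x)
    (continuous_Q hκ hA hLLf x) (fun t ht => hasDerivWithinAt_Q hκ hA hfLg ht x)
    (continuous_Q hκ hA (hA.L_mem _ hfLg) x) (fun t ht => hasDerivWithinAt_Q hκ hA hfg ht x)
    (hasDerivWithinAt_Q hκ hA hLfg le_rfl x)
    (fun t _ => hε.trans_le (Q_lower hκ hA hf hfε _ x))
    (fun t ht => by rw [← eY t ht]; exact (hl t.toNNReal x).1)
    (fun t ht => by
      rw [← eY t ht]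
      have := (hl t.toNNReal x).2
      have e : L κ (P κ t.toNNReal f) x = Q κ t (L κ f) x := congrFun (L_Q hκ hA hf t) x
      have e3 : (fun y => f y * Real.log (f y)) = f * g := by
        ext y
        rw [Pi.mul_apply, ← congrFun hlogf y]
      rw [e3, e, Real.coe_toNNReal t ht] at this
      simp only [Real.coe_toNNReal t ht]
      rw [← mul_assoc (n / 2)]
      exact this)
    (by
      simp only [Q_zero hκ hA hf, Q_zero hκ hA hfg]
      simp [hfdef])
    (by
      simp only [Q_zero hκ hA hf, Q_zero hκ hA hLfg, Q_zero hκ hA hLf, Q_zero hκ hA hfLg]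
      rw [L_exp_mul_self hκ hA hg, Pi.mul_apply, congrFun hlogf x, L_exp hA hg]
      simp only [hfdef]
      ring)
  simp only [Q_zero hκ hA hf, Q_zero hκ hA hLf, Q_zero hκ hA hfLg, Q_zero hκ hA hLLf,
    Q_zero hκ hA (hA.L_mem _ hfLg), Q_zero hκ hA hLLfg, Pi.mul_apply] at key
  rw [congrFun hlogf x] at key
  have star := L_L_entropy hκ hA hg x
  -- Brings the mixed term of `L_L_entropy` into the functions L(fg), Lf and fLg that occur in the
  -- expansion.
  have e1 : (g + 1) * L κ f = L κ (f * g) - L κ f + f * L κ g := by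
    ext y
    have h1 := L_exp_mul_self hκ hA hg y
    have h2 := L_exp hA hg y
    simp only [Pi.mul_apply, Pi.add_apply, Pi.sub_apply, Pi.one_apply]
    rw [h1]
    rw [mul_add] at h2
    change L κ f y = f y * L κ g y + f y * Gam κ g g y at h2
    change (g y + 1) * L κ f y
      = (g y + 1) * L κ f y + f y * Gam κ g g y - L κ f y + f y * L κ g y
    linarith
  rw [e1, L_add hκ hA (A.sub_mem hLfg hLf) hfLg, L_sub hκ hA hLfg hLf] at star
  change L κ (L κ (f * g)) x - 2 * (L κ (L κ (f * g)) x - L κ (L κ f) x + L κ (f * L κ g) x)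
    + L κ f x ^ 2 / f x + (g x + 1) * L κ (L κ f) x = 2 * (f x * Gam2 κ g x) at star
  have e2 : (f x * L κ g x) ^ 2 / f x = f x * L κ g x ^ 2 := by
    have := (hpos x).ne'
    field_simp
  rw [e2] at key
  have h5 : f x * (1 / n * L κ g x ^ 2) ≤ f x * Gam2 κ g x := by
    have : f x * (1 / n * L κ g x ^ 2) = (2 / n * (f x * L κ g x ^ 2)) / 2 := by ring
    rw [this]
    linarith
  have h6 := le_of_mul_le_mul_left h5 (hpos x)
  rw [ge_iff_le, zero_mul, zero_add]
  exact h6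

end

section

variable {E : Type*} [MeasurableSpace E]
variable {κ : ℝ≥0 → Kernel E E} {A : Subalgebra ℝ (E → ℝ)}

/-! ### Power means along the interpolation path -/

/-- The logarithm of the power mean `(P_u (f ^ q))^{1/q} (x)`. -/
def logMean (κ : ℝ≥0 → Kernel E E) (x : E) (q u : ℝ) (f : E → ℝ) : ℝ :=
  1 / q * Real.log (Q κ u (fun y => Real.exp (q * Real.log (f y))) x)

/-- The normalised entropy defect `(Ent_{P_u}(e^k) - u L P_u(e^k)) / P_u(e^k)`. -/
def entDefect (κ : ℝ≥0 → Kernel E E) (x : E) (u : ℝ) (k : E → ℝ) : ℝ :=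
  (Q κ u ((fun y => Real.exp (k y)) * k) x
    - Q κ u (fun y => Real.exp (k y)) x * Real.log (Q κ u (fun y => Real.exp (k y)) x)
    - u * Q κ u (L κ (fun y => Real.exp (k y))) x) / Q κ u (fun y => Real.exp (k y)) x

/-- The mean of `L k` for the tilted measure proportional to `e^k P_u(x, dy)`. -/
def tiltedL (κ : ℝ≥0 → Kernel E E) (x : E) (u : ℝ) (k : E → ℝ) : ℝ :=
  Q κ u ((fun y => Real.exp (k y)) * L κ k) x / Q κ u (fun y => Real.exp (k y)) x

section
variable (hκ : IsMarkov κ) (hA : IsDiffusion κ A)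
include hκ hA

lemma Q_exp_pos {k : E → ℝ} (hk : k ∈ A) (u : ℝ) (x : E) :
    0 < Q κ u (fun y => Real.exp (k y)) x := by
  obtain ⟨C, hC⟩ := (hA.domain k hk).bounded
  exact (Real.exp_pos (-C)).trans_le (Q_lower hκ hA (exp_mem hA hk)
    (fun y => Real.exp_le_exp.2 (neg_le_of_abs_le (hC y))) u x)

/-- The logarithmic Sobolev inequality at `e^k`, in terms of `entDefect` and `tiltedL`. -/
lemma localLogSobolev_iff (n : ℝ) : LocalLogSobolev κ A n ↔
    ∀ k ∈ A, ∀ u : ℝ, 0 < u → ∀ x, 0 < 1 - 2 / n * (u * tiltedL κ x u k) ∧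
      entDefect κ x u k ≤ n / 2 * Real.log (1 - 2 / n * (u * tiltedL κ x u k)) := by
  have conv : ∀ k ∈ A, ∀ u : ℝ≥0, ∀ x,
      (logArg κ n u (fun y => Real.exp (k y)) x = 1 - 2 / n * (u * tiltedL κ x u k)) ∧
      (Ent κ u (fun y => Real.exp (k y)) x ≤ u * L κ (P κ u (fun y => Real.exp (k y))) x
        + n / 2 * P κ u (fun y => Real.exp (k y)) x
          * Real.log (logArg κ n u (fun y => Real.exp (k y)) x)
      ↔ entDefect κ x u k ≤ n / 2 * Real.log (logArg κ n u (fun y => Real.exp (k y)) x)) := by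
    intro k hk u x
    have hpos := Q_exp_pos hκ hA hk u x
    refine ⟨?_, ?_⟩
    · simp only [logArg, tiltedL, Real.log_exp, Q_coe, Pi.mul_def]
      ring
    · rw [entDefect, div_le_iff₀ hpos, Ent, ← Q_coe, ← Q_coe, L_Q hκ hA (exp_mem hA hk)]
      simp only [Real.log_exp, Pi.mul_def]
      constructor <;> intro h <;> linarith
  constructor
  · intro h k hk u hu x
    have h1 := h _ (exp_mem hA hk) (fun y => Real.exp_pos _) (by simpa using hk) u.toNNReal x
    obtain ⟨c1, c2⟩ := conv k hk u.toNNReal x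
    rw [c2] at h1
    rwa [c1, Real.coe_toNNReal u hu.le] at h1
  · intro h f hf hpos hlog t x
    set k : E → ℝ := fun y => Real.log (f y) with hk
    have he : (fun y => Real.exp (k y)) = f := by
      ext y; exact Real.exp_log (hpos y)
    obtain ⟨c1, c2⟩ := conv k hlog t x
    rcases eq_or_lt_of_le (zero_le : 0 ≤ t) with rfl | ht
    · have h1 : logArg κ n 0 f x = 1 := by simp [logArg]
      rw [he, h1] at c2
      rw [h1]
      refine ⟨one_pos, c2.2 ?_⟩
      have e1 := Q_zero hκ hA (A.mul_mem hf hlog) x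
      rw [entDefect, he, NNReal.coe_zero, e1, Q_zero hκ hA hf]
      simp [hk]
    · have h1 := h k hlog t ht x
      rw [← c1, ← c2, he] at h1
      exact h1

/-- Derivative of the power mean along a path `u = u₀ + β r`, `q = p / u`, `p = p₀ - r`. -/
lemma hasDerivWithinAt_logMean {f : E → ℝ} (hf : f ∈ A) {ε : ℝ} (hε : 0 < ε)
    (hfε : ∀ x, ε ≤ f x) {u₀ β p₀ T : ℝ} (x : E)
    (hu : ∀ r ∈ Set.Icc 0 T, 0 < u₀ + β * r) (hp : ∀ r ∈ Set.Icc 0 T, p₀ - r ≠ 0)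
    {r : ℝ} (hr : r ∈ Set.Icc 0 T) :
    HasDerivWithinAt (fun r => logMean κ x ((p₀ - r) / (u₀ + β * r)) (u₀ + β * r) (Q κ r f))
      (((-u₀ - β * p₀) * entDefect κ x (u₀ + β * r)
            (fun y => (p₀ - r) / (u₀ + β * r) * Real.log (Q κ r f y))
          + (u₀ + β * r) * ((p₀ - r) - (u₀ + β * r)) * tiltedL κ x (u₀ + β * r)
            (fun y => (p₀ - r) / (u₀ + β * r) * Real.log (Q κ r f y))) / (p₀ - r) ^ 2)
      (Set.Icc 0 T) r := by
  set S := Set.Icc 0 T with hS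
  set w := -u₀ - β * p₀ with hw
  set u : ℝ → ℝ := fun r => u₀ + β * r with hudef
  set p : ℝ → ℝ := fun r => p₀ - r with hpdef
  set q : ℝ → ℝ := fun r => p r / u r with hqdef
  set F : ℝ → E → ℝ := fun r => Q κ r f with hF
  set F1 : ℝ → E → ℝ := fun r => Q κ r (L κ f) with hF1
  set G : ℝ → E → ℝ := fun r y => Real.log (Q κ r f y) with hG
  have hLf := hA.L_mem f hf
  have hGm : ∀ s, G s ∈ A := fun s => log_Q_mem hκ hA hf hε hfε _
  have hF1m : ∀ s, F1 s ∈ A := fun s => Q_mem hA hLf _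
  have hexp : ∀ s, (fun y => Real.exp (G s y)) = F s := fun s => exp_log_Q hκ hA hf hε hfε _
  have hinvm : ∀ s, (fun y => (F s y)⁻¹) ∈ A := by
    intro s
    have := exp_mem hA (A.smul_mem (hGm s) (-1 : ℝ))
    convert this using 2 with y
    simp only [Pi.smul_apply, smul_eq_mul, neg_mul, one_mul, Real.exp_neg]
    rw [← hexp]
  have hpos : ∀ s y, 0 < F s y := fun s y => hε.trans_le (Q_lower hκ hA hf hfε _ y)
  have hθ : ∀ r r' : ℝ, |r - r'| ≤ |r - r'| := fun _ _ => le_rfl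
  have du : ∀ s, HasDerivWithinAt u β S s := fun s =>
    ((((hasDerivAt_id s).const_mul β).const_add u₀).hasDerivWithinAt (s := S)).congr_deriv
      (mul_one β)
  have dp : ∀ s, HasDerivWithinAt p (-1) S s := fun s =>
    ((hasDerivAt_id s).const_sub p₀).hasDerivWithinAt
  have dq : ∀ s ∈ S, HasDerivWithinAt q (w / u s ^ 2) S s := fun s hs =>
    ((dp s).div (du s) (hu s hs).ne').congr_deriv (by simp only [hw, hudef, hpdef]; ring)
  have dF : ∀ y, ∀ s ∈ S, HasDerivWithinAt (fun s => F s y) (F1 s y) S s := fun y s hs =>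
    (hasDerivWithinAt_Q hκ hA hf hs.1 y).mono Set.Icc_subset_Ici_self
  have dG : ∀ y, ∀ s ∈ S, HasDerivWithinAt (fun s => G s y) (F1 s y / F s y) S s :=
    fun y s hs => (dF y s hs).log (hpos s y).ne'
  set k : ℝ → E → ℝ := fun s y => q s * G s y with hk
  set h : ℝ → E → ℝ := fun s y => Real.exp (k s y) with hh
  set m : ℝ → E → ℝ := fun s y => w / u s ^ 2 * G s y + q s * (F1 s y * (F s y)⁻¹) with hm
  set h' : ℝ → E → ℝ := fun s y => h s y * m s y with hh'
  have mk : ∀ s, k s ∈ A := fun s => A.smul_mem (hGm s) (q s)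
  have mh : ∀ s, h s ∈ A := fun s => exp_mem hA (mk s)
  have mm : ∀ s, m s ∈ A := fun s =>
    A.add_mem (A.smul_mem (hGm s) (w / u s ^ 2)) (A.smul_mem (A.mul_mem (hF1m s) (hinvm s)) (q s))
  have mh' : ∀ s, h' s ∈ A := fun s => A.mul_mem (mh s) (mm s)
  have uG : UniformLip S G := uniformLip_comp_Q hκ hA hf hε hfε S hθ
    fun y hy => Real.contDiffAt_log.2 hy.ne'
  have uinv : UniformLip S (fun s y => (F s y)⁻¹) := uniformLip_comp_Q hκ hA hf hε hfε S hθ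
    fun y hy => contDiffAt_inv ℝ hy.ne'
  have uF1 : UniformLip S F1 := uniformLip_Q hκ hA hLf S hθ
  have uq : UniformLip S (fun s (_ : E) => q s) := UniformLip.scalar fun s hs => by
    have : u s ≠ 0 := (hu s hs).ne'
    simp only [hqdef, hudef, hpdef]
    exact ContDiffAt.div (by fun_prop) (by fun_prop) this
  have uq' : UniformLip S (fun s (_ : E) => w / u s ^ 2) := UniformLip.scalar fun s hs => by
    have : u s ^ 2 ≠ 0 := pow_ne_zero _ (hu s hs).ne'
    simp only [hudef]
    exact ContDiffAt.div (by fun_prop) (by fun_prop) this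
  have uh : UniformLip S h := (uq.mul uG).comp_contDiff Real.contDiff_exp
  have uh' : UniformLip S h' := uh.mul ((uq'.mul uG).add (uq.mul (uF1.mul uinv)))
  have dh : ∀ y, ∀ s ∈ S, HasDerivWithinAt (fun s => h s y) (h' s y) S s := by
    intro y s hs
    refine ((dq s hs).mul (dG y s hs)).exp.congr_deriv ?_
    simp only [hh', hh, hm, hk, Pi.mul_apply, div_eq_mul_inv]
  have dΨ := hasDerivWithinAt_state (ℓ := fun s g => Q κ (u s) g x) (convex_Icc 0 T) hr
    (fun s _ => isState_Q hκ hA _ x) (fun s _ => mh s) (mh' r) uh' dh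
    (D := β * Q κ (u r) (L κ (h r)) x) (by
      have := (hasDerivWithinAt_Q hκ hA (mh r) (hu r hr).le x).comp r (du r)
        (fun s hs => (hu s hs).le)
      rw [mul_comm]
      exact this) ((continuous_Q hκ hA (mh' r) x).continuousAt.comp_continuousWithinAt
        (du r).continuousWithinAt)
  have hΨ : 0 < Q κ (u r) (h r) x := Q_exp_pos hκ hA (mk r) _ x
  have hur : u r ≠ 0 := (hu r hr).ne'
  have hpr : p r ≠ 0 := hp r hr
  have hqr : q r ≠ 0 := div_ne_zero hpr hur
  -- The derivative produces Γ(log P_r f), which does not occur in (ii). It is eliminated by hΓ(k) =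
  -- Lh - hLk, with weight 1/q = u/p.
  have key : h' r = (w / (u r * p r)) • (h r * k r) + ((1 - u r / p r) • (h r * L κ (k r))
      + (u r / p r) • L κ (h r)) := by
    ext y
    have l1 : F1 r y = F r y * (L κ (G r) y + Gam κ (G r) (G r) y) := by
      have h2 := L_exp hA (hGm r) y
      rw [hexp, congrFun (hexp r) y] at h2
      rw [← h2]
      exact (congrFun (L_Q hκ hA hf r) y).symm
    have l2 : L κ (h r) y = h r y * (L κ (k r) y + Gam κ (k r) (k r) y) := L_exp hA (mk r) y
    have l3 : L κ (k r) y = q r * L κ (G r) y := L_smul hA (hGm r) (q r) y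
    have l4 : Gam κ (k r) (k r) y = q r * (q r * Gam κ (G r) (G r) y) := by
      have e1 := Gam_smul_left hκ hA (hGm r) (mk r) (q r) y
      have e2 := Gam_smul_right hκ hA (hGm r) (hGm r) (q r) y
      change Gam κ (k r) (k r) y = _ at e1
      rw [e1]
      congr 1
    have hFp := (hpos r y).ne'
    simp only [hh', hm, Pi.add_apply, Pi.smul_apply, Pi.mul_apply, smul_eq_mul]
    rw [l2, l3, l4, l1, show k r y = q r * G r y from rfl, show q r = p r / u r from rfl]
    field_simp
    ring
  have st := isState_Q hκ hA (u r) x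
  have mhk := A.mul_mem (mh r) (mk r)
  have mhL := A.mul_mem (mh r) (hA.L_mem _ (mk r))
  have mLh := hA.L_mem _ (mh r)
  have val : Q κ (u r) (h' r) x = w / (u r * p r) * Q κ (u r) (h r * k r) x
      + ((1 - u r / p r) * Q κ (u r) (h r * L κ (k r)) x
        + u r / p r * Q κ (u r) (L κ (h r)) x) := by
    rw [key, st.add _ (A.smul_mem mhk _) _ (A.add_mem (A.smul_mem mhL _) (A.smul_mem mLh _)),
      st.add _ (A.smul_mem mhL _) _ (A.smul_mem mLh _), st.smul _ _ mhk, st.smul _ _ mhL,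
      st.smul _ _ mLh]
  have hone : ∀ s, logMean κ x (p s / u s) (u s) (Q κ s f)
      = u s / p s * Real.log (Q κ (u s) (h s) x) := by
    intro s
    rw [logMean, one_div_div]
  refine ((((du r).div (dp r) hpr).mul (dΨ.log hΨ.ne')).congr (fun s _ => hone s)
    (hone r)).congr_deriv ?_
  simp only [val, Pi.div_apply]
  change _ = (w * ((Q κ (u r) (h r * k r) x - Q κ (u r) (h r) x * Real.log (Q κ (u r) (h r) x)
    - u r * Q κ (u r) (L κ (h r)) x) / Q κ (u r) (h r) x)
    + u r * (p r - u r) * (Q κ (u r) (h r * L κ (k r)) x / Q κ (u r) (h r) x)) / p r ^ 2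
  -- w is constant because u and p are affine; as p has slope exactly -1, the total coefficient of
  -- P_u(Lh) is -u times that of the entropy, as in `entDefect`.
  have hw' : w = -u r - β * p r := by simp only [hw, hudef, hpdef]; ring
  have hΨ' := hΨ.ne'
  rw [hw']
  generalize Q κ (u r) (h r) x = Ψ at *
  generalize Q κ (u r) (h r * k r) x = B at *
  generalize Q κ (u r) (L κ (h r)) x = C at *
  generalize Q κ (u r) (h r * L κ (k r)) x = D at *
  generalize Real.log Ψ = Z at *
  field_simp
  ring

end

end

section

variable {E : Type*} [MeasurableSpace E]
variable {κ : ℝ≥0 → Kernel E E} {A : Subalgebra ℝ (E → ℝ)}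

/-! ### Hypercontractivity in logarithmic form -/

/-- The logarithm of the hypercontractive constant (of its inverse in the reverse case). -/
def logM (q₁ q₂ u₁ u₂ : ℝ) : ℝ :=
  (1 - 1 / q₁) * Real.log ((q₁ - 1) / u₂) + (1 / q₂ - 1) * Real.log ((q₂ - 1) / u₁)
    + (1 / q₂ - 1 / q₁) * Real.log ((u₁ * q₁ - u₂ * q₂) / (q₂ - q₁))

/-- The exponents of both hypercontractive bounds. -/
structure Exponents (q₁ q₂ : ℝ) : Prop where
  one : 0 < (q₁ - 1) * (q₂ - 1)
  zero : 0 < q₁ * q₂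
  order : 0 < (q₂ - q₁) * (q₁ - 1)

/-- Both hypercontractive bounds, in logarithmic form, for functions bounded below. -/
def LogHyper (κ : ℝ≥0 → Kernel E E) (A : Subalgebra ℝ (E → ℝ)) (n q₁ q₂ : ℝ) : Prop :=
  ∀ u₁ u₂ : ℝ, 0 < u₁ → 0 < u₂ → 0 < u₁ * q₁ - u₂ * q₂ →
    ∀ f ∈ A, (∃ ε : ℝ, 0 < ε ∧ ∀ x, ε ≤ f x) → ∀ x,
      (q₁ - 1) * (logMean κ x q₂ u₂ (Q κ (u₁ * q₁ - u₂ * q₂) f) - logMean κ x q₁ u₁ f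
        - n / 2 * logM q₁ q₂ u₁ u₂) ≤ 0

/-- `logM` is the increment of (1 - 1/q) log(w/(u(q-1))) between the two ends of the path; this is
the form in which it arises by integration. -/
lemma logM_eq {q₁ q₂ u₁ u₂ w : ℝ} (h : Exponents q₁ q₂) (hu₁ : 0 < u₁) (hu₂ : 0 < u₂)
    (hT : 0 < u₁ * q₁ - u₂ * q₂) (hw : w * (u₁ * q₁ - u₂ * q₂) = u₁ * u₂ * (q₂ - q₁)) :
    logM q₁ q₂ u₁ u₂ = (1 - 1 / q₂) * Real.log (w / (u₂ * (q₂ - 1)))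
      - (1 - 1 / q₁) * Real.log (w / (u₁ * (q₁ - 1))) := by
  obtain ⟨h1, h2, h3⟩ := h
  have a1 : q₁ - 1 ≠ 0 := left_ne_zero_of_mul h1.ne'
  have a2 : q₂ - 1 ≠ 0 := right_ne_zero_of_mul h1.ne'
  have a3 : q₂ - q₁ ≠ 0 := left_ne_zero_of_mul h3.ne'
  have hw' : w = u₁ * u₂ * (q₂ - q₁) / (u₁ * q₁ - u₂ * q₂) := by
    rw [eq_div_iff hT.ne', hw]
  have l : ∀ u q : ℝ, 0 < u → q - 1 ≠ 0 → Real.log (w / (u * (q - 1))) = Real.log u₁ + Real.log u₂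
      + Real.log (q₂ - q₁) - Real.log (u₁ * q₁ - u₂ * q₂) - (Real.log u + Real.log (q - 1)) := by
    intro u q hu hq
    rw [hw', Real.log_div (by positivity) (by positivity), Real.log_div (by positivity) hT.ne',
      Real.log_mul (by positivity) a3, Real.log_mul hu₁.ne' hu₂.ne', Real.log_mul hu.ne' hq]
  rw [logM, l _ _ hu₂ a2, l _ _ hu₁ a1, Real.log_div a1 hu₂.ne', Real.log_div a2 hu₁.ne',
    Real.log_div hT.ne' a3]
  ring

/-- Legendre duality for the logarithm: y log Y ≤ y log y + Y - y for Y, y > 0, with equality at y =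
Y, where Y = 1 - (2/n)Z. -/
lemma log_le_iff_forall {n e Z : ℝ} (hn : 0 < n) :
    (0 < 1 - 2 / n * Z ∧ e ≤ n / 2 * Real.log (1 - 2 / n * Z)) ↔
      ∀ y : ℝ, 0 < y → y * e + Z - n / 2 * (y * Real.log y + 1 - y) ≤ 0 := by
  have hZ : Z = n / 2 * (1 - (1 - 2 / n * Z)) := by field_simp; ring
  set Y := 1 - 2 / n * Z with hY
  constructor
  · rintro ⟨hY0, he⟩ y hy
    have h1 := Real.log_le_sub_one_of_pos (div_pos hY0 hy)
    rw [Real.log_div hY0.ne' hy.ne'] at h1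
    have h2 : y * Real.log Y ≤ y * Real.log y + Y - y := by
      have h3 := mul_le_mul_of_nonneg_left h1 hy.le
      have h4 : y * (Y / y - 1) = Y - y := by field_simp
      linarith
    have h5 := mul_le_mul_of_nonneg_left he hy.le
    have h6 := mul_le_mul_of_nonneg_left h2 (by positivity : 0 ≤ n / 2)
    rw [hZ]
    linarith
  · intro h
    have hY0 : 0 < Y := by
      by_contra! hneg
      -- At this y the terms in e cancel and the inequality reads y ≤ Y, whence Y > 0.
      have h1 := h (Real.exp (2 / n * e)) (Real.exp_pos _)
      rw [Real.log_exp, hZ] at h1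
      have h2 : n / 2 * (Real.exp (2 / n * e) * (2 / n * e)) = Real.exp (2 / n * e) * e := by
        field_simp
      have h3 : 0 < n / 2 * (Real.exp (2 / n * e) - Y) :=
        mul_pos (by positivity) (by linarith [Real.exp_pos (2 / n * e)])
      linarith
    refine ⟨hY0, ?_⟩
    have h1 := h Y hY0
    rw [hZ] at h1
    have h2 : Y * (e - n / 2 * Real.log Y) ≤ 0 := by linarith
    have h3 := nonpos_of_mul_nonpos_right h2 hY0
    linarith

section
variable (hκ : IsMarkov κ) (hA : IsDiffusion κ A)
include hκ hA

lemma localLogSobolev_iff_forall {n : ℝ} (hn : 0 < n) : LocalLogSobolev κ A n ↔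
    ∀ k ∈ A, ∀ u : ℝ, 0 < u → ∀ x, ∀ y : ℝ, 0 < y →
      y * entDefect κ x u k + u * tiltedL κ x u k - n / 2 * (y * Real.log y + 1 - y) ≤ 0 := by
  rw [localLogSobolev_iff hκ hA]
  simp only [log_le_iff_forall hn]

/-- Derivative of the normalised power mean along the interpolation path. -/
lemma hasDerivWithinAt_logMean_sub (n : ℝ) {f : E → ℝ} (hf : f ∈ A) {ε : ℝ} (hε : 0 < ε)
    (hfε : ∀ x, ε ≤ f x) {u₀ β p₀ T w : ℝ} (x : E) (hw : w = -u₀ - β * p₀) (hw0 : w ≠ 0)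
    (hu : ∀ r ∈ Set.Icc 0 T, 0 < u₀ + β * r) (hp : ∀ r ∈ Set.Icc 0 T, p₀ - r ≠ 0)
    (hv : ∀ r ∈ Set.Icc 0 T, (p₀ - r) - (u₀ + β * r) ≠ 0)
    {r : ℝ} (hr : r ∈ Set.Icc 0 T) {y : ℝ} (hy : y = w / ((p₀ - r) - (u₀ + β * r))) :
    HasDerivWithinAt (fun r => logMean κ x ((p₀ - r) / (u₀ + β * r)) (u₀ + β * r) (Q κ r f)
        - n / 2 * (((p₀ - r) - (u₀ + β * r)) / (p₀ - r)
          * Real.log (w / ((p₀ - r) - (u₀ + β * r)))))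
      (((p₀ - r) - (u₀ + β * r)) / (p₀ - r) ^ 2 * (y * entDefect κ x (u₀ + β * r)
            (fun z => (p₀ - r) / (u₀ + β * r) * Real.log (Q κ r f z))
          + (u₀ + β * r) * tiltedL κ x (u₀ + β * r)
            (fun z => (p₀ - r) / (u₀ + β * r) * Real.log (Q κ r f z))
          - n / 2 * (y * Real.log y + 1 - y)))
      (Set.Icc 0 T) r := by
  have h1 := hasDerivWithinAt_logMean hκ hA hf hε hfε x hu hp hr
  have dp : HasDerivWithinAt (fun r => p₀ - r) (-1) (Set.Icc 0 T) r :=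
    ((hasDerivAt_id r).const_sub p₀).hasDerivWithinAt
  have du : HasDerivWithinAt (fun r => u₀ + β * r) β (Set.Icc 0 T) r :=
    ((((hasDerivAt_id r).const_mul β).const_add u₀).hasDerivWithinAt).congr_deriv (mul_one β)
  have dv := dp.sub du
  have hvr := hv r hr
  have hpr := hp r hr
  -- The correction (v/p) log(w/v), v = p - u, has derivative v/p² (y log y + 1 - y): exactly the
  -- error term of the dual form of (ii).
  have h2 := (dv.div dp hpr).mul (((dv.fun_inv hvr).const_mul w).log
    (mul_ne_zero hw0 (inv_ne_zero hvr)))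
  refine ((h1.sub (h2.const_mul (n / 2))).congr_deriv ?_)
  rw [← hw]
  generalize entDefect κ x _ _ = e
  generalize tiltedL κ x _ _ = X
  simp only [Pi.div_apply, Pi.sub_apply, ← div_eq_mul_inv, ← hy]
  generalize Real.log y = Z at *
  rw [hy]
  have hβ : (-1 - β) * (p₀ - r) = w - ((p₀ - r) - (u₀ + β * r)) := by rw [hw]; ring
  have hβ' : β = -1 - (w - ((p₀ - r) - (u₀ + β * r))) / (p₀ - r) := by
    rw [← hβ]; field_simp; ring
  generalize hV : (p₀ - r) - (u₀ + β * r) = v at *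
  have hU : u₀ + β * r = (p₀ - r) - v := by rw [← hV]; ring
  rw [hU]
  generalize p₀ - r = p at *
  rw [hβ']
  field_simp
  ring

theorem logHyper_of_localLogSobolev {n : ℝ} (hn : 0 < n) (h : LocalLogSobolev κ A n)
    {q₁ q₂ : ℝ} (hq : Exponents q₁ q₂) : LogHyper κ A n q₁ q₂ := by
  rw [localLogSobolev_iff_forall hκ hA hn] at h
  rintro u₁ u₂ hu₁ hu₂ hT f hf ⟨ε, hε, hfε⟩ x
  set T := u₁ * q₁ - u₂ * q₂ with hTdef
  -- As r runs over [0,T], u goes from u₁ to u₂, and uq = u₁q₁ - r ends at u₂q₂ by the choice of T.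
  set β := (u₂ - u₁) / T with hβ
  have a1 : q₁ - 1 ≠ 0 := left_ne_zero_of_mul hq.one.ne'
  have a2 : q₂ - 1 ≠ 0 := right_ne_zero_of_mul hq.one.ne'
  have a3 : q₂ - q₁ ≠ 0 := left_ne_zero_of_mul hq.order.ne'
  have b1 : q₁ ≠ 0 := left_ne_zero_of_mul hq.zero.ne'
  have b2 : q₂ ≠ 0 := right_ne_zero_of_mul hq.zero.ne'
  have hTβ : T * β = u₂ - u₁ := by rw [hβ]; field_simp
  -- an affine function with positive end values is positive
  have aff : ∀ a b : ℝ, 0 < a → 0 < a + b * T → ∀ r ∈ Set.Icc 0 T, 0 < a + b * r := by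
    intro a b ha hb r hr
    rcases le_total 0 b with h0 | h0
    · exact add_pos_of_pos_of_nonneg ha (mul_nonneg h0 hr.1)
    · have := mul_le_mul_of_nonpos_left hr.2 h0
      linarith
  have hu : ∀ r ∈ Set.Icc 0 T, 0 < u₁ + β * r := aff u₁ β hu₁ (by rw [mul_comm, hTβ]; linarith)
  -- The factors q₁ here and q₁ - 1 below absorb the signs, so that both ranges of exponents are
  -- treated together.
  have hp : ∀ r ∈ Set.Icc 0 T, 0 < q₁ * (u₁ * q₁ - r) := by
    intro r hr
    have := aff (u₁ * (q₁ * q₁)) (-q₁) (mul_pos hu₁ (mul_self_pos.2 b1)) (by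
      have := mul_pos hu₂ hq.zero
      rw [hTdef]; linarith) r hr
    linarith
  have hv : ∀ r ∈ Set.Icc 0 T, 0 < (q₁ - 1) * ((u₁ * q₁ - r) - (u₁ + β * r)) := by
    intro r hr
    have := aff (u₁ * ((q₁ - 1) * (q₁ - 1))) (-((q₁ - 1) * (1 + β)))
      (mul_pos hu₁ (mul_self_pos.2 a1)) (by
        have h1 := mul_pos hu₂ hq.one
        have h2 : -((q₁ - 1) * (1 + β)) * T = -((q₁ - 1) * (T + (u₂ - u₁))) := by
          rw [← hTβ]; ring
        rw [h2, hTdef]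
        linarith) r hr
    linarith
  have hp0 : ∀ r ∈ Set.Icc 0 T, u₁ * q₁ - r ≠ 0 := fun r hr => right_ne_zero_of_mul (hp r hr).ne'
  have hv0 : ∀ r ∈ Set.Icc 0 T, (u₁ * q₁ - r) - (u₁ + β * r) ≠ 0 := fun r hr =>
    right_ne_zero_of_mul (hv r hr).ne'
  set w := -u₁ - β * (u₁ * q₁) with hw
  have hwT : w * T = u₁ * u₂ * (q₂ - q₁) := by
    have : w * T = -u₁ * T - (T * β) * (u₁ * q₁) := by rw [hw]; ring
    rw [this, hTβ, hTdef]; ring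
  have hwq : 0 < w * (q₁ - 1) := by
    have : w * (q₁ - 1) = u₁ * u₂ * ((q₂ - q₁) * (q₁ - 1)) / T := by
      rw [eq_div_iff hT.ne', mul_right_comm, hwT]; ring
    rw [this]
    exact div_pos (mul_pos (mul_pos hu₁ hu₂) hq.order) hT
  have hw0 : w ≠ 0 := left_ne_zero_of_mul hwq.ne'
  have hd := fun (r : ℝ) (hr : r ∈ Set.Icc 0 T) =>
    (hasDerivWithinAt_logMean_sub hκ hA n hf hε hfε x hw hw0 hu hp0 hv0 hr rfl).const_mul (q₁ - 1)
  have hanti := antitoneOn_of_hasDerivWithinAt_nonpos (convex_Icc 0 T)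
    (fun r hr => (hd r hr).continuousWithinAt)
    (fun r hr => (hd r (interior_subset hr)).mono interior_subset) (fun r hr => by
      have hr' := interior_subset hr
      have hk : (fun z => (u₁ * q₁ - r) / (u₁ + β * r) * Real.log (Q κ r f z)) ∈ A :=
        A.smul_mem (log_Q_mem hκ hA hf hε hfε r) _
      have hypos : 0 < w / ((u₁ * q₁ - r) - (u₁ + β * r)) := by
        have h1 := div_pos hwq (hv r hr')
        rwa [mul_comm, mul_div_mul_left _ _ a1] at h1
      have h1 := h _ hk _ (hu r hr') x _ hypos
      have h2 : 0 ≤ (q₁ - 1) * ((u₁ * q₁ - r) - (u₁ + β * r)) / (u₁ * q₁ - r) ^ 2 :=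
        div_nonneg (hv r hr').le (sq_nonneg _)
      rw [← mul_assoc, ← mul_div_assoc]
      exact mul_nonpos_of_nonneg_of_nonpos h2 h1)
  have hfin := hanti (Set.left_mem_Icc.2 hT.le) (Set.right_mem_Icc.2 hT.le) hT.le
  have hp2 : u₁ * q₁ - T = u₂ * q₂ := by rw [hTdef]; ring
  have hu2' : u₁ + β * T = u₂ := by rw [mul_comm, hTβ]; ring
  simp only [hp2, hu2', mul_zero, add_zero, sub_zero] at hfin
  rw [mul_div_cancel_left₀ _ hu₂.ne', mul_div_cancel_left₀ _ hu₁.ne', Q_zero' hκ hA hf] at hfin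
  rw [logM_eq (w := w) hq hu₁ hu₂ hT hwT]
  have e1 : (u₂ * q₂ - u₂) / (u₂ * q₂) = 1 - 1 / q₂ := by field_simp
  have e2 : (u₁ * q₁ - u₁) / (u₁ * q₁) = 1 - 1 / q₁ := by field_simp
  have e3 : u₂ * q₂ - u₂ = u₂ * (q₂ - 1) := by ring
  have e4 : u₁ * q₁ - u₁ = u₁ * (q₁ - 1) := by ring
  rw [e1, e2, e3, e4] at hfin
  linarith

/-- On a short path from (u,q₁) the bound says that the corrected logarithm of the power mean, times
q₁ - 1, does not exceed its initial value. Its derivative at 0 is thus nonpositive, and up to a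
positive factor it is the linear inequality with parameter y. -/
theorem localLogSobolev_of_logHyper {n : ℝ} (hn : 0 < n) {q₁ : ℝ} (h0 : q₁ ≠ 0) (h1 : q₁ ≠ 1)
    (h : ∀ q₂, Exponents q₁ q₂ → LogHyper κ A n q₁ q₂) : LocalLogSobolev κ A n := by
  rw [localLogSobolev_iff_forall hκ hA hn]
  intro k hk u hu x y hy
  have a1 : q₁ - 1 ≠ 0 := sub_ne_zero.2 h1
  -- Chosen so that f^{q₁} = e^k.
  set f : E → ℝ := fun z => Real.exp ((q₁⁻¹ • k) z) with hfdef
  have hkm := A.smul_mem hk q₁⁻¹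
  have hf : f ∈ A := exp_mem hA hkm
  have hlogf : ∀ z, q₁ * Real.log (f z) = k z := by
    intro z
    simp only [hfdef, Real.log_exp, Pi.smul_apply, smul_eq_mul]
    field_simp
  obtain ⟨ε, hε, hfε⟩ := exists_lower_bound hA (f := f) (fun z => Real.exp_pos _)
    (by simp only [hfdef, Real.log_exp]; exact hkm)
  -- Forces w/(u(q₁ - 1)) = y at the start; the slope β is then determined by w = -u - β u q₁.
  set w := y * (u * (q₁ - 1)) with hwdef
  set β := -(w + u) / (u * q₁) with hβ
  have hw : w = -u - β * (u * q₁) := by rw [hβ]; field_simp; ring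
  have hw0 : w ≠ 0 := by positivity
  have c1 : ∀ᶠ r in 𝓝 (0 : ℝ), 0 < u + β * r :=
    (by fun_prop : Continuous fun r => u + β * r).continuousAt.eventually
      (lt_mem_nhds (by simpa using hu))
  have c2 : ∀ᶠ r in 𝓝 (0 : ℝ), 0 < q₁ * (u * q₁ - r) :=
    (by fun_prop : Continuous fun r => q₁ * (u * q₁ - r)).continuousAt.eventually
      (lt_mem_nhds (by
        have := mul_pos hu (mul_self_pos.2 h0)
        simp only [sub_zero]; linarith))
  have c3 : ∀ᶠ r in 𝓝 (0 : ℝ), 0 < (q₁ - 1) * ((u * q₁ - r) - (u + β * r)) :=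
    (by fun_prop : Continuous fun r => (q₁ - 1) * ((u * q₁ - r) - (u + β * r))).continuousAt.eventually
      (lt_mem_nhds (by
        have := mul_pos hu (mul_self_pos.2 a1)
        simp only [sub_zero, mul_zero, add_zero]; linarith))
  obtain ⟨δ, hδ, hball⟩ := Metric.eventually_nhds_iff.1 (c1.and (c2.and c3))
  set T := δ / 2 with hT
  have hTpos : 0 < T := half_pos hδ
  have hall : ∀ r ∈ Set.Icc 0 T, 0 < u + β * r ∧ 0 < q₁ * (u * q₁ - r) ∧
      0 < (q₁ - 1) * ((u * q₁ - r) - (u + β * r)) := by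
    intro r hr
    refine hball ?_
    rw [Real.dist_eq, sub_zero, abs_of_nonneg hr.1]
    have := hr.2
    linarith
  have hd := hasDerivWithinAt_logMean_sub hκ hA n hf hε hfε x hw hw0 (fun r hr => (hall r hr).1)
    (fun r hr => right_ne_zero_of_mul (hall r hr).2.1.ne')
    (fun r hr => right_ne_zero_of_mul (hall r hr).2.2.ne') (Set.left_mem_Icc.2 hTpos.le) rfl
  have e1 : w / (u * q₁ - 0 - (u + β * 0)) = y := by
    rw [hwdef, sub_zero, mul_zero, add_zero, show u * q₁ - u = u * (q₁ - 1) by ring,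
      mul_div_cancel_right₀ _ (by positivity)]
  have e2 : (fun z => (u * q₁ - 0) / (u + β * 0) * Real.log (Q κ 0 f z)) = k := by
    ext z
    rw [Q_zero' hκ hA hf, sub_zero, mul_zero, add_zero, mul_div_cancel_left₀ _ hu.ne', hlogf]
  rw [e1, e2] at hd
  have hslope := ((hd.const_mul (q₁ - 1)).mono Set.Ioc_subset_Icc_self)
  rw [hasDerivWithinAt_iff_tendsto_slope' (by simp)] at hslope
  have hne : (𝓝[Set.Ioc 0 T] (0 : ℝ)).NeBot := by
    rw [nhdsWithin_Ioc_eq_nhdsGT hTpos]; infer_instance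
  have hle := le_of_tendsto hslope (b := 0) (by
    filter_upwards [self_mem_nhdsWithin] with r hr
    obtain ⟨b1, b2, b3⟩ := hall r (Set.Ioc_subset_Icc_self hr)
    set u₂ := u + β * r with hu2
    set q₂ := (u * q₁ - r) / u₂ with hq2
    have f1 : u₂ * q₂ = u * q₁ - r := by rw [hq2]; field_simp
    have f2 : u * q₁ - u₂ * q₂ = r := by rw [f1]; ring
    have f3 : (q₂ - q₁) * (u * u₂) = r * w := by
      have : (q₂ - q₁) * (u * u₂) = u * (u₂ * q₂) - q₁ * u * u₂ := by ring
      rw [this, f1, hu2, hw]; ring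
    have hq : Exponents q₁ q₂ := by
      refine ⟨?_, ?_, ?_⟩
      · have : (q₁ - 1) * (q₂ - 1) = (q₁ - 1) * (u * q₁ - r - u₂) / u₂ := by
          rw [← f1]; field_simp
        rw [this]; exact div_pos b3 b1
      · have : q₁ * q₂ = q₁ * (u * q₁ - r) / u₂ := by rw [hq2]; ring
        rw [this]; exact div_pos b2 b1
      · have : (q₂ - q₁) * (q₁ - 1) = r * y * (u * ((q₁ - 1) * (q₁ - 1))) / (u * u₂) := by
          rw [eq_div_iff (by positivity), mul_right_comm, f3, hwdef]; ring
        rw [this]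
        exact div_pos (mul_pos (mul_pos hr.1 hy) (mul_pos hu (mul_self_pos.2 a1))) (by positivity)
    have g1 := h q₂ hq u u₂ hu b1 (by rw [f2]; exact hr.1) f hf ⟨ε, hε, hfε⟩ x
    have g2 := logM_eq (w := w) hq hu b1 (by rw [f2]; exact hr.1) (by rw [f2]; linarith)
    have hq2ne : q₂ ≠ 0 := right_ne_zero_of_mul hq.zero.ne'
    rw [f2, g2] at g1
    rw [slope_def_field]
    refine div_nonpos_of_nonpos_of_nonneg ?_ (by simpa using hr.1.le)
    simp only [mul_zero, add_zero, sub_zero]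
    rw [mul_div_cancel_left₀ _ hu.ne', Q_zero' hκ hA hf]
    have k1 : (u * q₁ - r - u₂) / (u * q₁ - r) = 1 - 1 / q₂ := by rw [← f1]; field_simp
    have k2 : (u * q₁ - u) / (u * q₁) = 1 - 1 / q₁ := by field_simp
    have k3 : u * q₁ - r - u₂ = u₂ * (q₂ - 1) := by rw [← f1]; ring
    have k4 : u * q₁ - u = u * (q₁ - 1) := by ring
    rw [k1, k2, k3, k4]
    linarith)
  rw [sub_zero, mul_zero, add_zero] at hle
  have hc : 0 < (q₁ - 1) * ((u * q₁ - u) / (u * q₁) ^ 2) := by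
    have : (q₁ - 1) * ((u * q₁ - u) / (u * q₁) ^ 2)
        = ((q₁ - 1) * (q₁ - 1)) * u / (u * q₁) ^ 2 := by ring
    rw [this]
    exact div_pos (mul_pos (mul_self_pos.2 a1) hu) (by positivity)
  rw [← mul_assoc] at hle
  exact nonpos_of_mul_nonpos_right hle hc

end

end

section

variable {E : Type*} [MeasurableSpace E]
variable {κ : ℝ≥0 → Kernel E E} {A : Subalgebra ℝ (E → ℝ)}

/-! ### Power means in `[0, ∞]` -/

lemma Admissible.coe_sub {q₁ q₂ : ℝ} {u₁ u₂ s t : ℝ≥0} (h : Admissible q₁ q₂ u₁ u₂ s t) :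
    ((t - s : ℝ≥0) : ℝ) = u₁ * q₁ - u₂ * q₂ := by
  rw [NNReal.coe_sub h.2.2.1.le, h.2.2.2]

lemma Admissible.pos {q₁ q₂ : ℝ} {u₁ u₂ s t : ℝ≥0} (h : Admissible q₁ q₂ u₁ u₂ s t) :
    0 < (u₁ : ℝ) * q₁ - u₂ * q₂ := by
  rw [← h.2.2.2, sub_pos]
  exact h.2.2.1

lemma exponents_of_one_lt {q₁ q₂ : ℝ} (h1 : 1 < q₁) (h2 : q₁ < q₂) : Exponents q₁ q₂ :=
  ⟨mul_pos (by linarith) (by linarith), mul_pos (by linarith) (by linarith),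
    mul_pos (by linarith) (by linarith)⟩

lemma ReverseExponents.lt_one {q₁ q₂ : ℝ} (h : ReverseExponents q₁ q₂) : q₁ < 1 := by
  rcases h with h | h
  · exact h.2.2
  · linarith [h.2]

lemma ReverseExponents.lt {q₁ q₂ : ℝ} (h : ReverseExponents q₁ q₂) : q₂ < q₁ := by
  rcases h with h | h
  exacts [h.2.1, h.1]

lemma ReverseExponents.exponents {q₁ q₂ : ℝ} (h : ReverseExponents q₁ q₂) : Exponents q₁ q₂ := by
  have h1 := h.lt_one
  have h2 := h.lt
  refine ⟨mul_pos_of_neg_of_neg (by linarith) (by linarith), ?_,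
    mul_pos_of_neg_of_neg (by linarith) (by linarith)⟩
  rcases h with h | h
  · exact mul_pos (by linarith) (by linarith)
  · exact mul_pos_of_neg_of_neg (by linarith) (by linarith)

lemma constM_eq_exp {q₁ q₂ u₁ u₂ : ℝ} (h1 : 1 < q₁) (h2 : q₁ < q₂) (hu₁ : 0 < u₁) (hu₂ : 0 < u₂)
    (hT : 0 < u₁ * q₁ - u₂ * q₂) (n : ℝ) :
    constM q₁ q₂ u₁ u₂ ^ (n / 2) = Real.exp (n / 2 * logM q₁ q₂ u₁ u₂) := by
  have a1 : 0 < (q₁ - 1) / u₂ := div_pos (by linarith) hu₂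
  have a2 : 0 < (q₂ - 1) / u₁ := div_pos (by linarith) hu₁
  have a3 : 0 < (u₁ * q₁ - u₂ * q₂) / (q₂ - q₁) := div_pos hT (by linarith)
  have : constM q₁ q₂ u₁ u₂ = Real.exp (logM q₁ q₂ u₁ u₂) := by
    rw [constM, logM, Real.exp_add, Real.exp_add, Real.rpow_def_of_pos a1, Real.rpow_def_of_pos a2,
      Real.rpow_def_of_pos a3]
    simp only [mul_comm]
  rw [this, ← Real.exp_mul, mul_comm]

/-- `Real.log` depends only on the absolute value, so `logM` is unchanged when q - 1 is replaced by
1 - q; the exponents of N are opposite to those of M. -/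
lemma constN_eq_exp {q₁ q₂ u₁ u₂ : ℝ} (h1 : q₁ < 1) (h2 : q₂ < q₁) (hu₁ : 0 < u₁) (hu₂ : 0 < u₂)
    (hT : 0 < u₁ * q₁ - u₂ * q₂) (n : ℝ) :
    constN q₁ q₂ u₁ u₂ ^ (n / 2) = Real.exp (-(n / 2 * logM q₁ q₂ u₁ u₂)) := by
  have a1 : 0 < (1 - q₁) / u₂ := div_pos (by linarith) hu₂
  have a2 : 0 < (1 - q₂) / u₁ := div_pos (by linarith) hu₁
  have a3 : 0 < (u₁ * q₁ - u₂ * q₂) / (q₁ - q₂) := div_pos hT (by linarith)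
  have e1 : Real.log ((q₁ - 1) / u₂) = Real.log ((1 - q₁) / u₂) := by
    rw [← Real.log_neg_eq_log, ← neg_div, neg_sub]
  have e2 : Real.log ((q₂ - 1) / u₁) = Real.log ((1 - q₂) / u₁) := by
    rw [← Real.log_neg_eq_log, ← neg_div, neg_sub]
  have e3 : Real.log ((u₁ * q₁ - u₂ * q₂) / (q₂ - q₁))
      = Real.log ((u₁ * q₁ - u₂ * q₂) / (q₁ - q₂)) := by
    rw [← Real.log_neg_eq_log, ← div_neg, neg_sub]
  have : constN q₁ q₂ u₁ u₂ = Real.exp (-logM q₁ q₂ u₁ u₂) := by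
    rw [constN, logM, e1, e2, e3, Real.rpow_def_of_pos a1, Real.rpow_def_of_pos a2,
      Real.rpow_def_of_pos a3, ← Real.exp_add, ← Real.exp_add]
    congr 1
    ring
  rw [this, ← Real.exp_mul]
  congr 1
  ring

/-- For q ≤ 0 the powers q and 1/q both reverse the order. -/
lemma powMean_mono {u : ℝ≥0} {q : ℝ} {f g : E → ℝ} (h : ∀ y, f y ≤ g y) (x : E) :
    powMean κ u q f x ≤ powMean κ u q g x := by
  rcases le_total 0 q with hq | hq
  · exact ENNReal.rpow_le_rpow (lintegral_mono fun y =>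
      ENNReal.rpow_le_rpow (ENNReal.ofReal_le_ofReal (h y)) hq) (one_div_nonneg.2 hq)
  · have anti : ∀ {a b : ℝ≥0∞} {p : ℝ}, p ≤ 0 → a ≤ b → b ^ p ≤ a ^ p := by
      intro a b p hp hab
      have h1 := ENNReal.rpow_le_rpow hab (neg_nonneg.2 hp)
      rw [ENNReal.rpow_neg, ENNReal.rpow_neg] at h1
      exact ENNReal.inv_le_inv.1 h1
    exact anti (one_div_nonpos.2 hq) (lintegral_mono fun y =>
      anti hq (ENNReal.ofReal_le_ofReal (h y)))

section
variable (hκ : IsMarkov κ) (hA : IsDiffusion κ A) {f : E → ℝ} (hf : f ∈ A)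
include hκ hA hf

lemma powMean_eq_exp {ε : ℝ} (hε : 0 < ε) (hfε : ∀ x, ε ≤ f x) (u : ℝ≥0) (q : ℝ) (x : E) :
    powMean κ u q f x = ENNReal.ofReal (Real.exp (logMean κ x q u f)) := by
  have hk : (fun y => q * Real.log (f y)) ∈ A := A.smul_mem (log_mem hA hf hε hfε) q
  have hpos := Q_exp_pos hκ hA hk u x
  have h1 : ∀ y, ENNReal.ofReal (f y) ^ q = ENNReal.ofReal (Real.exp (q * Real.log (f y))) := by
    intro y
    have hy := hε.trans_le (hfε y)
    rw [ENNReal.ofReal_rpow_of_pos hy, Real.rpow_def_of_pos hy, mul_comm]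
  rw [powMean]
  simp only [h1]
  rw [← ofReal_integral_eq_lintegral_ofReal (hA.integrable hκ (exp_mem hA hk) u x)
    (ae_of_all _ fun y => (Real.exp_pos _).le)]
  rw [Q_coe] at hpos
  change ENNReal.ofReal (P κ u (fun y => Real.exp (q * Real.log (f y))) x) ^ (1 / q) = _
  rw [ENNReal.ofReal_rpow_of_pos hpos, Real.rpow_def_of_pos hpos, logMean, Q_coe, mul_comm]

/-- Monotone convergence: decreasing with finite start for q ≥ 0, increasing for q ≤ 0. In the
second case the limit may be infinite, and no domination is available. -/
lemma tendsto_powMean (u : ℝ≥0) {q : ℝ} (x : E) :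
    Tendsto (fun m : ℕ => powMean κ u q (fun y => f y + 1 / ((m : ℝ) + 1)) x) atTop
      (𝓝 (powMean κ u q f x)) := by
  have hκm := hκ.markov u
  have hfm := (hA.domain f hf).measurable
  obtain ⟨B, hB⟩ := (hA.domain f hf).bounded
  have hmeas : ∀ c : ℝ, Measurable fun y => ENNReal.ofReal (f y + c) ^ q := fun c =>
    (ENNReal.measurable_ofReal.comp (hfm.add_const c)).pow_const q
  have hanti : ∀ y, Antitone fun m : ℕ => ENNReal.ofReal (f y + 1 / ((m : ℝ) + 1)) := by
    intro y m m' hm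
    exact ENNReal.ofReal_le_ofReal (by gcongr)
  have hlim : ∀ y, Tendsto (fun m : ℕ => ENNReal.ofReal (f y + 1 / ((m : ℝ) + 1)) ^ q) atTop
      (𝓝 (ENNReal.ofReal (f y) ^ q)) := by
    intro y
    have h1 : Tendsto (fun m : ℕ => f y + 1 / ((m : ℝ) + 1)) atTop (𝓝 (f y + 0)) :=
      tendsto_one_div_add_atTop_nhds_zero_nat.const_add _
    rw [add_zero] at h1
    exact (ENNReal.continuous_rpow_const.tendsto _).comp (ENNReal.tendsto_ofReal h1)
  refine (ENNReal.continuous_rpow_const.tendsto _).comp ?_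
  rcases le_total 0 q with hq | hq
  · refine lintegral_tendsto_of_tendsto_of_antitone (fun m => (hmeas _).aemeasurable)
      (ae_of_all _ fun y m m' hm => ENNReal.rpow_le_rpow (hanti y hm) hq) ?_ (ae_of_all _ hlim)
    have h1 : ∫⁻ y, ENNReal.ofReal (f y + 1 / (((0 : ℕ) : ℝ) + 1)) ^ q ∂(κ u x)
        ≤ ∫⁻ _, ENNReal.ofReal (B + 1) ^ q ∂(κ u x) := by
      refine lintegral_mono fun y => ENNReal.rpow_le_rpow (ENNReal.ofReal_le_ofReal ?_) hq
      have := (abs_le.1 (hB y)).2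
      simpa using this
    refine ne_top_of_le_ne_top ?_ h1
    rw [lintegral_const, measure_univ, mul_one]
    exact ENNReal.rpow_ne_top_of_nonneg hq ENNReal.ofReal_ne_top
  · refine lintegral_tendsto_of_tendsto_of_monotone (fun m => (hmeas _).aemeasurable)
      (ae_of_all _ fun y m m' hm => ?_) (ae_of_all _ hlim)
    have h1 := ENNReal.rpow_le_rpow (hanti y hm) (neg_nonneg.2 hq)
    rw [ENNReal.rpow_neg, ENNReal.rpow_neg] at h1
    exact ENNReal.inv_le_inv.1 h1

omit [MeasurableSpace E] hκ hA in
lemma add_const_mem (c : ℝ) : (fun y => f y + c) ∈ A :=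
  A.add_mem hf (A.algebraMap_mem c)

lemma P_add_const (c : ℝ) (t : ℝ≥0) : P κ t (fun y => f y + c) = fun y => P κ t f y + c := by
  ext x
  have h := P_add_mem hκ hA hf (A.algebraMap_mem c) t x
  have h2 := P_const hκ t c x
  change P κ t (fun y => f y + c) x = P κ t f x + P κ t (fun _ => c) x at h
  rw [h, h2]

end

/-! ### From the logarithmic form back to the bounds for all positive functions -/

section
variable (hκ : IsMarkov κ) (hA : IsDiffusion κ A) {n : ℝ}
include hκ hA

/-- Apply the bound to f + 1/(m+1), which P_T shifts by the same constant. The smaller side is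
handled by monotonicity, so only the larger one has to converge. -/
lemma hyper_of_bounded_below {q₁ q₂ : ℝ} {u₁ u₂ : ℝ≥0} {T : ℝ≥0} {K : ℝ}
    (h : ∀ f ∈ A, (∃ ε : ℝ, 0 < ε ∧ ∀ x, ε ≤ f x) → ∀ x,
      powMean κ u₂ q₂ (P κ T f) x ≤ powMean κ u₁ q₁ f x * ENNReal.ofReal K)
    {f : E → ℝ} (hf : f ∈ A) (hpos : ∀ x, 0 < f x) (x : E) :
    powMean κ u₂ q₂ (P κ T f) x ≤ powMean κ u₁ q₁ f x * ENNReal.ofReal K := by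
  refine ge_of_tendsto (ENNReal.Tendsto.mul_const (tendsto_powMean hκ hA hf u₁ x)
    (Or.inr ENNReal.ofReal_ne_top)) (Eventually.of_forall fun m => ?_)
  have hm : (0 : ℝ) < 1 / ((m : ℝ) + 1) := by positivity
  refine le_trans ?_ (h _ (add_const_mem hf _) ⟨_, hm, fun y => le_add_of_nonneg_left (hpos y).le⟩ x)
  refine powMean_mono (fun y => ?_) x
  rw [P_add_const hκ hA hf]
  exact le_add_of_nonneg_right hm.le

lemma reverse_of_bounded_below {q₁ q₂ : ℝ} {u₁ u₂ : ℝ≥0} {T : ℝ≥0} {K : ℝ}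
    (h : ∀ f ∈ A, (∃ ε : ℝ, 0 < ε ∧ ∀ x, ε ≤ f x) → ∀ x,
      powMean κ u₁ q₁ f x ≤ powMean κ u₂ q₂ (P κ T f) x * ENNReal.ofReal K)
    {f : E → ℝ} (hf : f ∈ A) (hpos : ∀ x, 0 < f x) (x : E) :
    powMean κ u₁ q₁ f x ≤ powMean κ u₂ q₂ (P κ T f) x * ENNReal.ofReal K := by
  refine ge_of_tendsto (ENNReal.Tendsto.mul_const (tendsto_powMean hκ hA (hA.P_mem f hf T) u₂ x)
    (Or.inr ENNReal.ofReal_ne_top)) (Eventually.of_forall fun m => ?_)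
  have hm : (0 : ℝ) < 1 / ((m : ℝ) + 1) := by positivity
  have h1 := h _ (add_const_mem hf _) ⟨_, hm, fun y => le_add_of_nonneg_left (hpos y).le⟩ x
  rw [P_add_const hκ hA hf] at h1
  exact le_trans (powMean_mono (fun y => le_add_of_nonneg_right hm.le) x) h1

/-- For functions bounded below, the logarithmic form of the bounds is the original one. -/
lemma logHyper_iff {q₁ q₂ : ℝ} {u₁ u₂ T : ℝ≥0} (hT : (T : ℝ) = u₁ * q₁ - u₂ * q₂) {f : E → ℝ}
    (hf : f ∈ A) {ε : ℝ} (hε : 0 < ε) (hfε : ∀ x, ε ≤ f x) (x : E) :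
    (1 < q₁ → ((q₁ - 1) * (logMean κ x q₂ u₂ (Q κ (u₁ * q₁ - u₂ * q₂) f) - logMean κ x q₁ u₁ f
        - n / 2 * logM q₁ q₂ u₁ u₂) ≤ 0 ↔
      powMean κ u₂ q₂ (P κ T f) x ≤ powMean κ u₁ q₁ f x
        * ENNReal.ofReal (Real.exp (n / 2 * logM q₁ q₂ u₁ u₂)))) ∧
    (q₁ < 1 → ((q₁ - 1) * (logMean κ x q₂ u₂ (Q κ (u₁ * q₁ - u₂ * q₂) f) - logMean κ x q₁ u₁ f
        - n / 2 * logM q₁ q₂ u₁ u₂) ≤ 0 ↔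
      powMean κ u₁ q₁ f x ≤ powMean κ u₂ q₂ (P κ T f) x
        * ENNReal.ofReal (Real.exp (-(n / 2 * logM q₁ q₂ u₁ u₂))))) := by
  have hPf := hA.P_mem f hf T
  have hPε := P_nonneg_bound hκ hA hf hfε T
  rw [powMean_eq_exp hκ hA hf hε hfε, powMean_eq_exp hκ hA hPf hε hPε, ← hT, Q_coe,
    ← ENNReal.ofReal_mul (Real.exp_pos _).le, ← ENNReal.ofReal_mul (Real.exp_pos _).le,
    ← Real.exp_add, ← Real.exp_add, ENNReal.ofReal_le_ofReal_iff (Real.exp_pos _).le,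
    ENNReal.ofReal_le_ofReal_iff (Real.exp_pos _).le, Real.exp_le_exp, Real.exp_le_exp]
  refine ⟨fun hq => ?_, fun hq => ?_⟩
  · constructor
    · intro h
      have := nonpos_of_mul_nonpos_right h (by linarith)
      linarith
    · intro h
      exact mul_nonpos_of_nonneg_of_nonpos (by linarith) (by linarith)
  · constructor
    · intro h
      by_contra! hlt
      have : 0 < (q₁ - 1) * (logMean κ x q₂ u₂ (P κ T f) - logMean κ x q₁ u₁ f
        - n / 2 * logM q₁ q₂ u₁ u₂) := mul_pos_of_neg_of_neg (by linarith) (by linarith)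
      linarith
    · intro h
      exact mul_nonpos_of_nonpos_of_nonneg (by linarith) (by linarith)

theorem hypercontractive_of_localLogSobolev (hn : 0 < n) (h : LocalLogSobolev κ A n) :
    Hypercontractive κ A n := by
  intro q₁ q₂ u₁ u₂ s t h1 h2 had f hf hpos x
  refine hyper_of_bounded_below hκ hA (fun f hf hε x => ?_) hf hpos x
  obtain ⟨ε, hε, hfε⟩ := id hε
  rw [constM_eq_exp h1 h2 (NNReal.coe_pos.2 had.1)
    (NNReal.coe_pos.2 had.2.1) had.pos]
  exact ((logHyper_iff hκ hA had.coe_sub hf hε hfε x).1 h1).1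
    (logHyper_of_localLogSobolev hκ hA hn h (exponents_of_one_lt h1 h2) u₁ u₂ had.1 had.2.1
      had.pos f hf ⟨ε, hε, hfε⟩ x)

theorem reverseHypercontractive_of_localLogSobolev (hn : 0 < n) (h : LocalLogSobolev κ A n) :
    ReverseHypercontractive κ A n := by
  intro q₁ q₂ u₁ u₂ s t hq had f hf hpos x
  refine reverse_of_bounded_below hκ hA (fun f hf hε x => ?_) hf hpos x
  obtain ⟨ε, hε, hfε⟩ := id hε
  rw [constN_eq_exp hq.lt_one hq.lt (NNReal.coe_pos.2 had.1)
    (NNReal.coe_pos.2 had.2.1) had.pos]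
  exact ((logHyper_iff hκ hA had.coe_sub hf hε hfε x).2 hq.lt_one).1
    (logHyper_of_localLogSobolev hκ hA hn h hq.exponents u₁ u₂ had.1 had.2.1
      had.pos f hf ⟨ε, hε, hfε⟩ x)

omit hκ hA in
lemma exists_admissible {q₁ q₂ u₁ u₂ : ℝ} (hu₁ : 0 < u₁) (hu₂ : 0 < u₂)
    (hT : 0 < u₁ * q₁ - u₂ * q₂) :
    Admissible q₁ q₂ u₁.toNNReal u₂.toNNReal 0 (u₁ * q₁ - u₂ * q₂).toNNReal := by
  refine ⟨Real.toNNReal_pos.2 hu₁, Real.toNNReal_pos.2 hu₂, Real.toNNReal_pos.2 hT, ?_⟩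
  rw [Real.coe_toNNReal _ hT.le, Real.coe_toNNReal _ hu₁.le, Real.coe_toNNReal _ hu₂.le]
  simp

theorem localLogSobolev_of_hypercontractive (hn : 0 < n) (h : Hypercontractive κ A n) :
    LocalLogSobolev κ A n := by
  refine localLogSobolev_of_logHyper hκ hA hn (q₁ := 2) (by norm_num) (by norm_num)
    fun q₂ hq u₁ u₂ hu₁ hu₂ hT f hf hε x => ?_
  obtain ⟨ε, hε, hfε⟩ := hε
  have h2 : 2 < q₂ := sub_pos.1 (pos_of_mul_pos_left hq.order (by norm_num))
  have had := exists_admissible hu₁ hu₂ hT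
  have h3 := h 2 q₂ _ _ _ _ (by norm_num) h2 had f hf (fun x => hε.trans_le (hfε x)) x
  rw [constM_eq_exp (by norm_num) h2 (NNReal.coe_pos.2 had.1)
    (NNReal.coe_pos.2 had.2.1) had.pos] at h3
  have h4 := ((logHyper_iff (n := n) hκ hA had.coe_sub hf hε hfε x).1 (by norm_num)).2 h3
  rwa [Real.coe_toNNReal _ hu₁.le, Real.coe_toNNReal _ hu₂.le] at h4

/-- Starting from q₁ = 1/2 only exponents 0 < q₂ < 1/2 occur, so the branch of exponents in (0,1)
already implies (ii). -/
theorem localLogSobolev_of_reverseHypercontractive (hn : 0 < n)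
    (h : ReverseHypercontractive κ A n) : LocalLogSobolev κ A n := by
  refine localLogSobolev_of_logHyper hκ hA hn (q₁ := 1 / 2) (by norm_num) (by norm_num)
    fun q₂ hq u₁ u₂ hu₁ hu₂ hT f hf hε x => ?_
  obtain ⟨ε, hε, hfε⟩ := hε
  have h2 : q₂ < 1 / 2 := by
    exact sub_neg.1 (neg_of_mul_pos_left hq.order (by norm_num))
  have h2' : ReverseExponents (1 / 2) q₂ :=
    Or.inl ⟨pos_of_mul_pos_right hq.zero (by norm_num), h2, by norm_num⟩
  have had := exists_admissible hu₁ hu₂ hT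
  have h3 := h (1 / 2) q₂ _ _ _ _ h2' had f hf (fun x => hε.trans_le (hfε x)) x
  rw [constN_eq_exp (by norm_num) h2 (NNReal.coe_pos.2 had.1)
    (NNReal.coe_pos.2 had.2.1) had.pos] at h3
  have h4 := ((logHyper_iff (n := n) hκ hA had.coe_sub hf hε hfε x).2 (by norm_num)).2 h3
  rwa [Real.coe_toNNReal _ hu₁.le, Real.coe_toNNReal _ hu₂.le] at h4

theorem tfae_CD (hn : 0 < n) : List.TFAE [CD κ A 0 n, LocalLogSobolev κ A n,
    Hypercontractive κ A n, ReverseHypercontractive κ A n] := by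
  tfae_have 1 → 2 := localLogSobolev_of_CD hκ hA hn
  tfae_have 2 → 1 := CD_of_localLogSobolev hκ hA hn
  tfae_have 2 → 3 := hypercontractive_of_localLogSobolev hκ hA hn
  tfae_have 3 → 2 := localLogSobolev_of_hypercontractive hκ hA hn
  tfae_have 2 → 4 := reverseHypercontractive_of_localLogSobolev hκ hA hn
  tfae_have 4 → 2 := localLogSobolev_of_reverseHypercontractive hκ hA hn
  tfae_finish

end

end

section

variable {E : Type*} [MeasurableSpace E]
/-! ### The Euclidean heat semigroup -/

variable {d : ℕ}

lemma heat_apply (t : ℝ≥0) (x : EuclideanSpace ℝ (Fin d)) :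
    heat d t x
      = (stdGaussian (EuclideanSpace ℝ (Fin d))).map (fun y => x + √(2 * (t : ℝ)) • y) := rfl

lemma P_heat {f : EuclideanSpace ℝ (Fin d) → ℝ} (hf : Measurable f) (t : ℝ≥0)
    (x : EuclideanSpace ℝ (Fin d)) :
    P (heat d) t f x
      = ∫ y, f (x + √(2 * (t : ℝ)) • y) ∂(stdGaussian (EuclideanSpace ℝ (Fin d))) := by
  rw [P, heat_apply, integral_map (by fun_prop) hf.aestronglyMeasurable]

/-- The characteristic functions multiply and the variances add. -/
lemma stdGaussian_conv {F : Type*} [NormedAddCommGroup F] [InnerProductSpace ℝ F]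
    [FiniteDimensional ℝ F] [MeasurableSpace F] [BorelSpace F] {a b c : ℝ}
    (h : a ^ 2 + b ^ 2 = c ^ 2) :
    ((stdGaussian F).map (fun y => a • y)) ∗ ((stdGaussian F).map (fun y => b • y))
      = (stdGaussian F).map (fun y => c • y) := by
  have := Measure.isProbabilityMeasure_map (μ := stdGaussian F) (f := fun y => a • y) (by fun_prop)
  have := Measure.isProbabilityMeasure_map (μ := stdGaussian F) (f := fun y => b • y) (by fun_prop)
  have := Measure.isProbabilityMeasure_map (μ := stdGaussian F) (f := fun y => c • y) (by fun_prop)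
  apply Measure.ext_of_charFun
  ext z
  rw [charFun_conv, charFun_map_smul, charFun_map_smul, charFun_map_smul, charFun_stdGaussian,
    charFun_stdGaussian, charFun_stdGaussian, ← Complex.exp_add]
  congr 1
  simp only [norm_smul, mul_pow, Complex.ofReal_mul, Real.norm_eq_abs]
  rw [← Complex.ofReal_pow |a|, ← Complex.ofReal_pow |b|, ← Complex.ofReal_pow |c|, sq_abs, sq_abs,
    sq_abs, ← h]
  push_cast
  ring

lemma isMarkov_heat (d : ℕ) : IsMarkov (heat d) where
  markov t := ⟨fun x => by
    rw [heat_apply]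
    exact Measure.isProbabilityMeasure_map (by fun_prop)⟩
  zero := by
    ext1 x
    rw [heat_apply, Kernel.id_apply]
    simp [Measure.map_const]
  add s t := by
    ext x B hB
    rw [Kernel.comp_apply' _ _ _ hB, heat_apply t,
      lintegral_map (Kernel.measurable_coe _ hB) (by fun_prop)]
    have e : (√(2 * (t : ℝ))) ^ 2 + (√(2 * (s : ℝ))) ^ 2 = (√(2 * ((s + t : ℝ≥0) : ℝ))) ^ 2 := by
      rw [Real.sq_sqrt (by positivity), Real.sq_sqrt (by positivity), Real.sq_sqrt (by positivity)]
      push_cast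
      ring
    have h := stdGaussian_conv (F := EuclideanSpace ℝ (Fin d)) e
    have m1 : heat d (s + t) x
        = ((stdGaussian (EuclideanSpace ℝ (Fin d))).map
          (fun y => √(2 * ((s + t : ℝ≥0) : ℝ)) • y)).map (fun z => x + z) := by
      rw [Measure.map_map (by fun_prop) (by fun_prop), heat_apply]
      rfl
    have := Measure.isProbabilityMeasure_map (μ := stdGaussian (EuclideanSpace ℝ (Fin d)))
      (f := fun y => √(2 * (s : ℝ)) • y) (by fun_prop)
    have hB2 : MeasurableSet ((fun z => x + z) ⁻¹' B) := (measurable_const_add x) hB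
    rw [m1, Measure.map_apply (by fun_prop) hB, ← h, ← lintegral_indicator_one hB2,
      Measure.lintegral_conv (measurable_one.indicator hB2), lintegral_map ?_ (by fun_prop)]
    · refine lintegral_congr fun y => ?_
      rw [heat_apply, ← lintegral_indicator_one hB, lintegral_map (by fun_prop) (by fun_prop),
        lintegral_map (measurable_one.indicator hB) (by fun_prop)]
      refine lintegral_congr fun z => ?_
      rw [add_assoc]
      rfl
    · exact Measurable.lintegral_prod_right' (f := fun p : EuclideanSpace ℝ (Fin d) ×
        EuclideanSpace ℝ (Fin d) => ((fun z => x + z) ⁻¹' B).indicator 1 (p.1 + p.2))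
        ((measurable_one.indicator hB2).comp measurable_add)

/-! ### Smooth functions with bounded derivatives -/

/-- Smooth maps that are bounded with all their derivatives. -/
def BoundedSmooth {V F : Type*} [NormedAddCommGroup V] [NormedSpace ℝ V] [NormedAddCommGroup F]
    [NormedSpace ℝ F] (f : V → F) : Prop :=
  ContDiff ℝ ∞ f ∧ ∀ k : ℕ, ∃ C : ℝ, ∀ x, ‖iteratedFDeriv ℝ k f x‖ ≤ C

lemma mem_smoothBounded {f : EuclideanSpace ℝ (Fin d) → ℝ} :
    f ∈ smoothBounded d ↔ BoundedSmooth f := Iff.rfl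

namespace BoundedSmooth

variable {V F G : Type*} [NormedAddCommGroup V] [NormedSpace ℝ V] [NormedAddCommGroup F]
  [NormedSpace ℝ F] [NormedAddCommGroup G] [NormedSpace ℝ G] {f : V → F}

lemma bounded (hf : BoundedSmooth f) : ∃ C : ℝ, 0 ≤ C ∧ ∀ x, ‖f x‖ ≤ C := by
  obtain ⟨C, hC⟩ := hf.2 0
  refine ⟨|C|, abs_nonneg _, fun x => ?_⟩
  have := hC x
  rw [norm_iteratedFDeriv_zero] at this
  exact this.trans (le_abs_self C)

lemma differentiable (hf : BoundedSmooth f) : Differentiable ℝ f :=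
  hf.1.differentiable (by simp)

lemma fderiv (hf : BoundedSmooth f) : BoundedSmooth (fderiv ℝ f) := by
  refine ⟨hf.1.fderiv_right (by simp), fun k => ?_⟩
  obtain ⟨C, hC⟩ := hf.2 (k + 1)
  exact ⟨C, fun x => by rw [norm_iteratedFDeriv_fderiv]; exact hC x⟩

lemma clm_comp (hf : BoundedSmooth f) (ℓ : F →L[ℝ] G) : BoundedSmooth (fun x => ℓ (f x)) := by
  refine ⟨ℓ.contDiff.comp hf.1, fun k => ?_⟩
  obtain ⟨C, hC⟩ := hf.2 k
  refine ⟨‖ℓ‖ * C, fun x => ?_⟩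
  have := ℓ.norm_iteratedFDeriv_comp_left (hf.1.contDiffAt (x := x)) (n := k)
    (by exact_mod_cast le_top)
  exact this.trans (mul_le_mul_of_nonneg_left (hC x) (norm_nonneg _))

lemma dir (hf : BoundedSmooth f) (v : V) : BoundedSmooth (fun x => _root_.fderiv ℝ f x v) :=
  hf.fderiv.clm_comp (ContinuousLinearMap.apply ℝ F v)

lemma comp {f : V → ℝ} (hf : BoundedSmooth f) {φ : ℝ → ℝ} (hφ : ContDiff ℝ ∞ φ) :
    BoundedSmooth (fun x => φ (f x)) := by
  refine ⟨hφ.comp hf.1, fun k => ?_⟩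
  obtain ⟨B, -, hB⟩ := hf.bounded
  have h1 : ∀ i : ℕ, ∃ C : ℝ, ∀ y ∈ Set.Icc (-B) B, ‖iteratedFDeriv ℝ i φ y‖ ≤ C := fun i =>
    isCompact_Icc.exists_bound_of_continuousOn
      (hφ.continuous_iteratedFDeriv (m := i) (by exact_mod_cast le_top)).continuousOn
  choose C hC using h1
  choose D hD using hf.2
  set C' := ∑ i ∈ Finset.range (k + 1), |C i| with hC'
  -- `norm_iteratedFDeriv_comp_le` asks for a bound by D'^i on the i-th derivative; as D' ≥ 1, the
  -- bound by D' suffices for i ≥ 1.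
  set D' := 1 + ∑ i ∈ Finset.range (k + 1), |D i| with hD'
  refine ⟨k.factorial * C' * D' ^ k, fun x => ?_⟩
  have hD1 : 1 ≤ D' := le_add_of_nonneg_right (Finset.sum_nonneg fun i _ => abs_nonneg _)
  refine norm_iteratedFDeriv_comp_le hφ hf.1 (by exact_mod_cast le_top) x (fun i hi => ?_)
    fun i hi hik => ?_
  · refine (hC i _ (abs_le.1 (hB x))).trans ((le_abs_self _).trans ?_)
    exact Finset.single_le_sum (f := fun i => |C i|) (fun i _ => abs_nonneg _)
      (Finset.mem_range.2 (Nat.lt_succ_of_le hi))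
  · refine (hD i x).trans ((le_abs_self _).trans ?_)
    have h2 : |D i| ≤ D' := (Finset.single_le_sum (f := fun i => |D i|) (fun i _ => abs_nonneg _)
      (Finset.mem_range.2 (Nat.lt_succ_of_le hik))).trans (by rw [hD']; linarith)
    exact h2.trans (le_self_pow₀ hD1 (by omega))

/-- Differentiation under the integral sign for averages of translates. -/
lemma hasFDerivAt_integral_add [MeasurableSpace V] [BorelSpace V] [SecondCountableTopology V]
    (hf : BoundedSmooth f) (μ : Measure V) [IsProbabilityMeasure μ] (x : V) :
    HasFDerivAt (fun x => ∫ z, f (x + z) ∂μ) (∫ z, _root_.fderiv ℝ f (x + z) ∂μ) x := by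
  obtain ⟨B, -, hB⟩ := hf.bounded
  obtain ⟨C, -, hC⟩ := hf.fderiv.bounded
  have hm : ∀ x, AEStronglyMeasurable (fun z => f (x + z)) μ :=
    fun x => (hf.1.continuous.comp (continuous_const_add x)).aestronglyMeasurable
  exact hasFDerivAt_integral_of_dominated_of_fderiv_le (μ := μ) (𝕜 := ℝ) (x₀ := x)
    (F := fun x z => f (x + z)) (s := Set.univ)
    (F' := fun x z => _root_.fderiv ℝ f (x + z)) (bound := fun _ => C)
    univ_mem (Eventually.of_forall hm)
    (Integrable.of_bound (hm x) B (ae_of_all _ fun z => hB _))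
    (hf.fderiv.1.continuous.comp (continuous_const_add x)).aestronglyMeasurable
    (ae_of_all _ fun z x _ => hC _) (integrable_const _)
    (ae_of_all _ fun z x _ => (hasFDerivAt_comp_add_right z).2 (hf.differentiable _).hasFDerivAt)

/-- Averages of translates of a function that is bounded with its derivatives. -/
lemma integral_add.{u} {V F : Type u} [NormedAddCommGroup V] [NormedSpace ℝ V]
    [NormedAddCommGroup F] [NormedSpace ℝ F] {f : V → F} [MeasurableSpace V] [BorelSpace V]
    [SecondCountableTopology V] (hf : BoundedSmooth f) (μ : Measure V)
    [IsProbabilityMeasure μ] : BoundedSmooth (fun x => ∫ z, f (x + z) ∂μ) := by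
  -- Both inductions replace F by V →L[ℝ] F, which is why F is generalised and shares its universe
  -- with V.
  constructor
  · refine contDiff_infty.2 fun n => ?_
    induction n generalizing F with
    | zero =>
      exact contDiff_zero.2 (continuous_iff_continuousAt.2 fun x =>
        (hf.hasFDerivAt_integral_add μ x).continuousAt)
    | succ n ih =>
      push_cast
      refine contDiff_succ_iff_fderiv.2
        ⟨fun x => (hf.hasFDerivAt_integral_add μ x).differentiableAt, fun h => by simp at h, ?_⟩
      rw [show _root_.fderiv ℝ (fun x => ∫ z, f (x + z) ∂μ)
        = fun x => ∫ z, _root_.fderiv ℝ f (x + z) ∂μ from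
        funext fun x => (hf.hasFDerivAt_integral_add μ x).fderiv]
      exact ih hf.fderiv
  · intro k
    induction k generalizing F with
    | zero =>
      obtain ⟨C, -, hC⟩ := hf.bounded
      refine ⟨C, fun x => ?_⟩
      rw [norm_iteratedFDeriv_zero]
      simpa using norm_integral_le_of_norm_le_const (μ := μ) (ae_of_all _ fun z => hC (x + z))
    | succ k ih =>
      obtain ⟨C, hC⟩ := ih hf.fderiv
      refine ⟨C, fun x => ?_⟩
      rw [← norm_iteratedFDeriv_fderiv, show _root_.fderiv ℝ (fun x => ∫ z, f (x + z) ∂μ)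
        = fun x => ∫ z, _root_.fderiv ℝ f (x + z) ∂μ from
        funext fun x => (hf.hasFDerivAt_integral_add μ x).fderiv]
      exact hC x

end BoundedSmooth

lemma P_heat_mem {f : EuclideanSpace ℝ (Fin d) → ℝ} (hf : f ∈ smoothBounded d) (t : ℝ≥0) :
    P (heat d) t f ∈ smoothBounded d := by
  have hm := Measure.isProbabilityMeasure_map (μ := stdGaussian (EuclideanSpace ℝ (Fin d)))
    (f := fun y => √(2 * (t : ℝ)) • y) (by fun_prop)
  have h := BoundedSmooth.integral_add (mem_smoothBounded.1 hf)
    ((stdGaussian (EuclideanSpace ℝ (Fin d))).map (fun y => √(2 * (t : ℝ)) • y))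
  rw [mem_smoothBounded]
  convert h using 2 with x
  rw [P_heat hf.1.continuous.measurable, integral_map (by fun_prop)]
  exact (hf.1.continuous.comp (continuous_const_add x)).aestronglyMeasurable

end

section

variable {E : Type*} [MeasurableSpace E]
/-! ### The generator of the heat semigroup -/

variable {d : ℕ}

namespace BoundedSmooth

variable {V F : Type*} [NormedAddCommGroup V] [NormedSpace ℝ V] [NormedAddCommGroup F]
  [NormedSpace ℝ F] {f : V → F}

/-- The constant does not depend on the base point, as the uniform bound on difference quotients
requires. -/
lemma taylor_one (hf : BoundedSmooth f) :
    ∃ C : ℝ, 0 ≤ C ∧ ∀ x z, ‖f (x + z) - f x - _root_.fderiv ℝ f x z‖ ≤ C * ‖z‖ ^ 2 := by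
  obtain ⟨C, hC0, hC⟩ := hf.fderiv.fderiv.bounded
  refine ⟨C, hC0, fun x z => ?_⟩
  have hL : ∀ w ∈ segment ℝ x (x + z),
      ‖_root_.fderiv ℝ f w - _root_.fderiv ℝ f x‖ ≤ C * ‖z‖ := by
    intro w hw
    have h1 := convex_univ.norm_image_sub_le_of_norm_fderiv_le (𝕜 := ℝ) (C := C)
      (f := _root_.fderiv ℝ f) (x := x) (y := w)
      (fun y _ => hf.fderiv.differentiable y) (fun y _ => hC y) trivial trivial
    refine h1.trans (mul_le_mul_of_nonneg_left ?_ hC0)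
    rw [segment_eq_image'] at hw
    obtain ⟨θ, ⟨h0, hθ⟩, rfl⟩ := hw
    simp only [add_sub_cancel_left, norm_smul, Real.norm_eq_abs, abs_of_nonneg h0]
    exact mul_le_of_le_one_left (norm_nonneg _) hθ
  have h2 := (convex_segment x (x + z)).norm_image_sub_le_of_norm_fderiv_le' (𝕜 := ℝ)
    (fun y _ => hf.differentiable y) hL (left_mem_segment ℝ _ _) (right_mem_segment ℝ _ _)
  simp only [add_sub_cancel_left] at h2
  exact h2.trans_eq (by ring)

lemma taylor_two (hf : BoundedSmooth f) :
    ∃ C : ℝ, 0 ≤ C ∧ ∀ x z, ‖f (x + z) - f x - _root_.fderiv ℝ f x z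
      - (1 / 2 : ℝ) • _root_.fderiv ℝ (_root_.fderiv ℝ f) x z z‖ ≤ C * ‖z‖ ^ 3 := by
  obtain ⟨C, hC0, hC⟩ := hf.fderiv.taylor_one
  refine ⟨C, hC0, fun x z => ?_⟩
  -- Along r ↦ x + r z the derivative of the second-order remainder is the first-order remainder of
  -- the differential, evaluated at z.
  have h := norm_image_sub_le_of_norm_deriv_le_segment_01'
    (f := fun r : ℝ => f (x + r • z) - r • _root_.fderiv ℝ f x z
      - (r ^ 2 / 2) • _root_.fderiv ℝ (_root_.fderiv ℝ f) x z z)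
    (f' := fun r : ℝ => (_root_.fderiv ℝ f (x + r • z) - _root_.fderiv ℝ f x
      - _root_.fderiv ℝ (_root_.fderiv ℝ f) x (r • z)) z)
    (C := C * ‖z‖ ^ 3) (fun r _ => ?_) (fun r hr => ?_)
  · convert h using 2
    simp only [one_smul, zero_smul, add_zero, one_pow]
    simp
    abel
  · have h1 : HasDerivAt (fun r : ℝ => x + r • z) z r := by
      simpa using ((hasDerivAt_id r).smul_const z).const_add x
    have h2 := (hf.differentiable (x + r • z)).hasFDerivAt.comp_hasDerivAt r h1
    have h3 := (hasDerivAt_id r).smul_const (_root_.fderiv ℝ f x z)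
    have h4 := (((hasDerivAt_id r).pow 2).div_const 2).smul_const
      (_root_.fderiv ℝ (_root_.fderiv ℝ f) x z z)
    refine HasDerivWithinAt.congr_deriv (HasDerivAt.hasDerivWithinAt ((h2.sub h3).sub h4)) ?_
    simp
  · refine (ContinuousLinearMap.le_opNorm _ _).trans ?_
    have h1 := hC x (r • z)
    have h2 : ‖r • z‖ ≤ ‖z‖ := by
      rw [norm_smul, Real.norm_eq_abs, abs_of_nonneg hr.1]
      exact mul_le_of_le_one_left (norm_nonneg _) hr.2.le
    calc _ ≤ (C * ‖r • z‖ ^ 2) * ‖z‖ := by gcongr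
      _ ≤ (C * ‖z‖ ^ 2) * ‖z‖ := by gcongr
      _ = _ := by ring

end BoundedSmooth

/-! ### Gaussian moments -/

lemma integrable_norm_pow_stdGaussian (k : ℕ) :
    Integrable (fun y => ‖y‖ ^ k) (stdGaussian (EuclideanSpace ℝ (Fin d))) := by
  rcases Nat.eq_zero_or_pos k with rfl | hk
  · simp
  · exact (IsGaussian.memLp_id (stdGaussian (EuclideanSpace ℝ (Fin d))) k
      (by simp)).integrable_norm_pow hk.ne'

lemma integral_coord_mul_coord_stdGaussian (i j : Fin d) :
    ∫ y, y i * y j ∂(stdGaussian (EuclideanSpace ℝ (Fin d))) = if i = j then 1 else 0 := by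
  have h := covarianceBilin_apply (IsGaussian.memLp_id
    (stdGaussian (EuclideanSpace ℝ (Fin d))) 2 (by simp))
    (EuclideanSpace.basisFun (Fin d) ℝ i) (EuclideanSpace.basisFun (Fin d) ℝ j)
  rw [covarianceBilin_stdGaussian] at h
  simp only [id, integral_id_stdGaussian, sub_zero] at h
  simp only [EuclideanSpace.basisFun_apply, EuclideanSpace.inner_single_left, map_one,
    one_mul] at h
  refine h.symm.trans ((innerSL_apply_apply ℝ _ _).trans ?_)
  rw [EuclideanSpace.inner_single_left]
  simp

lemma integral_bilin_stdGaussian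
    (B : EuclideanSpace ℝ (Fin d) →L[ℝ] EuclideanSpace ℝ (Fin d) →L[ℝ] ℝ) :
    ∫ y, B y y ∂(stdGaussian (EuclideanSpace ℝ (Fin d)))
      = ∑ i, B (EuclideanSpace.basisFun (Fin d) ℝ i) (EuclideanSpace.basisFun (Fin d) ℝ i) := by
  set e := EuclideanSpace.basisFun (Fin d) ℝ
  have hi : ∀ i j : Fin d, Integrable (fun y : EuclideanSpace ℝ (Fin d) => y i * y j)
      (stdGaussian (EuclideanSpace ℝ (Fin d))) := by
    intro i j
    refine (integrable_norm_pow_stdGaussian 2).mono' (by fun_prop) (ae_of_all _ fun y => ?_)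
    rw [norm_mul, sq]
    exact mul_le_mul (PiLp.norm_apply_le _ _) (PiLp.norm_apply_le _ _) (norm_nonneg _)
      (norm_nonneg _)
  have hB : ∀ y : EuclideanSpace ℝ (Fin d),
      B y y = ∑ i, ∑ j, (y i * y j) * B (e i) (e j) := by
    intro y
    have hy : y = ∑ i, y i • e i := (e.sum_repr y).symm
    conv_lhs => rw [hy]
    simp only [map_sum, map_smul, sum_apply, smul_apply,
      smul_eq_mul, Finset.mul_sum]
    rw [Finset.sum_comm]
    exact Finset.sum_congr rfl fun i _ => Finset.sum_congr rfl fun j _ => by ring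
  rw [integral_congr_ae (ae_of_all _ hB),
    integral_finsetSum _ fun i _ => integrable_finsetSum _ fun j _ => (hi i j).mul_const _]
  refine Finset.sum_congr rfl fun i _ => ?_
  rw [integral_finsetSum _ fun j _ => (hi i j).mul_const _]
  simp [integral_mul_const, integral_coord_mul_coord_stdGaussian]

/-- The partial derivatives of a function on `ℝ^d`. -/
def coordDeriv (i : Fin d) (f : EuclideanSpace ℝ (Fin d) → ℝ) (x : EuclideanSpace ℝ (Fin d)) : ℝ :=
  fderiv ℝ f x (EuclideanSpace.basisFun (Fin d) ℝ i)

/-! ### Calculus of partial derivatives -/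

section coordDeriv

variable {f g : EuclideanSpace ℝ (Fin d) → ℝ} (hf : f ∈ smoothBounded d)
  (hg : g ∈ smoothBounded d) (i j : Fin d)

include hf

lemma coordDeriv_mem : coordDeriv i f ∈ smoothBounded d :=
  BoundedSmooth.dir (mem_smoothBounded.1 hf) _

lemma differentiable_of_mem : Differentiable ℝ f :=
  BoundedSmooth.differentiable (mem_smoothBounded.1 hf)

lemma coordDeriv_coordDeriv (x : EuclideanSpace ℝ (Fin d)) :
    coordDeriv j (coordDeriv i f) x
      = fderiv ℝ (fderiv ℝ f) x (EuclideanSpace.basisFun (Fin d) ℝ j)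
          (EuclideanSpace.basisFun (Fin d) ℝ i) := by
  have h := ((ContinuousLinearMap.apply ℝ ℝ (EuclideanSpace.basisFun (Fin d) ℝ i)).hasFDerivAt.comp
    x (BoundedSmooth.differentiable (mem_smoothBounded.1 hf).fderiv x).hasFDerivAt).fderiv
  exact DFunLike.congr_fun h (EuclideanSpace.basisFun (Fin d) ℝ j)

lemma coordDeriv_comm : coordDeriv j (coordDeriv i f) = coordDeriv i (coordDeriv j f) := by
  ext x
  rw [coordDeriv_coordDeriv hf, coordDeriv_coordDeriv hf]
  exact (hf.1.contDiffAt.isSymmSndFDerivAt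
    (by rw [minSmoothness_of_isRCLikeNormedField]; exact ENat.LEInfty.out)) _ _

lemma coordDeriv_comp {φ : ℝ → ℝ} (hφ : Differentiable ℝ φ) :
    coordDeriv i (fun x => φ (f x)) = fun x => deriv φ (f x) * coordDeriv i f x := by
  ext x
  have h := ((hφ (f x)).hasDerivAt.comp_hasFDerivAt x
    (differentiable_of_mem hf x).hasFDerivAt).fderiv
  exact DFunLike.congr_fun h (EuclideanSpace.basisFun (Fin d) ℝ i)

include hg

lemma coordDeriv_mul :
    coordDeriv i (f * g) = f * coordDeriv i g + g * coordDeriv i f := by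
  ext x
  have h := ((differentiable_of_mem hf x).hasFDerivAt.mul
    (differentiable_of_mem hg x).hasFDerivAt).fderiv
  exact DFunLike.congr_fun h (EuclideanSpace.basisFun (Fin d) ℝ i)

lemma coordDeriv_add : coordDeriv i (f + g) = coordDeriv i f + coordDeriv i g := by
  ext x
  have h := ((differentiable_of_mem hf x).hasFDerivAt.add
    (differentiable_of_mem hg x).hasFDerivAt).fderiv
  exact DFunLike.congr_fun h (EuclideanSpace.basisFun (Fin d) ℝ i)

end coordDeriv

lemma coordDeriv_sum {ι : Type*} (s : Finset ι) {f : ι → EuclideanSpace ℝ (Fin d) → ℝ}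
    (hf : ∀ k, f k ∈ smoothBounded d) (i : Fin d) :
    coordDeriv i (∑ k ∈ s, f k) = ∑ k ∈ s, coordDeriv i (f k) := by
  ext x
  have h := (HasFDerivAt.sum (u := s)
    fun k _ => (differentiable_of_mem (hf k) x).hasFDerivAt).fderiv
  rw [coordDeriv, h]
  simp [coordDeriv]

section generator

variable {f : EuclideanSpace ℝ (Fin d) → ℝ} (hf : f ∈ smoothBounded d)

include hf

/-- The linear Taylor term has Gaussian mean 0 and the remainder is quadratic in √(2h) y, hence of
order h after integration. -/
lemma abs_P_heat_sub_le :
    ∃ C : ℝ, ∀ (h : ℝ≥0) (x : EuclideanSpace ℝ (Fin d)), |P (heat d) h f x - f x| ≤ C * h := by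
  obtain ⟨C, hC0, hC⟩ := (mem_smoothBounded.1 hf).taylor_one
  obtain ⟨B, -, hB⟩ := (mem_smoothBounded.1 hf).bounded
  set γ := stdGaussian (EuclideanSpace ℝ (Fin d))
  refine ⟨C * (2 * ∫ y, ‖y‖ ^ 2 ∂γ), fun h x => ?_⟩
  set c := √(2 * (h : ℝ)) with hc
  have hc2 : c ^ 2 = 2 * h := Real.sq_sqrt (by positivity)
  have hf1 : Integrable (fun y => f (x + c • y)) γ := by
    refine Integrable.of_bound ?_ B (ae_of_all _ fun y => hB _)
    exact (hf.1.continuous.comp (by fun_prop)).aestronglyMeasurable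
  have hi1 : Integrable (fun y => fderiv ℝ f x (c • y)) γ :=
    (fderiv ℝ f x).integrable_comp ((IsGaussian.integrable_id (μ := γ)).smul c)
  have h0 : ∫ y, fderiv ℝ f x (c • y) ∂γ = 0 := by
    simp only [map_smul, smul_eq_mul, integral_const_mul]
    rw [integral_strongDual_stdGaussian, mul_zero]
  have h1 : P (heat d) h f x - f x
      = ∫ y, (f (x + c • y) - f x - fderiv ℝ f x (c • y)) ∂γ := by
    have hf2 : Integrable (fun y => f (x + c • y) - f x) γ := hf1.sub (integrable_const _)
    rw [P_heat hf.1.continuous.measurable, integral_sub hf2 hi1, h0,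
      integral_sub hf1 (integrable_const _)]
    simp [γ, c]
  rw [h1, ← Real.norm_eq_abs]
  refine (norm_integral_le_of_norm_le
    (((integrable_norm_pow_stdGaussian 2).const_mul (c ^ 2)).const_mul C)
    (ae_of_all _ fun y => (hC x (c • y)).trans_eq ?_)).trans_eq ?_
  · rw [norm_smul, mul_pow, Real.norm_eq_abs, sq_abs]
  · rw [integral_const_mul, integral_const_mul, hc2]
    ring

/-- One order further: the covariance is the identity, so the quadratic term averages to h times the
trace of the Hessian, with an error of order h^{3/2}. -/
lemma tendsto_P_heat_sub (x : EuclideanSpace ℝ (Fin d)) :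
    Tendsto (fun h : ℝ≥0 => (P (heat d) h f x - f x) / h) (𝓝[>] (0 : ℝ≥0))
      (𝓝 (∑ i, coordDeriv i (coordDeriv i f) x)) := by
  obtain ⟨C, hC0, hC⟩ := (mem_smoothBounded.1 hf).taylor_two
  obtain ⟨B, -, hB⟩ := (mem_smoothBounded.1 hf).bounded
  set γ := stdGaussian (EuclideanSpace ℝ (Fin d))
  set l := ∑ i, coordDeriv i (coordDeriv i f) x with hl
  set M := C * (2 * ∫ y, ‖y‖ ^ 3 ∂γ) with hM
  have key : ∀ h : ℝ≥0, 0 < h →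
      ‖(P (heat d) h f x - f x) / h - l‖ ≤ M * √(2 * (h : ℝ)) := by
    intro h hpos
    have hpos' : (0 : ℝ) < h := hpos
    set c := √(2 * (h : ℝ)) with hc
    have hc0 : 0 ≤ c := Real.sqrt_nonneg _
    have hc2 : c ^ 2 = 2 * h := Real.sq_sqrt (by positivity)
    have hf1 : Integrable (fun y => f (x + c • y)) γ := by
      refine Integrable.of_bound ?_ B (ae_of_all _ fun y => hB _)
      exact (hf.1.continuous.comp (by fun_prop)).aestronglyMeasurable
    have hi1 : Integrable (fun y => fderiv ℝ f x (c • y)) γ :=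
      (fderiv ℝ f x).integrable_comp ((IsGaussian.integrable_id (μ := γ)).smul c)
    have h0 : ∫ y, fderiv ℝ f x (c • y) ∂γ = 0 := by
      simp only [map_smul, smul_eq_mul, integral_const_mul]
      rw [integral_strongDual_stdGaussian, mul_zero]
    have hB2 : ∫ y, (1 / 2 : ℝ) • fderiv ℝ (fderiv ℝ f) x (c • y) (c • y) ∂γ = h * l := by
      simp only [map_smul, smul_apply, smul_eq_mul, integral_const_mul]
      rw [integral_bilin_stdGaussian, hl]
      simp only [coordDeriv_coordDeriv hf]
      linear_combination (1 / 2 * ∑ i, fderiv ℝ (fderiv ℝ f) x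
        (EuclideanSpace.basisFun (Fin d) ℝ i) (EuclideanSpace.basisFun (Fin d) ℝ i)) * hc2
    have hi2 : Integrable
        (fun y => (1 / 2 : ℝ) • fderiv ℝ (fderiv ℝ f) x (c • y) (c • y)) γ := by
      refine (((integrable_norm_pow_stdGaussian 2).const_mul
        (1 / 2 * (‖fderiv ℝ (fderiv ℝ f) x‖ * c ^ 2)))).mono' ?_ (ae_of_all _ fun y => ?_)
      · exact Continuous.aestronglyMeasurable (by fun_prop)
      · have := (fderiv ℝ (fderiv ℝ f) x).le_opNorm₂ (c • y) (c • y)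
        rw [norm_smul, Real.norm_of_nonneg (by norm_num : (0 : ℝ) ≤ 1 / 2)]
        rw [norm_smul c y, Real.norm_of_nonneg hc0] at this
        nlinarith
    have h1 : P (heat d) h f x - f x - h * l
        = ∫ y, (f (x + c • y) - f x - fderiv ℝ f x (c • y)
          - (1 / 2 : ℝ) • fderiv ℝ (fderiv ℝ f) x (c • y) (c • y)) ∂γ := by
      have hf2 : Integrable (fun y => f (x + c • y) - f x) γ := hf1.sub (integrable_const _)
      have hf3 : Integrable (fun y => f (x + c • y) - f x - fderiv ℝ f x (c • y)) γ := hf2.sub hi1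
      rw [P_heat hf.1.continuous.measurable, integral_sub hf3 hi2, hB2, integral_sub hf2 hi1, h0,
        integral_sub hf1 (integrable_const _)]
      simp [γ, c]
    have h2 : ‖P (heat d) h f x - f x - h * l‖ ≤ M * c * h := by
      rw [h1]
      refine (norm_integral_le_of_norm_le
        (((integrable_norm_pow_stdGaussian 3).const_mul (c ^ 3)).const_mul C)
        (ae_of_all _ fun y => (hC x (c • y)).trans_eq ?_)).trans_eq ?_
      · rw [norm_smul, mul_pow, Real.norm_of_nonneg hc0]
      · rw [integral_const_mul, integral_const_mul, hM]
        linear_combination (C * c * ∫ y, ‖y‖ ^ 3 ∂γ) * hc2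
    have h3 : (P (heat d) h f x - f x) / h - l = (P (heat d) h f x - f x - h * l) / h := by
      field_simp
    rw [h3, norm_div, Real.norm_of_nonneg hpos'.le, div_le_iff₀ hpos']
    exact h2
  rw [tendsto_iff_norm_sub_tendsto_zero]
  refine squeeze_zero' (Eventually.of_forall fun _ => norm_nonneg _)
    (eventually_nhdsWithin_of_forall fun h hh => key h hh) ?_
  have : Tendsto (fun h : ℝ≥0 => M * √(2 * (h : ℝ))) (𝓝 0) (𝓝 (M * √(2 * ((0 : ℝ≥0) : ℝ)))) :=
    Continuous.tendsto (by fun_prop) 0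
  simp only [NNReal.coe_zero, mul_zero, Real.sqrt_zero] at this
  exact this.mono_left nhdsWithin_le_nhds

lemma inDomain_heat : InDomain (heat d) f where
  measurable := hf.1.continuous.measurable
  bounded := by
    obtain ⟨B, -, hB⟩ := (mem_smoothBounded.1 hf).bounded
    exact ⟨B, hB⟩
  quotient_bounded := abs_P_heat_sub_le hf
  tendsto x := ⟨_, tendsto_P_heat_sub hf x⟩

lemma L_heat : L (heat d) f = ∑ i, coordDeriv i (coordDeriv i f) := by
  ext x
  rw [Finset.sum_apply]
  exact L_eq_of_tendsto (tendsto_P_heat_sub hf x)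

lemma L_heat_eq_laplacian (x : EuclideanSpace ℝ (Fin d)) :
    L (heat d) f x = Laplacian.laplacian f x := by
  rw [L_heat hf, InnerProductSpace.laplacian_eq_iteratedFDeriv_orthonormalBasis f
    (EuclideanSpace.basisFun (Fin d) ℝ), Finset.sum_apply]
  simp [coordDeriv_coordDeriv hf, iteratedFDeriv_two_apply]

lemma L_heat_mem : L (heat d) f ∈ smoothBounded d := by
  rw [L_heat hf]
  exact sum_mem fun i _ => coordDeriv_mem (coordDeriv_mem hf i) i

end generator

/-! ### Diffusion property, Bochner formula and CD(0,d) -/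

lemma Gam_heat {f g : EuclideanSpace ℝ (Fin d) → ℝ} (hf : f ∈ smoothBounded d)
    (hg : g ∈ smoothBounded d) :
    Gam (heat d) f g = ∑ i, coordDeriv i f * coordDeriv i g := by
  have h1 := L_heat (mul_mem hf hg)
  have h2 : ∀ i, coordDeriv i (coordDeriv i (f * g))
      = f * coordDeriv i (coordDeriv i g) + g * coordDeriv i (coordDeriv i f)
        + 2 * (coordDeriv i f * coordDeriv i g) := fun i => by
    have hfi := coordDeriv_mem hf i
    have hgi := coordDeriv_mem hg i
    rw [coordDeriv_mul hf hg, coordDeriv_add (mul_mem hf hgi) (mul_mem hg hfi),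
      coordDeriv_mul hf hgi, coordDeriv_mul hg hfi]
    ring
  simp only [h2, Finset.sum_add_distrib, ← Finset.mul_sum, ← L_heat hf, ← L_heat hg] at h1
  ext x
  have h3 := L_mul (κ := heat d) f g x
  rw [h1] at h3
  simp only [Pi.add_apply, Pi.mul_apply, Pi.ofNat_apply] at h3
  linarith

lemma isDiffusion_heat (d : ℕ) : IsDiffusion (heat d) (smoothBounded d) where
  domain _ hf := inDomain_heat hf
  L_mem _ hf := L_heat_mem hf
  P_mem _ hf t := P_heat_mem hf t
  comp_mem _ hf _ hφ := BoundedSmooth.comp (mem_smoothBounded.1 hf) hφ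
  chain f hf φ hφ x := by
    have hφ' : ContDiff ℝ ∞ (deriv φ) := contDiff_infty_iff_deriv.1 hφ |>.2
    have hm : ∀ ψ : ℝ → ℝ, ContDiff ℝ ∞ ψ → (fun y => ψ (f y)) ∈ smoothBounded d :=
      fun ψ hψ => BoundedSmooth.comp (mem_smoothBounded.1 hf) hψ
    have h1 : ∀ i, coordDeriv i (coordDeriv i (fun y => φ (f y))) x
        = deriv φ (f x) * coordDeriv i (coordDeriv i f) x
          + deriv (deriv φ) (f x) * (coordDeriv i f x * coordDeriv i f x) := fun i => by
      rw [coordDeriv_comp hf i (hφ.differentiable (by simp))]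
      have := coordDeriv_mul (hm _ hφ') (coordDeriv_mem hf i) i
      rw [coordDeriv_comp hf i (hφ'.differentiable (by simp))] at this
      refine (congrFun this x).trans ?_
      simp only [Pi.add_apply, Pi.mul_apply]
      ring
    rw [L_heat (hm φ hφ), L_heat hf, Gam_heat hf hf]
    simp only [Finset.sum_apply, h1, Finset.sum_add_distrib, Finset.mul_sum, Pi.mul_apply]

lemma coordDeriv_L_heat {f : EuclideanSpace ℝ (Fin d) → ℝ} (hf : f ∈ smoothBounded d)
    (j : Fin d) : coordDeriv j (L (heat d) f) = L (heat d) (coordDeriv j f) := by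
  rw [L_heat hf, L_heat (coordDeriv_mem hf j),
    coordDeriv_sum _ fun i => coordDeriv_mem (coordDeriv_mem hf i) i]
  refine Finset.sum_congr rfl fun i _ => ?_
  rw [coordDeriv_comm (coordDeriv_mem hf i), coordDeriv_comm hf]

lemma L_heat_sum {ι : Type*} (s : Finset ι) {f : ι → EuclideanSpace ℝ (Fin d) → ℝ}
    (hf : ∀ k, f k ∈ smoothBounded d) :
    L (heat d) (∑ k ∈ s, f k) = ∑ k ∈ s, L (heat d) (f k) := by
  rw [L_heat (sum_mem fun k _ => hf k), Finset.sum_congr rfl fun k _ => L_heat (hf k),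
    Finset.sum_comm]
  refine Finset.sum_congr rfl fun i _ => ?_
  rw [coordDeriv_sum s hf, coordDeriv_sum s fun k => coordDeriv_mem (hf k) i]

/-- The Bochner formula on `ℝ^d`. -/
lemma Gam2_heat {f : EuclideanSpace ℝ (Fin d) → ℝ} (hf : f ∈ smoothBounded d)
    (x : EuclideanSpace ℝ (Fin d)) :
    Gam2 (heat d) f x = ∑ j, ∑ i, coordDeriv i (coordDeriv j f) x ^ 2 := by
  have hj := coordDeriv_mem hf
  have h1 : L (heat d) (Gam (heat d) f f) x
      = ∑ j, (2 * (coordDeriv j f x * L (heat d) (coordDeriv j f) x)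
        + 2 * ∑ i, coordDeriv i (coordDeriv j f) x ^ 2) := by
    rw [Gam_heat hf hf, L_heat_sum _ fun j => mul_mem (hj j) (hj j), Finset.sum_apply]
    refine Finset.sum_congr rfl fun j _ => ?_
    rw [L_mul, Gam_heat (hj j) (hj j), Finset.sum_apply]
    simp only [Pi.mul_apply, sq]
    ring
  have h2 : Gam (heat d) f (L (heat d) f) x
      = ∑ j, coordDeriv j f x * L (heat d) (coordDeriv j f) x := by
    rw [Gam_heat hf (L_heat_mem hf), Finset.sum_apply]
    simp only [Pi.mul_apply, coordDeriv_L_heat hf]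
  rw [Gam2, h1, h2, Finset.sum_add_distrib, ← Finset.mul_sum, ← Finset.mul_sum]
  ring

/-- (∑ ∂ᵢᵢf)² ≤ d ∑ (∂ᵢᵢf)², and the diagonal entries are part of the Hilbert–Schmidt norm of the
Hessian. -/
lemma CD_heat (hd : 1 ≤ d) : CD (heat d) (smoothBounded d) 0 d := by
  intro f hf x
  rw [Gam2_heat hf, L_heat hf, Finset.sum_apply, zero_mul, zero_add, ge_iff_le, one_div,
    inv_mul_le_iff₀ (by exact_mod_cast hd)]
  have h1 := sq_sum_le_card_mul_sum_sq (s := Finset.univ)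
    (f := fun i : Fin d => coordDeriv i (coordDeriv i f) x)
  rw [Finset.card_univ, Fintype.card_fin] at h1
  refine h1.trans (mul_le_mul_of_nonneg_left ?_ (Nat.cast_nonneg d))
  exact Finset.sum_le_sum fun j _ => Finset.single_le_sum
    (f := fun i => coordDeriv i (coordDeriv j f) x ^ 2) (fun i _ => sq_nonneg _)
    (Finset.mem_univ j)

end

section

variable {E : Type*} [MeasurableSpace E]
/-! ### Gaussian functions and the heat semigroup -/

variable {d : ℕ}

/-- Completing the square turns the integrand into a constant times the density of the Gaussian of
mean 2bcx/β and variance 1/β, β = 1 - 2bc². -/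
lemma integral_exp_sq_gaussianReal {b c : ℝ} (x : ℝ) (h : 0 < 1 - 2 * b * c ^ 2) :
    ∫ y, Real.exp (b * (x + c * y) ^ 2) ∂(gaussianReal 0 1)
      = Real.exp (-(1 / 2 * Real.log (1 - 2 * b * c ^ 2)) + b * x ^ 2 / (1 - 2 * b * c ^ 2)) := by
  set β := 1 - 2 * b * c ^ 2 with hβ
  set v : ℝ≥0 := ⟨β⁻¹, (inv_pos.2 h).le⟩ with hv
  have hv' : (v : ℝ) = β⁻¹ := rfl
  have hv0 : v ≠ 0 := by
    rw [← NNReal.coe_ne_zero, hv']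
    exact (inv_pos.2 h).ne'
  have hβ0 := h.ne'
  have hs : √β = Real.exp (1 / 2 * Real.log β) := by
    rw [Real.sqrt_eq_rpow, Real.rpow_def_of_pos h, mul_comm]
  have key : ∀ y, gaussianPDFReal 0 1 y • Real.exp (b * (x + c * y) ^ 2)
      = Real.exp (-(1 / 2 * Real.log β) + b * x ^ 2 / β)
        * gaussianPDFReal (2 * b * c * x / β) v y := by
    intro y
    rw [gaussianPDFReal, gaussianPDFReal, hv', ← div_eq_mul_inv, Real.sqrt_div' _ h.le, hs, inv_div,
      Real.exp_add, Real.exp_neg, smul_eq_mul, mul_assoc, ← Real.exp_add, NNReal.coe_one, mul_one]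
    have e : -(y - 0) ^ 2 / (2 * 1) + b * (x + c * y) ^ 2
        = b * x ^ 2 / β + -(y - 2 * b * c * x / β) ^ 2 / (2 * β⁻¹) := by
      field_simp
      rw [hβ]
      ring
    rw [e, Real.exp_add]
    field_simp
  rw [integral_gaussianReal_eq_integral_smul one_ne_zero, integral_congr_ae (ae_of_all _ key),
    integral_const_mul, integral_gaussianPDFReal_eq_one _ hv0, mul_one]

lemma integral_exp_norm_sq_stdGaussian {b c : ℝ} (x : EuclideanSpace ℝ (Fin d))
    (h : 0 < 1 - 2 * b * c ^ 2) :
    ∫ y, Real.exp (b * ‖x + c • y‖ ^ 2) ∂(stdGaussian (EuclideanSpace ℝ (Fin d)))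
      = Real.exp (-(d / 2 * Real.log (1 - 2 * b * c ^ 2))
        + b / (1 - 2 * b * c ^ 2) * ‖x‖ ^ 2) := by
  rw [← map_pi_eq_stdGaussian, integral_map (by fun_prop)
    (Continuous.aestronglyMeasurable (by fun_prop))]
  have e : ∀ y : Fin d → ℝ, Real.exp (b * ‖x + c • WithLp.toLp 2 y‖ ^ 2)
      = ∏ i, Real.exp (b * (x i + c * y i) ^ 2) := by
    intro y
    rw [EuclideanSpace.real_norm_sq_eq, Finset.mul_sum, Real.exp_sum]
    simp
  simp only [e]
  rw [integral_fintype_prod_eq_prod (f := fun i y => Real.exp (b * (x i + c * y) ^ 2))]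
  simp only [integral_exp_sq_gaussianReal _ h]
  rw [← Real.exp_sum, Finset.sum_add_distrib, EuclideanSpace.real_norm_sq_eq, Finset.mul_sum]
  congr 2
  · simp
    ring
  · exact Finset.sum_congr rfl fun i _ => by ring

lemma P_heat_gaussian (k : ℝ) {b : ℝ} (t : ℝ≥0) (h : 0 < 1 - 4 * b * t)
    (x : EuclideanSpace ℝ (Fin d)) :
    P (heat d) t (fun y => Real.exp (k + b * ‖y‖ ^ 2)) x
      = Real.exp (k - d / 2 * Real.log (1 - 4 * b * t) + b / (1 - 4 * b * t) * ‖x‖ ^ 2) := by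
  have e : 1 - 2 * b * √(2 * (t : ℝ)) ^ 2 = 1 - 4 * b * t := by
    rw [Real.sq_sqrt (by positivity)]
    ring
  rw [P_heat (Continuous.measurable (by fun_prop))]
  simp only [Real.exp_add k]
  rw [integral_const_mul, integral_exp_norm_sq_stdGaussian x (by rwa [e]), e, ← Real.exp_add]
  congr 1
  ring

lemma powMean_heat_gaussian (k : ℝ) {b q : ℝ} (u : ℝ≥0) (hq : q ≠ 0) (h : 0 < 1 - 4 * (q * b) * u)
    (x : EuclideanSpace ℝ (Fin d)) :
    powMean (heat d) u q (fun y => Real.exp (k + b * ‖y‖ ^ 2)) x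
      = ENNReal.ofReal (Real.exp (k - d / (2 * q) * Real.log (1 - 4 * (q * b) * u)
          + b / (1 - 4 * (q * b) * u) * ‖x‖ ^ 2)) := by
  have h1 := P_heat_gaussian (d := d) (q * k) u h x
  -- The Bochner integral of a non-integrable function is 0, so the nonzero value just computed
  -- proves integrability.
  have hi : Integrable (fun y => Real.exp (q * k + q * b * ‖y‖ ^ 2)) (heat d u x) := by
    refine Integrable.of_integral_ne_zero ?_
    change P (heat d) u _ x ≠ 0
    rw [h1]
    exact (Real.exp_pos _).ne'
  have h2 : ∫⁻ y, ENNReal.ofReal (Real.exp (k + b * ‖y‖ ^ 2)) ^ q ∂(heat d u x)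
      = ENNReal.ofReal (P (heat d) u (fun y => Real.exp (q * k + q * b * ‖y‖ ^ 2)) x) := by
    rw [P, ofReal_integral_eq_lintegral_ofReal hi (ae_of_all _ fun y => (Real.exp_pos _).le)]
    refine lintegral_congr fun y => ?_
    rw [ENNReal.ofReal_rpow_of_pos (Real.exp_pos _), ← Real.exp_mul]
    congr 2
    ring
  rw [powMean, h2, h1, ENNReal.ofReal_rpow_of_pos (Real.exp_pos _), ← Real.exp_mul]
  congr 2
  field_simp

/-- Gaussian functions stay Gaussian under P_t and powers, so both sides are explicit. The quadratic
exponents agree because t - s = u₁q₁ - u₂q₂; the choice of a makes the prefactors differ by exactly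
the constant, in both ranges of exponents. -/
lemma gaussExtremal_eq {q₁ q₂ : ℝ} (hq : Exponents q₁ q₂) {u₁ u₂ s t : ℝ≥0}
    (had : Admissible q₁ q₂ u₁ u₂ s t) (x : EuclideanSpace ℝ (Fin d)) :
    powMean (heat d) u₁ q₁ (gaussExtremal d q₁ u₁ u₂ s t) x ≠ 0 ∧
    powMean (heat d) u₁ q₁ (gaussExtremal d q₁ u₁ u₂ s t) x ≠ ⊤ ∧
    powMean (heat d) u₂ q₂ (P (heat d) (t - s) (gaussExtremal d q₁ u₁ u₂ s t)) x
      = powMean (heat d) u₁ q₁ (gaussExtremal d q₁ u₁ u₂ s t) x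
        * ENNReal.ofReal (Real.exp (d / 2 * logM q₁ q₂ u₁ u₂)) := by
  have hu₁ : 0 < (u₁ : ℝ) := had.1
  have hu₂ : 0 < (u₂ : ℝ) := had.2.1
  have hT := had.pos
  have hts := had.coe_sub
  have c1 : q₁ - 1 ≠ 0 := left_ne_zero_of_mul hq.one.ne'
  have c2 : q₂ - 1 ≠ 0 := right_ne_zero_of_mul hq.one.ne'
  have c3 : q₂ - q₁ ≠ 0 := left_ne_zero_of_mul hq.order.ne'
  have c4 : q₁ ≠ 0 := left_ne_zero_of_mul hq.zero.ne'
  have c5 : q₂ ≠ 0 := right_ne_zero_of_mul hq.zero.ne'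
  have hu₁' := hu₁.ne'
  have hu₂' := hu₂.ne'
  set T : ℝ := u₁ * q₁ - u₂ * q₂ with hTdef
  have hT' := hT.ne'
  set a : ℝ := (T + u₂ - u₁) / (4 * u₁ * T * (q₁ - 1)) with ha
  set β : ℝ := (u₂ * (q₂ - 1)) / (u₁ * (q₁ - 1)) with hβ
  set B : ℝ := u₂ * (q₂ - q₁) / (T * (q₁ - 1)) with hB
  have hβ0 : 0 < β := by
    have : β = u₂ * ((q₁ - 1) * (q₂ - 1)) / (u₁ * (q₁ - 1) ^ 2) := by rw [hβ]; field_simp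
    rw [this]
    have := hq.one
    positivity
  have hB0 : 0 < B := by
    have : B = u₂ * ((q₂ - q₁) * (q₁ - 1)) / (T * (q₁ - 1) ^ 2) := by rw [hB]; field_simp
    rw [this]
    have := hq.order
    positivity
  have hf : gaussExtremal d q₁ u₁ u₂ s t = fun y => Real.exp (0 + a * ‖y‖ ^ 2) := by
    ext y
    rw [gaussExtremal, had.2.2.2, zero_add]
  have e1 : 1 - 4 * a * ((t - s : ℝ≥0) : ℝ) = β := by
    rw [hts, ha, hβ]
    field_simp
    rw [hTdef]
    ring
  have e2 : 1 - 4 * (q₁ * a) * u₁ = B := by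
    rw [ha, hB]
    field_simp
    rw [hTdef]
    ring
  -- After multiplication by β this is 1 - 4aT - 4q₂au₂ = 1 - 4q₁au₁.
  have e3 : 1 - 4 * (q₂ * (a / β)) * u₂ = B / β := by
    rw [eq_div_iff hβ0.ne', ← e2]
    have : 4 * (q₂ * (a / β)) * u₂ * β = 4 * q₂ * a * u₂ := by field_simp
    rw [sub_mul, this, one_mul, ← e1, hts]
    ring
  have hPf : P (heat d) (t - s) (gaussExtremal d q₁ u₁ u₂ s t)
      = fun y => Real.exp (0 - d / 2 * Real.log β + a / β * ‖y‖ ^ 2) := by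
    ext y
    rw [hf, P_heat_gaussian 0 (t - s) (by rwa [e1]), e1]
  have h1 : powMean (heat d) u₁ q₁ (gaussExtremal d q₁ u₁ u₂ s t) x
      = ENNReal.ofReal (Real.exp (0 - d / (2 * q₁) * Real.log B + a / B * ‖x‖ ^ 2)) := by
    rw [hf, powMean_heat_gaussian 0 u₁ c4 (by rwa [e2]), e2]
  have h2 : powMean (heat d) u₂ q₂ (P (heat d) (t - s) (gaussExtremal d q₁ u₁ u₂ s t)) x
      = ENNReal.ofReal (Real.exp (0 - d / 2 * Real.log β - d / (2 * q₂) * Real.log (B / β)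
          + a / β / (B / β) * ‖x‖ ^ 2)) := by
    rw [hPf, powMean_heat_gaussian _ u₂ c5 (by rw [e3]; positivity), e3]
  refine ⟨?_, ?_, ?_⟩
  · rw [h1]
    exact (ENNReal.ofReal_pos.2 (Real.exp_pos _)).ne'
  · rw [h1]
    exact ENNReal.ofReal_ne_top
  -- B u₁(q₁ - 1) is the constant w of the interpolation path, so `logM_eq` applies with logarithms
  -- of B/β and B.
  · have hw : B * (u₁ * (q₁ - 1)) * T = u₁ * u₂ * (q₂ - q₁) := by
      rw [hB]
      field_simp
    have h3 := logM_eq hq hu₁ hu₂ hT hw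
    have e4 : B * (u₁ * (q₁ - 1)) / (u₂ * (q₂ - 1)) = B / β := by rw [hβ]; field_simp
    have e5 : B * (u₁ * (q₁ - 1)) / (u₁ * (q₁ - 1)) = B := by field_simp
    rw [e4, e5] at h3
    rw [h1, h2, ← ENNReal.ofReal_mul (Real.exp_pos _).le, ← Real.exp_add, h3,
      div_div_div_cancel_right₀ hβ0.ne', Real.log_div hB0.ne' hβ0.ne']
    congr 2
    field_simp
    ring

end

end MarkovSG

end

/-! ### The theorem -/

open MarkovSG in
theorem mainTheorem1 :
    (∀ (E : Type*) [MeasurableSpace E] (κ : ℝ≥0 → Kernel E E) (A : Subalgebra ℝ (E → ℝ)),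
      IsMarkov κ → IsDiffusion κ A → ∀ n : ℝ, 1 ≤ n →
        List.TFAE [CD κ A 0 n, LocalLogSobolev κ A n, Hypercontractive κ A n,
          ReverseHypercontractive κ A n]) ∧
    (∀ d : ℕ, 1 ≤ d →
      -- the Euclidean heat semigroup is a diffusion with generator `Δ`, satisfying `CD(0, d)`
      IsMarkov (heat d) ∧ IsDiffusion (heat d) (smoothBounded d) ∧
      (∀ f ∈ smoothBounded d, ∀ x, L (heat d) f x = Laplacian.laplacian f x) ∧
      CD (heat d) (smoothBounded d) 0 d ∧
      -- both bounds are equalities, with finite positive sides, at Gaussian functions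
      (∀ (q₁ q₂ : ℝ) (u₁ u₂ s t : ℝ≥0), 1 < q₁ → q₁ < q₂ → Admissible q₁ q₂ u₁ u₂ s t →
        ∀ x, powMean (heat d) u₁ q₁ (gaussExtremal d q₁ u₁ u₂ s t) x ≠ 0 ∧
          powMean (heat d) u₁ q₁ (gaussExtremal d q₁ u₁ u₂ s t) x ≠ ⊤ ∧
          powMean (heat d) u₂ q₂ (P (heat d) (t - s) (gaussExtremal d q₁ u₁ u₂ s t)) x
            = powMean (heat d) u₁ q₁ (gaussExtremal d q₁ u₁ u₂ s t) x
              * ENNReal.ofReal (constM q₁ q₂ u₁ u₂ ^ ((d : ℝ) / 2))) ∧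
      (∀ (q₁ q₂ : ℝ) (u₁ u₂ s t : ℝ≥0), ReverseExponents q₁ q₂ → Admissible q₁ q₂ u₁ u₂ s t →
        ∀ x, powMean (heat d) u₁ q₁ (gaussExtremal d q₁ u₁ u₂ s t) x ≠ 0 ∧
          powMean (heat d) u₁ q₁ (gaussExtremal d q₁ u₁ u₂ s t) x ≠ ⊤ ∧
          powMean (heat d) u₁ q₁ (gaussExtremal d q₁ u₁ u₂ s t) x
            = powMean (heat d) u₂ q₂ (P (heat d) (t - s) (gaussExtremal d q₁ u₁ u₂ s t)) x
              * ENNReal.ofReal (constN q₁ q₂ u₁ u₂ ^ ((d : ℝ) / 2)))) := by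
  refine ⟨fun E _ κ A hκ hA n hn => tfae_CD hκ hA (by linarith), fun d hd =>
    ⟨isMarkov_heat d, isDiffusion_heat d, fun f hf x => L_heat_eq_laplacian hf x, CD_heat hd,
      fun q₁ q₂ u₁ u₂ s t h1 h2 had x => ?_, fun q₁ q₂ u₁ u₂ s t hq had x => ?_⟩⟩
  · rw [constM_eq_exp h1 h2 (NNReal.coe_pos.2 had.1) (NNReal.coe_pos.2 had.2.1) had.pos]
    exact gaussExtremal_eq (exponents_of_one_lt h1 h2) had x
  -- The same Gaussian identity, inverted: the reverse constant is the exponential of the opposite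
  -- exponent.
  · obtain ⟨h0, htop, heq⟩ := gaussExtremal_eq hq.exponents had x
    refine ⟨h0, htop, ?_⟩
    rw [constN_eq_exp hq.lt_one hq.lt (NNReal.coe_pos.2 had.1) (NNReal.coe_pos.2 had.2.1) had.pos,
      heq, mul_assoc, ← ENNReal.ofReal_mul (Real.exp_pos _).le, ← Real.exp_add, add_neg_cancel,
      Real.exp_zero, ENNReal.ofReal_one, mul_one]
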